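/- **Theorem 4.1.** Let $r\ge 1$, $\omega=(\omega_1,\dots,\omega_r)\in\mathbb{R}^r$ and $\rho>0$, and put $D_\rho=\{\theta\in\mathbb{C}^r: |\mathrm{Im}\,\theta_j|\le\rho,\ j=1,\dots,r\}$. Let $a:\mathbb{R}\to\mathbb{R}$ be analytic quasi-periodic on $D_\rho$ with frequencies $\omega$, i.e. $a(t)=F(\omega_1t,\dots,\omega_rt)$ for some function $F$ that is analytic on $D_\rho$ and $2\pi$-periodic in each argument. Assume that the average $\bar a=\lim_{T\to\infty}\frac1{2T}\int_{-T}^{T}a(t)\,dt$ is positive, and that for some $\alpha>0$ and $\tau>r-1$ $$|\langle k,\omega\rangle|\ge\frac{\alpha}{|k|^{\tau}}\qquad\text{for all }k\in\mathbb{Z}^r\setminus\{0\},\qquad |k|=|k_1|+\dots+|k_r|.$$ Write Hill's equation $\ddot x+\varepsilon a(t)x=0$ as the Hamiltonian system $$\dot z=(A+\varepsilon Q(t))z,\qquad z=\begin{pmatrix}x\\ \dot x\end{pmatrix},\quad A=\begin{pmatrix}0&1\\0&0\end{pmatrix},\quad Q(t)=\begin{pmatrix}0&0\\-a(t)&0\end{pmatrix}.\tag{$*$}$$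 Then there are $\varepsilon_{\max}>0$ and, for every $\varepsilon_0\in(0,\varepsilon_{\max}]$, a (nonempty) Cantor set $E_{\varepsilon_0}\subset(0,\varepsilon_0)$ (a compact, perfect, totally disconnected set) of positive Lebesgue measure such that for every $\varepsilon\in E_{\varepsilon_0}$ the system $(*)$ is reducible: there are a constant real Hamiltonian matrix $B$ and a change of variables $z=\psi(t)y$, with $\psi(t)$ a real symplectic $2\times2$ matrix for every $t$, such that $\psi$ and $\psi^{-1}$ are bounded and analytic quasi-periodic with frequencies $\omega$ on $D_{\rho'}$ for some $\rho'>0$, and which changes $(*)$ into $\dot y=By$. Moreover, the relative measure of $E_{\varepsilon_0}$ in $(0,\varepsilon_0)$ tends to one: $$\lim_{\varepsilon_0\to0^+}\frac{\mathrm{meas}(E_{\varepsilon_0})}{\varepsilon_0}=1.$$ -/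

import Mathlib

open Set Filter Topology MeasureTheory Matrix

namespace QPHill

/-- The closed complex strip `D_ρ = {θ ∈ ℂ^r : |Im θ_j| ≤ ρ for all j}`. -/
def strip (r : ℕ) (ρ : ℝ) : Set (Fin r → ℂ) := {θ | ∀ j, |(θ j).im| ≤ ρ}

/-- `f` is (real-valued) analytic quasi-periodic on `D_ρ` with frequencies `ω`:
`f(t) = F(ω₁ t, …, ω_r t)` with `F` analytic on `D_ρ` and `2π`-periodic in each argument. -/
def IsAnalyticQP {r : ℕ} (ω : Fin r → ℝ) (ρ : ℝ) (f : ℝ → ℝ) : Prop :=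
  ∃ F : (Fin r → ℂ) → ℂ,
    AnalyticOnNhd ℂ F (strip r ρ) ∧
    (∀ θ ∈ strip r ρ, ∀ j, F (Function.update θ j (θ j + 2 * (Real.pi : ℂ))) = F θ) ∧
    ∀ t : ℝ, (f t : ℂ) = F (fun j => ((ω j * t : ℝ) : ℂ))

/-- A `2 × 2` matrix function is analytic quasi-periodic on `D_ρ` if all its entries are. -/
def IsAnalyticQPMatrix {r : ℕ} (ω : Fin r → ℝ) (ρ : ℝ)
    (P : ℝ → Matrix (Fin 2) (Fin 2) ℝ) : Prop :=
  ∀ i j, IsAnalyticQP ω ρ (fun t => P t i j)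

/-- `|⟨k, ω⟩| ≥ α / |k|^τ` for all nonzero integer vectors `k`, where `|k| = ∑ |k_j|`. -/
def IsDiophantine {r : ℕ} (ω : Fin r → ℝ) (α τ : ℝ) : Prop :=
  ∀ k : Fin r → ℤ, k ≠ 0 → α / (∑ j, |(k j : ℝ)|) ^ τ ≤ |∑ j, (k j : ℝ) * ω j|

/-- The average of `f` exists and equals `m`: `m = lim_{T → ∞} (1 / 2T) ∫_{-T}^{T} f(t) dt`. -/
def HasAverage (f : ℝ → ℝ) (m : ℝ) : Prop :=
  Tendsto (fun T : ℝ => (1 / (2 * T)) * ∫ t in (-T)..T, f t) atTop (𝓝 m)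

/-- The standard symplectic matrix in dimension two. -/
def J : Matrix (Fin 2) (Fin 2) ℝ := !![0, 1; -1, 0]

def IsSymplectic (M : Matrix (Fin 2) (Fin 2) ℝ) : Prop := Mᵀ * J * M = J

/-- `B` is Hamiltonian, i.e. `B = J S` with `S` symmetric. -/
def IsHamiltonian (B : Matrix (Fin 2) (Fin 2) ℝ) : Prop :=
  ∃ S : Matrix (Fin 2) (Fin 2) ℝ, S.IsSymm ∧ B = J * S

/-- `z` is a (global) solution of the linear system `z' = M(t) z`. -/
def IsSolution (M : ℝ → Matrix (Fin 2) (Fin 2) ℝ) (z : ℝ → Fin 2 → ℝ) : Prop :=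
  ∀ t, HasDerivAt z (M t *ᵥ z t) t

/-- The Hamiltonian system `z' = M(t) z` is reducible: there is a nonsingular symplectic change of
variables `z = ψ(t) y`, where `ψ` and `ψ⁻¹` are bounded and analytic quasi-periodic with
frequencies `ω`, which changes the system into a Hamiltonian system `y' = B y` with `B`
constant. -/
def IsReducible {r : ℕ} (ω : Fin r → ℝ) (M : ℝ → Matrix (Fin 2) (Fin 2) ℝ) : Prop :=
  ∃ (ψ : ℝ → Matrix (Fin 2) (Fin 2) ℝ) (B : Matrix (Fin 2) (Fin 2) ℝ),
    (∃ ρ' : ℝ, 0 < ρ' ∧ IsAnalyticQPMatrix ω ρ' ψ ∧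
      IsAnalyticQPMatrix ω ρ' (fun t => (ψ t)⁻¹)) ∧
    (∃ C : ℝ, ∀ t i j, |ψ t i j| ≤ C ∧ |(ψ t)⁻¹ i j| ≤ C) ∧
    (∀ t, IsUnit (ψ t).det) ∧
    (∀ t, IsSymplectic (ψ t)) ∧
    IsHamiltonian B ∧
    ∀ y : ℝ → Fin 2 → ℝ,
      IsSolution M (fun t => ψ t *ᵥ y t) ↔ IsSolution (fun _ => B) y

/-- A Cantor set in `ℝ`: nonempty, compact, perfect and totally disconnected. -/
def IsCantorSet (E : Set ℝ) : Prop :=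
  E.Nonempty ∧ IsCompact E ∧ Perfect E ∧ IsTotallyDisconnected E

def hillA : Matrix (Fin 2) (Fin 2) ℝ := !![0, 1; 0, 0]

def hillQ (a : ℝ → ℝ) (t : ℝ) : Matrix (Fin 2) (Fin 2) ℝ := !![0, 0; -a t, 0]

end QPHill

/-! The parameter ε is treated as an unknown and the Floquet exponent μ as the given datum. For
small μ > 0 with 2μ nonresonant relative to ω, one looks for ε and a quasi-periodic u = 1 + w such
that e^{iμt}u solves Hill's equation, that is u'' + 2iμu' + (εa - μ²)u = 0. Fixing μ fixes the small
divisors ⟨k,ω⟩ and ⟨k,ω⟩ + 2μ during the whole iteration, so no parameters have to be removed step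
by step.

The equation is solved by a Newton scheme with multiplicative corrections u ↦ u(1+y), in Fourier
coefficients with weighted ℓ¹ norms. Multiplied by u, the linearised equation factors: p = u²y'
satisfies p' + 2iμp = -(e + δau²), and then y' = u⁻²p must have mean zero. The correction δ of ε
makes both mean conditions solvable without dividing by the small number μ (`exists_correction`).
The new residual is exactly (y + y²)(e + δau²), hence quadratically small (`newton_step`), and the
scheme converges with w = O(μ²) (`exists_floquet`).

Everything needed about μ ↦ ε follows from one Wronskian identity (`Floquet.pair_estimate`):
averaged in time, the Wronskian of one solution with the conjugate of another shows that (ε - δ̄)ā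
and μ² - ν² agree up to a small relative error. A solution paired with itself gives real ε; paired
with the trivial solution, ε ≈ μ²/ā; two solutions paired together show that ε is a bi-Lipschitz
function of μ², with no smooth dependence required.

The real and imaginary parts of u and of u' + iμu form, after normalisation of the constant
Wronskian, a symplectic matrix conjugating the system to a rotation (`Floquet.reducible`). Resonant
exponents below μ₀ have measure O(μ₀²) (`exists_resonant_bound`), so their image under μ²/ā has
measure O(μ₀³), against a range of length μ₀²/ā. The good parameters below ε₀ = s² therefore contain
a compact set of measure at least s²(1 - Ds) (`exists_compact_image`), and a Cantor set inside it
loses only another O(s³) (`exists_cantor_subset`). -/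

open Set Filter Topology MeasureTheory Matrix

/-! ### Weighted ℓ¹ algebra of Fourier coefficients. -/

namespace QPHill

open Complex (I)

variable {r : ℕ}

/-- The `ℓ¹` length of an integer vector. -/
def len (k : Fin r → ℤ) : ℝ := ∑ j, |(k j : ℝ)|

/-- The frequency `⟨k, ω⟩`. -/
def freq (ω : Fin r → ℝ) (k : Fin r → ℤ) : ℝ := ∑ j, (k j : ℝ) * ω j

lemma len_nonneg (k : Fin r → ℤ) : 0 ≤ len k := Finset.sum_nonneg fun _ _ => abs_nonneg _

@[simp] lemma len_zero : len (0 : Fin r → ℤ) = 0 := by simp [len]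

@[simp] lemma freq_zero (ω : Fin r → ℝ) : freq ω 0 = 0 := by simp [freq]

lemma len_add_le (k l : Fin r → ℤ) : len (k + l) ≤ len k + len l := by
  unfold len
  rw [← Finset.sum_add_distrib]
  refine Finset.sum_le_sum fun j _ => ?_
  simpa using abs_add_le (k j : ℝ) (l j)

lemma len_neg (k : Fin r → ℤ) : len (-k) = len k := by simp [len]

lemma freq_add (ω : Fin r → ℝ) (k l : Fin r → ℤ) : freq ω (k + l) = freq ω k + freq ω l := by
  simp [freq, add_mul, Finset.sum_add_distrib]

lemma freq_neg (ω : Fin r → ℝ) (k : Fin r → ℤ) : freq ω (-k) = -freq ω k := by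
  simp [freq]

lemma one_le_len {k : Fin r → ℤ} (hk : k ≠ 0) : 1 ≤ len k := by
  obtain ⟨j, hj⟩ := Function.ne_iff.1 hk
  have h1 : (1 : ℝ) ≤ |(k j : ℝ)| := by
    have := Int.one_le_abs hj
    exact_mod_cast this
  exact h1.trans (Finset.single_le_sum (f := fun j => |(k j : ℝ)|)
    (fun _ _ => abs_nonneg _) (Finset.mem_univ j))

lemma abs_freq_le (ω : Fin r → ℝ) : ∃ W : ℝ, 0 < W ∧ ∀ k, |freq ω k| ≤ W * len k := by
  refine ⟨1 + ∑ j, |ω j|, by positivity, fun k => ?_⟩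
  unfold freq len
  refine (Finset.abs_sum_le_sum_abs _ _).trans ?_
  rw [Finset.mul_sum]
  refine Finset.sum_le_sum fun j _ => ?_
  rw [abs_mul, mul_comm]
  refine mul_le_mul_of_nonneg_right ?_ (abs_nonneg _)
  have := Finset.single_le_sum (f := fun j => |ω j|) (fun _ _ => abs_nonneg _) (Finset.mem_univ j)
  linarith

/-- The weighted `ℓ¹` norm of the coefficient family `c` is at most `M`. -/
def Bd (ρ : ℝ) (c : (Fin r → ℤ) → ℂ) (M : ℝ) : Prop :=
  Summable (fun k => ‖c k‖ * Real.exp (ρ * len k)) ∧ ∑' k, ‖c k‖ * Real.exp (ρ * len k) ≤ M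

lemma Bd.nonneg {ρ M : ℝ} {c : (Fin r → ℤ) → ℂ} (h : Bd ρ c M) : 0 ≤ M :=
  (tsum_nonneg fun _ => by positivity).trans h.2

lemma Bd.of_le {ρ ρ' M M' : ℝ} {c d : (Fin r → ℤ) → ℂ} (h : Bd ρ c M)
    {C : ℝ} (hC : 0 ≤ C) (hM : C * M ≤ M')
    (hd : ∀ k, ‖d k‖ * Real.exp (ρ' * len k) ≤ C * (‖c k‖ * Real.exp (ρ * len k))) :
    Bd ρ' d M' := by
  have hs : Summable (fun k => ‖d k‖ * Real.exp (ρ' * len k)) :=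
    Summable.of_nonneg_of_le (fun _ => by positivity) hd (h.1.mul_left C)
  refine ⟨hs, ?_⟩
  calc _ ≤ ∑' k, C * (‖c k‖ * Real.exp (ρ * len k)) := hs.tsum_le_tsum hd (h.1.mul_left C)
    _ = C * ∑' k, (‖c k‖ * Real.exp (ρ * len k)) := tsum_mul_left
    _ ≤ C * M := mul_le_mul_of_nonneg_left h.2 hC
    _ ≤ M' := hM

lemma Bd.mono {ρ ρ' M M' : ℝ} {c : (Fin r → ℤ) → ℂ} (h : Bd ρ c M) (hρ : ρ' ≤ ρ) (hM : M ≤ M') :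
    Bd ρ' c M' := by
  refine h.of_le zero_le_one (by simpa using hM) fun k => ?_
  rw [one_mul]
  have := len_nonneg k
  gcongr

lemma Bd.add {ρ M M' : ℝ} {c d : (Fin r → ℤ) → ℂ} (h : Bd ρ c M) (h' : Bd ρ d M') :
    Bd ρ (c + d) (M + M') := by
  have key : ∀ k, ‖(c + d) k‖ * Real.exp (ρ * len k) ≤
      ‖c k‖ * Real.exp (ρ * len k) + ‖d k‖ * Real.exp (ρ * len k) := fun k => by
    rw [← add_mul]
    exact mul_le_mul_of_nonneg_right (norm_add_le _ _) (Real.exp_pos _).le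
  have hs : Summable (fun k => ‖(c + d) k‖ * Real.exp (ρ * len k)) :=
    Summable.of_nonneg_of_le (fun _ => by positivity) key (h.1.add h'.1)
  refine ⟨hs, (hs.tsum_le_tsum key (h.1.add h'.1)).trans ?_⟩
  rw [h.1.tsum_add h'.1]
  exact add_le_add h.2 h'.2

lemma Bd.smul {ρ M : ℝ} {c : (Fin r → ℤ) → ℂ} (h : Bd ρ c M) (z : ℂ) :
    Bd ρ (z • c) (‖z‖ * M) :=
  h.of_le (norm_nonneg z) le_rfl fun k => by simp [mul_assoc]

lemma Bd.neg {ρ M : ℝ} {c : (Fin r → ℤ) → ℂ} (h : Bd ρ c M) : Bd ρ (-c) M :=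
  h.of_le zero_le_one (by simp) fun k => by simp

lemma Bd.sub {ρ M M' : ℝ} {c d : (Fin r → ℤ) → ℂ} (h : Bd ρ c M) (h' : Bd ρ d M') :
    Bd ρ (c - d) (M + M') := by
  rw [sub_eq_add_neg]; exact h.add h'.neg

/-- The coefficients of the constant function `1`. -/
def one : (Fin r → ℤ) → ℂ := Pi.single 0 1

lemma one_zero : (one : (Fin r → ℤ) → ℂ) 0 = 1 := by simp [one]

lemma one_ne {k : Fin r → ℤ} (hk : k ≠ 0) : one k = 0 := by simp [one, hk]

lemma bd_one (ρ : ℝ) : Bd ρ (one : (Fin r → ℤ) → ℂ) 1 := by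
  have h : HasSum (fun k => ‖(one : (Fin r → ℤ) → ℂ) k‖ * Real.exp (ρ * len k)) 1 := by
    convert hasSum_single (0 : Fin r → ℤ) ?_ using 1
    · simp [one_zero]
    · intro k hk; simp [one_ne hk]
  exact ⟨h.summable, h.tsum_eq.le⟩

lemma Bd.norm_apply_le {ρ M : ℝ} {c : (Fin r → ℤ) → ℂ} (h : Bd ρ c M) (k : Fin r → ℤ) :
    ‖c k‖ * Real.exp (ρ * len k) ≤ M :=
  (h.1.le_tsum k fun _ _ => by positivity).trans h.2

lemma Bd.norm_zero_le {ρ M : ℝ} {c : (Fin r → ℤ) → ℂ} (h : Bd ρ c M) : ‖c 0‖ ≤ M := by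
  simpa using h.norm_apply_le 0

lemma Bd.summable_norm {ρ M : ℝ} {c : (Fin r → ℤ) → ℂ} (h : Bd ρ c M) (hρ : 0 ≤ ρ) :
    Summable (fun k => ‖c k‖) := by
  simpa using (h.mono hρ le_rfl).1

lemma Bd.tsum_norm_le {ρ M : ℝ} {c : (Fin r → ℤ) → ℂ} (h : Bd ρ c M) (hρ : 0 ≤ ρ) :
    ∑' k, ‖c k‖ ≤ M := by
  simpa using (h.mono hρ le_rfl).2

/-- The character `t ↦ exp(i⟨k,ω⟩t)`. -/
noncomputable def chr (ω : Fin r → ℝ) (k : Fin r → ℤ) (t : ℝ) : ℂ := Complex.exp ((freq ω k * t : ℝ) * I)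

lemma norm_chr (ω : Fin r → ℝ) (k : Fin r → ℤ) (t : ℝ) : ‖chr ω k t‖ = 1 :=
  Complex.norm_exp_ofReal_mul_I _

lemma chr_add (ω : Fin r → ℝ) (k l : Fin r → ℤ) (t : ℝ) :
    chr ω (k + l) t = chr ω k t * chr ω l t := by
  rw [chr, chr, chr, ← Complex.exp_add, freq_add]; congr 1; push_cast; ring

lemma chr_zero (ω : Fin r → ℝ) (t : ℝ) : chr ω 0 t = 1 := by simp [chr]

lemma hasDerivAt_chr (ω : Fin r → ℝ) (k : Fin r → ℤ) (t : ℝ) :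
    HasDerivAt (chr ω k) (I * freq ω k * chr ω k t) t := by
  have h1 : HasDerivAt (fun t : ℝ => ((freq ω k * t : ℝ) : ℂ)) ((freq ω k : ℝ) : ℂ) t := by
    have := ((hasDerivAt_id t).const_mul (freq ω k)).ofReal_comp
    simpa using this
  refine (h1.mul_const I).cexp.congr_deriv ?_
  unfold chr
  ring

/-- The quasi-periodic function with coefficients `c`. -/
noncomputable def ev (ω : Fin r → ℝ) (c : (Fin r → ℤ) → ℂ) (t : ℝ) : ℂ := ∑' k, c k * chr ω k t

lemma Bd.summable_ev {ρ M : ℝ} {c : (Fin r → ℤ) → ℂ} (h : Bd ρ c M) (hρ : 0 ≤ ρ)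
    (ω : Fin r → ℝ) (t : ℝ) : Summable (fun k => c k * chr ω k t) :=
  Summable.of_norm (by simpa [norm_chr] using h.summable_norm hρ)

lemma Bd.norm_ev_le {ρ M : ℝ} {c : (Fin r → ℤ) → ℂ} (h : Bd ρ c M) (hρ : 0 ≤ ρ)
    (ω : Fin r → ℝ) (t : ℝ) : ‖ev ω c t‖ ≤ M := by
  refine (norm_tsum_le_tsum_norm (by simpa [norm_chr] using h.summable_norm hρ)).trans ?_
  simpa [norm_chr] using h.tsum_norm_le hρ

lemma ev_one (ω : Fin r → ℝ) (t : ℝ) : ev ω one t = 1 := by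
  rw [ev, tsum_eq_single 0]
  · simp [one_zero, chr_zero]
  · intro k hk; simp [one_ne hk]

lemma ev_smul (ω : Fin r → ℝ) (z : ℂ) (c : (Fin r → ℤ) → ℂ) (t : ℝ) :
    ev ω (z • c) t = z * ev ω c t := by
  simp [ev, mul_assoc, tsum_mul_left]

lemma ev_neg (ω : Fin r → ℝ) (c : (Fin r → ℤ) → ℂ) (t : ℝ) : ev ω (-c) t = -ev ω c t := by
  simp [ev, tsum_neg]

lemma ev_add {ρ ρ' M M' : ℝ} {c d : (Fin r → ℤ) → ℂ} (h : Bd ρ c M) (hρ : 0 ≤ ρ)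
    (h' : Bd ρ' d M') (hρ' : 0 ≤ ρ') (ω : Fin r → ℝ) (t : ℝ) :
    ev ω (c + d) t = ev ω c t + ev ω d t := by
  simp only [ev, Pi.add_apply, add_mul]
  exact (h.summable_ev hρ ω t).tsum_add (h'.summable_ev hρ' ω t)

lemma ev_sub {ρ ρ' M M' : ℝ} {c d : (Fin r → ℤ) → ℂ} (h : Bd ρ c M) (hρ : 0 ≤ ρ)
    (h' : Bd ρ' d M') (hρ' : 0 ≤ ρ') (ω : Fin r → ℝ) (t : ℝ) :
    ev ω (c - d) t = ev ω c t - ev ω d t := by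
  rw [sub_eq_add_neg, ev_add h hρ h'.neg hρ', ev_neg, sub_eq_add_neg]

/-- Convolution of coefficient families. -/
noncomputable def conv (c d : (Fin r → ℤ) → ℂ) (k : Fin r → ℤ) : ℂ := ∑' j, c j * d (k - j)

/-- The shear `(k, j) ↦ (j, k - j)`. -/
def shear (r : ℕ) : (Fin r → ℤ) × (Fin r → ℤ) ≃ (Fin r → ℤ) × (Fin r → ℤ) where
  toFun p := (p.2, p.1 - p.2)
  invFun p := (p.1 + p.2, p.1)
  left_inv p := by simp
  right_inv p := by simp

/-- The weight e^{ρ|k|} is submultiplicative along k = j + (k - j), so the weighted ℓ¹ space is a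
Banach algebra; the double sum is reorganised by `shear`. -/
lemma Bd.conv {ρ M M' : ℝ} {c d : (Fin r → ℤ) → ℂ} (h : Bd ρ c M) (h' : Bd ρ d M') (hρ : 0 ≤ ρ) :
    Bd ρ (conv c d) (M * M') := by
  set A : (Fin r → ℤ) → ℝ := fun k => ‖c k‖ * Real.exp (ρ * len k) with hA
  set B : (Fin r → ℤ) → ℝ := fun k => ‖d k‖ * Real.exp (ρ * len k) with hB
  have hA0 : ∀ k, 0 ≤ A k := fun k => by positivity
  have hB0 : ∀ k, 0 ≤ B k := fun k => by positivity
  have hAB : Summable fun p : (Fin r → ℤ) × (Fin r → ℤ) => A p.1 * B p.2 :=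
    h.1.mul_of_nonneg h'.1 hA0 hB0
  have hG : Summable fun p : (Fin r → ℤ) × (Fin r → ℤ) => A p.2 * B (p.1 - p.2) :=
    (shear r).summable_iff.2 hAB
  have hpt : ∀ k j, ‖c j * d (k - j)‖ * Real.exp (ρ * len k) ≤ A j * B (k - j) := fun k j => by
    have h1 : Real.exp (ρ * len k) ≤ Real.exp (ρ * len j) * Real.exp (ρ * len (k - j)) := by
      rw [← Real.exp_add, ← mul_add]
      have := len_add_le j (k - j)
      rw [add_sub_cancel] at this
      gcongr
    calc _ ≤ ‖c j‖ * ‖d (k - j)‖ * (Real.exp (ρ * len j) * Real.exp (ρ * len (k - j))) := by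
          rw [norm_mul]; gcongr
      _ = _ := by simp only [hA, hB]; ring
  have hsec : ∀ k, Summable fun j => A j * B (k - j) := fun k => hG.prod_factor k
  have hbd : ∀ k, ‖QPHill.conv c d k‖ * Real.exp (ρ * len k) ≤ ∑' j, A j * B (k - j) := fun k => by
    have hs : Summable fun j => ‖c j * d (k - j)‖ * Real.exp (ρ * len k) :=
      Summable.of_nonneg_of_le (fun _ => by positivity) (hpt k) (hsec k)
    have hs' : Summable fun j => ‖c j * d (k - j)‖ :=
      (summable_mul_right_iff (Real.exp_pos _).ne').1 hs
    calc _ ≤ (∑' j, ‖c j * d (k - j)‖) * Real.exp (ρ * len k) := by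
          gcongr; exact norm_tsum_le_tsum_norm hs'
      _ = ∑' j, ‖c j * d (k - j)‖ * Real.exp (ρ * len k) := tsum_mul_right.symm
      _ ≤ _ := hs.tsum_le_tsum (hpt k) (hsec k)
  have hs2 : Summable fun k => ∑' j, A j * B (k - j) := hG.prod
  have hs1 : Summable fun k => ‖QPHill.conv c d k‖ * Real.exp (ρ * len k) :=
    Summable.of_nonneg_of_le (fun _ => by positivity) hbd hs2
  refine ⟨hs1, (hs1.tsum_le_tsum hbd hs2).trans ?_⟩
  rw [← hG.tsum_prod]
  have e1 : ∑' p : (Fin r → ℤ) × (Fin r → ℤ), A p.2 * B (p.1 - p.2) =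
      ∑' p : (Fin r → ℤ) × (Fin r → ℤ), A p.1 * B p.2 :=
    (shear r).tsum_eq (fun p => A p.1 * B p.2)
  rw [e1, ← h.1.tsum_mul_tsum h'.1 hAB]
  exact mul_le_mul h.2 h'.2 (tsum_nonneg hB0) h.nonneg

lemma ev_conv {ρ ρ' M M' : ℝ} {c d : (Fin r → ℤ) → ℂ} (h : Bd ρ c M) (hρ : 0 ≤ ρ)
    (h' : Bd ρ' d M') (hρ' : 0 ≤ ρ') (ω : Fin r → ℝ) (t : ℝ) :
    ev ω (conv c d) t = ev ω c t * ev ω d t := by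
  have h1 : Summable fun k => ‖c k * chr ω k t‖ := by simpa [norm_chr] using h.summable_norm hρ
  have h2 : Summable fun k => ‖d k * chr ω k t‖ := by simpa [norm_chr] using h'.summable_norm hρ'
  have h3 := summable_mul_of_summable_norm h1 h2
  have h4 : Summable fun p : (Fin r → ℤ) × (Fin r → ℤ) =>
      (c p.2 * chr ω p.2 t) * (d (p.1 - p.2) * chr ω (p.1 - p.2) t) :=
    (shear r).summable_iff.2 h3
  have e1 := (shear r).tsum_eq (fun p => (c p.1 * chr ω p.1 t) * (d p.2 * chr ω p.2 t))
  rw [ev, ev, ev, tsum_mul_tsum_of_summable_norm h1 h2, ← e1]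
  simp only [shear, Equiv.coe_fn_mk]
  rw [h4.tsum_prod]
  refine tsum_congr fun k => ?_
  rw [QPHill.conv, ← tsum_mul_right]
  refine tsum_congr fun j => ?_
  have : chr ω k t = chr ω j t * chr ω (k - j) t := by rw [← chr_add]; simp
  rw [this]; ring

/-- Coefficients of the derivative. -/
noncomputable def dif (ω : Fin r → ℝ) (c : (Fin r → ℤ) → ℂ) (k : Fin r → ℤ) : ℂ := I * freq ω k * c k

/-- Loss of analyticity for polynomially bounded multipliers. -/
lemma Bd.multiplier {ρ ρ' M G : ℝ} {m : ℕ} {c d : (Fin r → ℤ) → ℂ} (h : Bd ρ c M)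
    (hρ : ρ' < ρ) (hG : 0 ≤ G) (hd : ∀ k, ‖d k‖ ≤ G * len k ^ m * ‖c k‖) :
    Bd ρ' d (G * m.factorial / (ρ - ρ') ^ m * M) := by
  have hδ : 0 < ρ - ρ' := sub_pos.2 hρ
  refine h.of_le (C := G * m.factorial / (ρ - ρ') ^ m) (by positivity) le_rfl fun k => ?_
  have hl := len_nonneg k
  -- The exponential dominates the m-th term of its series at (ρ - ρ')|k|, so m powers of |k| cost
  -- m!/(ρ - ρ')^m in the norm.
  have h1 : len k ^ m ≤ m.factorial / (ρ - ρ') ^ m * Real.exp ((ρ - ρ') * len k) := by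
    have := Real.pow_div_factorial_le_exp ((ρ - ρ') * len k) (by positivity) m
    rw [mul_pow, div_le_iff₀ (by positivity)] at this
    rw [div_mul_eq_mul_div, le_div_iff₀ (by positivity)]
    linarith
  calc ‖d k‖ * Real.exp (ρ' * len k)
      ≤ G * (m.factorial / (ρ - ρ') ^ m * Real.exp ((ρ - ρ') * len k)) * ‖c k‖ *
        Real.exp (ρ' * len k) := by
        gcongr
        exact (hd k).trans (by gcongr)
    _ = G * m.factorial / (ρ - ρ') ^ m * (‖c k‖ *
        (Real.exp ((ρ - ρ') * len k) * Real.exp (ρ' * len k))) := by ring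
    _ = _ := by rw [← Real.exp_add]; ring_nf

lemma Bd.dif {ρ ρ' M W : ℝ} {ω : Fin r → ℝ} {c : (Fin r → ℤ) → ℂ} (h : Bd ρ c M)
    (hρ : ρ' < ρ) (hW : 0 < W) (hω : ∀ k, |freq ω k| ≤ W * len k) :
    Bd ρ' (dif ω c) (W / (ρ - ρ') * M) := by
  have := h.multiplier (m := 1) (d := QPHill.dif ω c) hρ hW.le fun k => by
    simp only [QPHill.dif, norm_mul, Complex.norm_I, one_mul, Complex.norm_real, Real.norm_eq_abs,
      pow_one]
    gcongr
    exact hω k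
  simpa using this

/-- Termwise differentiation is legitimate because a positive width pays for the factor ⟨k,ω⟩,
leaving a summable majorant at width 0. -/
lemma hasDerivAt_ev {ρ M : ℝ} {c : (Fin r → ℤ) → ℂ} (h : Bd ρ c M) (hρ : 0 < ρ)
    (ω : Fin r → ℝ) (t : ℝ) : HasDerivAt (ev ω c) (ev ω (dif ω c) t) t := by
  obtain ⟨W, hW, hWω⟩ := abs_freq_le ω
  have hd : Bd 0 (dif ω c) _ := h.dif hρ hW hWω
  have := hasDerivAt_tsum (𝕜 := ℝ) (u := fun k => ‖dif ω c k‖)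
    (g := fun k t => c k * chr ω k t) (g' := fun k t => dif ω c k * chr ω k t)
    (hd.summable_norm le_rfl) (fun k t => ?_) (fun k t => ?_) (h.summable_ev hρ.le ω 0) t
  · exact this
  · refine ((hasDerivAt_chr ω k t).const_mul (c k)).congr_deriv ?_
    unfold QPHill.dif
    ring
  · simp [norm_chr]

lemma dif_zero (ω : Fin r → ℝ) (c : (Fin r → ℤ) → ℂ) : dif ω c 0 = 0 := by simp [dif]

/-- Series of coefficient families. -/
lemma bd_series {ρ M : ℝ} {c : ℕ → (Fin r → ℤ) → ℂ} {N : ℕ → ℝ} (h : ∀ n, Bd ρ (c n) (N n))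
    (hρ : 0 ≤ ρ) (hN : HasSum N M) (ω : Fin r → ℝ) :
    Bd ρ (fun k => ∑' n, c n k) M ∧
      ∀ t, HasSum (fun n => ev ω (c n) t) (ev ω (fun k => ∑' n, c n k) t) := by
  set A : ℕ → (Fin r → ℤ) → ℝ := fun n k => ‖c n k‖ * Real.exp (ρ * len k) with hA
  have hA0 : ∀ n k, 0 ≤ A n k := fun n k => by positivity
  have hsum : Summable fun p : ℕ × (Fin r → ℤ) => A p.1 p.2 := by
    rw [summable_prod_of_nonneg (fun p => hA0 p.1 p.2)]
    refine ⟨fun n => (h n).1, ?_⟩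
    exact Summable.of_nonneg_of_le (fun n => tsum_nonneg (hA0 n)) (fun n => (h n).2) hN.summable
  have hsw : Summable fun p : (Fin r → ℤ) × ℕ => A p.2 p.1 :=
    (Equiv.prodComm (Fin r → ℤ) ℕ).summable_iff.2 hsum
  have hk : ∀ k, Summable fun n => A n k := fun k => hsw.prod_factor k
  have hk' : ∀ k, Summable fun n => ‖c n k‖ := fun k =>
    (summable_mul_right_iff (Real.exp_pos _).ne').1 (hk k)
  have hpt : ∀ k, ‖∑' n, c n k‖ * Real.exp (ρ * len k) ≤ ∑' n, A n k := fun k => by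
    rw [hA, tsum_mul_right]
    gcongr
    exact norm_tsum_le_tsum_norm (hk' k)
  have hs1 : Summable fun k => ‖∑' n, c n k‖ * Real.exp (ρ * len k) :=
    Summable.of_nonneg_of_le (fun _ => by positivity) hpt hsw.prod
  refine ⟨⟨hs1, (hs1.tsum_le_tsum hpt hsw.prod).trans ?_⟩, fun t => ?_⟩
  · rw [show ∑' k, ∑' n, A n k = ∑' n, ∑' k, A n k from
      Summable.tsum_comm (f := A) hsum]
    have hn : Summable fun n => ∑' k, A n k := hsum.prod
    exact (hn.tsum_le_tsum (fun n => (h n).2) hN.summable).trans hN.tsum_eq.le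
  · have hB : Summable fun p : ℕ × (Fin r → ℤ) => c p.1 p.2 * chr ω p.2 t := by
      refine Summable.of_norm_bounded hsum fun p => ?_
      rw [norm_mul, norm_chr, mul_one]
      have : 1 ≤ Real.exp (ρ * len p.2) :=
        Real.one_le_exp (mul_nonneg hρ (len_nonneg _))
      exact le_mul_of_one_le_right (norm_nonneg _) this
    have h2 := hB.prod.hasSum
    have h3 : ev ω (fun k => ∑' n, c n k) t = ∑' n, ∑' k, c n k * chr ω k t := by
      rw [← Summable.tsum_comm (f := fun n k => c n k * chr ω k t) hB]
      exact tsum_congr fun k => tsum_mul_right.symm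
    rw [h3]
    exact h2

/-- The family `-y`, convolved `n` times with `-y`. -/
noncomputable def negPow (y : (Fin r → ℤ) → ℂ) : ℕ → (Fin r → ℤ) → ℂ
  | 0 => -y
  | n + 1 => conv (negPow y n) (-y)

/-- Neumann series. -/
lemma exists_inverse {ρ Y : ℝ} {y : (Fin r → ℤ) → ℂ} (h : Bd ρ y Y) (hρ : 0 ≤ ρ)
    (hY : Y ≤ 1 / 2) (ω : Fin r → ℝ) :
    ∃ z : (Fin r → ℤ) → ℂ, Bd ρ z (2 * Y) ∧ ∀ t, (1 + ev ω y t) * (1 + ev ω z t) = 1 := by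
  have hw : ∀ n, Bd ρ (negPow y n) (Y * Y ^ n) ∧ ∀ t, ev ω (negPow y n) t = (-ev ω y t) * (-ev ω y t) ^ n := by
    intro n
    induction n with
    | zero => exact ⟨by simpa [negPow] using h.neg, fun t => by simp [negPow, ev_neg]⟩
    | succ n ih =>
      refine ⟨by simpa [negPow, pow_succ, mul_assoc] using ih.1.conv h.neg hρ, fun t => ?_⟩
      change ev ω (conv (negPow y n) (-y)) t = _
      rw [ev_conv ih.1 hρ h.neg hρ, ih.2, ev_neg, pow_succ, mul_assoc]
  have hY0 := h.nonneg
  -- The series starts at -y, with the constant 1 kept outside, so its sum is bounded by Y/(1 - Y)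
  -- and stays small with Y.
  have hs := bd_series (fun n => (hw n).1) hρ
    ((hasSum_geometric_of_lt_one hY0 (by linarith)).mul_left Y) ω
  refine ⟨_, hs.1.mono le_rfl ?_, fun t => ?_⟩
  · have : (1 - Y)⁻¹ ≤ 2 := by
      rw [inv_le_comm₀ (by linarith) (by norm_num)]; linarith
    nlinarith
  · have h1 : ‖-ev ω y t‖ < 1 := by
      rw [norm_neg]; exact (h.norm_ev_le hρ ω t).trans_lt (by linarith)
    have h2 := (hasSum_geometric_of_norm_lt_one h1).mul_left (-ev ω y t)
    have h3 := hs.2 t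
    simp only [(hw _).2] at h3
    rw [h3.unique h2]
    have h4 : 1 + ev ω y t ≠ 0 := fun h0 => by
      rw [show ev ω y t = -1 by linear_combination h0] at h1
      norm_num at h1
    rw [sub_neg_eq_add]
    field_simp
    ring

end QPHill

/-! ### Small divisors, the linearised equation and the Newton step. -/

namespace QPHill

open Complex (I)

variable {r : ℕ}

/-- Small divisor condition with polynomial loss. -/
def SmallDiv (γ : ℝ) (m : ℕ) (f : (Fin r → ℤ) → ℝ) : Prop := ∀ k, k ≠ 0 → γ / len k ^ m ≤ |f k|

open Classical in
/-- Division by `i f` on the nonzero modes. -/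
noncomputable def sol (f : (Fin r → ℤ) → ℝ) (c : (Fin r → ℤ) → ℂ) (k : Fin r → ℤ) : ℂ :=
  if k = 0 then 0 else c k / (I * f k)

lemma sol_zero (f : (Fin r → ℤ) → ℝ) (c : (Fin r → ℤ) → ℂ) : sol f c 0 = 0 := by simp [sol]

lemma SmallDiv.ne_zero {γ : ℝ} {m : ℕ} {f : (Fin r → ℤ) → ℝ} (h : SmallDiv γ m f) (hγ : 0 < γ)
    {k : Fin r → ℤ} (hk : k ≠ 0) : f k ≠ 0 := by
  have h1 := h k hk
  have h2 : 0 < len k := by linarith [one_le_len hk]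
  exact abs_pos.1 (lt_of_lt_of_le (by positivity) h1)

lemma SmallDiv.mul_sol {γ : ℝ} {m : ℕ} {f : (Fin r → ℤ) → ℝ} (h : SmallDiv γ m f) (hγ : 0 < γ)
    (c : (Fin r → ℤ) → ℂ) {k : Fin r → ℤ} (hk : k ≠ 0) : I * f k * sol f c k = c k := by
  have h0 : (f k : ℂ) ≠ 0 := by exact_mod_cast h.ne_zero hγ hk
  rw [sol, if_neg hk]
  field_simp [Complex.I_ne_zero]

/-- Dividing by f multiplies by at most γ⁻¹|k|^m, a polynomial multiplier paid for by
`Bd.multiplier`. -/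
lemma Bd.sol {ρ ρ' M γ : ℝ} {m : ℕ} {f : (Fin r → ℤ) → ℝ} {c : (Fin r → ℤ) → ℂ} (h : Bd ρ c M)
    (hρ : ρ' < ρ) (hf : SmallDiv γ m f) (hγ : 0 < γ) :
    Bd ρ' (sol f c) (γ⁻¹ * m.factorial / (ρ - ρ') ^ m * M) := by
  refine h.multiplier hρ (by positivity) fun k => ?_
  by_cases hk : k = 0
  · subst hk
    rw [sol_zero, norm_zero]
    have := len_nonneg (0 : Fin r → ℤ)
    positivity
  · have h1 := hf k hk
    have hl : 0 < len k := by linarith [one_le_len hk]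
    rw [QPHill.sol, if_neg hk, norm_div, norm_mul, Complex.norm_I, one_mul, Complex.norm_real,
      Real.norm_eq_abs, div_eq_inv_mul]
    gcongr
    rw [← inv_inv (len k ^ m), ← mul_inv]
    exact inv_anti₀ (by positivity) (by rwa [div_eq_mul_inv] at h1)

/-- Solution of the linearised equation: the parameter correction `δ` is chosen such that the
corrector has vanishing mean. -/
lemma exists_correction {ω : Fin r → ℝ} {γ σ ρ ρ' μ M A x η : ℝ} {m : ℕ}
    {b e χ : (Fin r → ℤ) → ℂ} (hγ : 0 < γ) (hσ : 0 < σ) (hσρ : σ ≤ ρ) (hρ : ρ' < ρ)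
    (hloss : ρ - ρ' ≤ σ) (hρ'0 : 0 < ρ')
    (hμ : 0 < μ) (hd : SmallDiv γ m (fun k => freq ω k + 2 * μ))
    (hA : 0 < A) (hAM : A ≤ M)
    (hμG : 40 * M * (γ⁻¹ * m.factorial / σ ^ m * μ) ≤ A)
    (hb : Bd ρ b (2 * M)) (he : Bd ρ e x) (hχ : Bd ρ χ η) (hη : η ≤ 5 / 8)
    (hmean : ‖(1 + χ 0) * b 0 - A‖ ≤ 11 / 40 * A) :
    ∃ (δ : ℂ) (p q : (Fin r → ℤ) → ℂ) (N : ℝ), ‖δ‖ ≤ 6 * x / A ∧ Bd ρ' p N ∧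
      Bd ρ' q (170 * (M / A) * (γ⁻¹ * m.factorial / (ρ - ρ') ^ m) * x) ∧ q 0 = 0 ∧
      (∀ t, ev ω q t = (1 + ev ω χ t) * ev ω p t) ∧
      ∀ t, ev ω (dif ω p) t + 2 * I * μ * ev ω p t = -(ev ω e t + δ * ev ω b t) := by
  set f : (Fin r → ℤ) → ℝ := fun k => freq ω k + 2 * μ with hf
  set G := γ⁻¹ * m.factorial / σ ^ m with hG
  set L := γ⁻¹ * m.factorial / (ρ - ρ') ^ m with hL
  have hGpos : 0 < G := by positivity
  have hδ0 : 0 < ρ - ρ' := sub_pos.2 hρ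
  have hLpos : 0 < L := by positivity
  have hGL : G ≤ L := by rw [hG, hL]; gcongr
  have hx0 : 0 ≤ x := he.nonneg
  have hM0 : 0 < M := hA.trans_le hAM
  have hη0 : 0 ≤ η := hχ.nonneg
  have hρ0 : 0 < ρ := hσ.trans_le hσρ
  set p1 := sol f e with hp1
  set p2 := sol f b with hp2
  set Ψ : (Fin r → ℤ) → ℂ := one + χ with hΨdef
  have hΨ : Bd ρ Ψ 2 := ((bd_one ρ).add hχ).mono le_rfl (by linarith)
  have hΨ' : Bd ρ' Ψ 2 := hΨ.mono hρ.le le_rfl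
  have hΨ0 : Ψ 0 = 1 + χ 0 := by simp [hΨdef, one_zero]
  -- The means β1, β2 only need width 0, so they can be bounded by spending the fixed width σ. This
  -- gives the constant G, the same at every iteration, and smallness of μG can be imposed once and
  -- for all. The loss L of the current step enters only the norms at width ρ'.
  have g1 : Bd 0 p1 (G * x) := by
    simpa [hG] using (he.mono hσρ le_rfl).sol hσ hd hγ
  have g2 : Bd 0 p2 (G * (2 * M)) := by
    simpa [hG] using (hb.mono hσρ le_rfl).sol hσ hd hγ
  have l1 : Bd ρ' p1 (L * x) := he.sol hρ hd hγ
  have l2 : Bd ρ' p2 (L * (2 * M)) := hb.sol hρ hd hγ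
  set β1 := conv Ψ p1 0 with hβ1
  set β2 := conv Ψ p2 0 with hβ2
  have nβ1 : ‖β1‖ ≤ 2 * (G * x) := ((hΨ.mono hρ0.le le_rfl).conv g1 le_rfl).norm_zero_le
  have nβ2 : ‖β2‖ ≤ 2 * (G * (2 * M)) := ((hΨ.mono hρ0.le le_rfl).conv g2 le_rfl).norm_zero_le
  have n2 : ‖(2 * I * μ : ℂ)‖ = 2 * μ := by simp [abs_of_pos hμ]
  -- With p = p0 - p1 - δp2 the two conditions are Ψ₀p0 = β1 + δβ2 (mean of Ψp is zero) and 2iμp0 =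
  -- -(e₀ + δb₀) (zeroth mode of the equation). Eliminating p0 gives δ·den = -num, and den is close
  -- to A.
  set den := 2 * I * μ * β2 + Ψ 0 * b 0 with hden
  have hdenA : ‖den - A‖ ≤ A / 2 := by
    have : den - A = 2 * I * μ * β2 + (Ψ 0 * b 0 - A) := by rw [hden]; ring
    rw [this]
    refine (norm_add_le _ _).trans ?_
    rw [norm_mul, n2]
    rw [hΨ0]
    have h3 : 2 * μ * ‖β2‖ ≤ 2 * μ * (2 * (G * (2 * M))) := by gcongr
    nlinarith
  have hdenpos : A / 2 ≤ ‖den‖ := by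
    have h1 := norm_sub_norm_le (A : ℂ) den
    rw [norm_sub_rev, Complex.norm_real, Real.norm_eq_abs, abs_of_pos hA] at h1
    linarith
  have hden0 : den ≠ 0 := norm_pos_iff.1 (by linarith)
  have hμG' : μ * G ≤ 1 / 40 := by
    have : 40 * A * (G * μ) ≤ A := le_trans (by gcongr) hμG
    have : A * (40 * (μ * G)) ≤ A * 1 := by linarith
    have := le_of_mul_le_mul_left this hA
    linarith
  set num := 2 * I * μ * β1 + Ψ 0 * e 0 with hnum
  have hnumle : ‖num‖ ≤ 3 * x := by
    refine (norm_add_le _ _).trans ?_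
    rw [norm_mul, n2, norm_mul]
    have h3 : 2 * μ * ‖β1‖ ≤ 2 * μ * (2 * (G * x)) := by gcongr
    have h4 : ‖Ψ 0‖ * ‖e 0‖ ≤ 2 * x :=
      mul_le_mul hΨ.norm_zero_le he.norm_zero_le (norm_nonneg _) (by norm_num)
    nlinarith
  set δ := -num / den with hδ
  have hδle : ‖δ‖ ≤ 6 * x / A := by
    rw [hδ, norm_div, norm_neg, div_le_div_iff₀ (by linarith) hA]
    nlinarith
  have hΨ0n : 3 / 8 ≤ ‖Ψ 0‖ := by
    rw [hΨ0]
    have h1 := norm_sub_norm_le (1 : ℂ) (-χ 0)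
    rw [norm_neg, norm_one, sub_neg_eq_add] at h1
    linarith [hχ.norm_zero_le]
  have hΨ0ne : Ψ 0 ≠ 0 := norm_pos_iff.1 (by linarith)
  -- p0 is read off the mean-zero condition, where the divisor Ψ₀ is near 1, rather than off the
  -- zeroth mode, where the divisor would be 2iμ.
  set p0 := (β1 + δ * β2) / Ψ 0 with hp0
  have hMA : 1 ≤ M / A := (one_le_div hA).2 hAM
  have hp0le : ‖p0‖ ≤ 70 * (M / A) * L * x := by
    have h1 : ‖β1 + δ * β2‖ ≤ 2 * (G * x) + 6 * x / A * (2 * (G * (2 * M))) := by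
      refine (norm_add_le _ _).trans ?_
      rw [norm_mul]
      gcongr
    have h2 : 2 * (G * x) + 6 * x / A * (2 * (G * (2 * M))) ≤ 26 * (M / A) * L * x := by
      have e1 : 6 * x / A * (2 * (G * (2 * M))) = 24 * ((M / A) * (G * x)) := by
        field_simp
        ring
      rw [e1]
      have h4 : G * x ≤ L * x := by gcongr
      have h5 : G * x ≤ M / A * (G * x) := le_mul_of_one_le_left (by positivity) hMA
      have h6 : M / A * (G * x) ≤ M / A * (L * x) := by gcongr
      linarith
    rw [hp0, norm_div, div_le_iff₀ (by linarith)]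
    have h3 : 0 ≤ (M / A) * L * x := by positivity
    nlinarith
  have hr : Bd ρ' (conv Ψ p1) (2 * (L * x)) := hΨ'.conv l1 hρ'0.le
  have hs : Bd ρ' (conv Ψ p2) (2 * (L * (2 * M))) := hΨ'.conv l2 hρ'0.le
  have hp : Bd ρ' (p0 • one - p1 - δ • p2) _ := (((bd_one ρ').smul p0).sub l1).sub (l2.smul δ)
  have hq : Bd ρ' (p0 • Ψ - conv Ψ p1 - δ • conv Ψ p2) _ :=
    ((hΨ'.smul p0).sub hr).sub (hs.smul δ)
  have hevp : ∀ t, ev ω (p0 • one - p1 - δ • p2) t = p0 - ev ω p1 t - δ * ev ω p2 t := fun t => by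
    rw [ev_sub (((bd_one ρ').smul p0).sub l1) hρ'0.le (l2.smul δ) hρ'0.le,
      ev_sub ((bd_one ρ').smul p0) hρ'0.le l1 hρ'0.le, ev_smul, ev_smul, ev_one, mul_one]
  refine ⟨δ, p0 • one - p1 - δ • p2, p0 • Ψ - conv Ψ p1 - δ • conv Ψ p2, _, hδle, hp,
    hq.mono le_rfl ?_, ?_, fun t => ?_, fun t => ?_⟩
  · have e1 : 6 * x / A * (2 * (L * (2 * M))) = 24 * ((M / A) * (L * x)) := by
      field_simp
      ring
    have h1 : ‖δ‖ * (2 * (L * (2 * M))) ≤ 24 * ((M / A) * (L * x)) := by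
      rw [← e1]; gcongr
    have h5 : L * x ≤ M / A * (L * x) := le_mul_of_one_le_left (by positivity) hMA
    have h6 : 0 ≤ M / A * (L * x) := by positivity
    linarith
  · simp only [Pi.sub_apply, Pi.smul_apply, smul_eq_mul]
    rw [← hβ1, ← hβ2, hp0]
    field_simp
    ring
  · rw [hevp, ev_sub ((hΨ'.smul p0).sub hr) hρ'0.le (hs.smul δ) hρ'0.le,
      ev_sub (hΨ'.smul p0) hρ'0.le hr hρ'0.le, ev_smul, ev_smul,
      ev_conv hΨ' hρ'0.le l1 hρ'0.le, ev_conv hΨ' hρ'0.le l2 hρ'0.le,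
      hΨdef, ev_add (bd_one ρ) hρ0.le hχ hρ0.le, ev_one]
    ring
  · obtain ⟨W, hW, hWω⟩ := abs_freq_le ω
    have hdp : Bd 0 (dif ω (p0 • one - p1 - δ • p2)) _ := hp.dif hρ'0 hW hWω
    have hp00 : 2 * I * μ * p0 = -(e 0 + δ * b 0) := by
      have h1 : δ * den = -num := by rw [hδ]; field_simp
      rw [hp0]
      field_simp
      rw [hden, hnum] at h1
      linear_combination h1
    rw [← ev_smul, ← ev_add hdp le_rfl (hp.smul _) hρ'0.le, ← ev_smul,
      ← ev_add he hρ0.le (hb.smul δ) hρ0.le, ← ev_neg]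
    congr 1
    funext k
    by_cases hk : k = 0
    · subst hk
      simp only [Pi.add_apply, Pi.smul_apply, Pi.sub_apply, Pi.neg_apply, smul_eq_mul, dif_zero,
        one_zero, hp1, hp2, sol_zero]
      linear_combination hp00
    · have h1 : I * ((freq ω k + 2 * μ : ℝ) : ℂ) * p1 k = e k := hd.mul_sol hγ e hk
      have h2 : I * ((freq ω k + 2 * μ : ℝ) : ℂ) * p2 k = b k := hd.mul_sol hγ b hk
      simp only [Pi.add_apply, Pi.smul_apply, Pi.sub_apply, Pi.neg_apply, smul_eq_mul, dif,
        one_ne hk]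
      push_cast at h1 h2
      clear_value p1 p2 δ p0
      linear_combination -h1 - δ * h2

/-- One Newton step for the equation `u'' + 2iμu' + (εa - μ²)u = 0` with `u = 1 + w`. -/
lemma newton_step {ω : Fin r → ℝ} {γ σ ρ ρ' μ M A x θ Y : ℝ} {m : ℕ}
    {a e w : (Fin r → ℤ) → ℂ} {ε : ℂ} (hγ : 0 < γ) (hσ : 0 < σ) (hσρ : σ ≤ ρ') (hρ : ρ' < ρ)
    (hloss : ρ - ρ' ≤ σ) (hn : SmallDiv γ m (freq ω))
    (hμ : 0 < μ) (hd : SmallDiv γ m (fun k => freq ω k + 2 * μ))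
    (hA : 0 < A) (ha : Bd ρ a M) (ha0 : a 0 = A)
    (hμG : 40 * M * (γ⁻¹ * m.factorial / σ ^ m * μ) ≤ A)
    (he : Bd ρ e x) (hw : Bd ρ w θ) (hθ : θ ≤ 1 / 8) (hθM : 40 * M * θ ≤ A)
    (heq : ∀ t, (1 + ev ω w t) * (ev ω (dif ω (dif ω w)) t + 2 * I * μ * ev ω (dif ω w) t +
      (ε * ev ω a t - μ ^ 2) * (1 + ev ω w t)) = ev ω e t)
    (hY : 170 * (M / A) * (γ⁻¹ * m.factorial / ((ρ - ρ') / 2) ^ m) ^ 2 * x = Y) (hY2 : Y ≤ 1 / 2) :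
    ∃ (δ : ℂ) (w' e' : (Fin r → ℤ) → ℂ), ‖δ‖ ≤ 6 * x / A ∧ Bd ρ' (w' - w) (2 * Y) ∧
      Bd ρ' e' (20 * (M / A) * Y * x) ∧
      ∀ t, (1 + ev ω w' t) * (ev ω (dif ω (dif ω w')) t + 2 * I * μ * ev ω (dif ω w') t +
      ((ε + δ) * ev ω a t - μ ^ 2) * (1 + ev ω w' t)) = ev ω e' t := by
  have hρ'0 : 0 < ρ' := hσ.trans_le hσρ
  have hρ0 : 0 < ρ := hρ'0.trans hρ
  have hAM : A ≤ M := by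
    have := ha.norm_zero_le
    rwa [ha0, Complex.norm_real, Real.norm_eq_abs, abs_of_pos hA] at this
  have hM0 : 0 < M := hA.trans_le hAM
  have hMA : 1 ≤ M / A := (one_le_div hA).2 hAM
  have hθ0 := hw.nonneg
  have hx0 := he.nonneg
  obtain ⟨z, hz, hwz⟩ := exists_inverse hw hρ0.le (by linarith) ω
  -- Here 1 + χ represents u⁻² and 1 + φ below represents u², so that b represents au².
  set χ : (Fin r → ℤ) → ℂ := (2 : ℂ) • z + conv z z with hχdef
  have hχ : Bd ρ χ (5 * θ) := ((hz.smul 2).add (hz.conv hz hρ0.le)).mono le_rfl (by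
    rw [Complex.norm_ofNat]; nlinarith)
  have evχ : ∀ t, ev ω χ t = 2 * ev ω z t + ev ω z t * ev ω z t := fun t => by
    rw [hχdef, ev_add (hz.smul 2) hρ0.le (hz.conv hz hρ0.le) hρ0.le, ev_smul,
      ev_conv hz hρ0.le hz hρ0.le]
  set φ : (Fin r → ℤ) → ℂ := (2 : ℂ) • w + conv w w with hφdef
  have hφ : Bd ρ φ (3 * θ) := ((hw.smul 2).add (hw.conv hw hρ0.le)).mono le_rfl (by
    rw [Complex.norm_ofNat]; nlinarith)
  have evφ : ∀ t, ev ω φ t = 2 * ev ω w t + ev ω w t * ev ω w t := fun t => by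
    rw [hφdef, ev_add (hw.smul 2) hρ0.le (hw.conv hw hρ0.le) hρ0.le, ev_smul,
      ev_conv hw hρ0.le hw hρ0.le]
  have haφ := ha.conv hφ hρ0.le
  set b : (Fin r → ℤ) → ℂ := a + conv a φ with hbdef
  have hb : Bd ρ b (2 * M) := (ha.add haφ).mono le_rfl (by nlinarith)
  have evb : ∀ t, ev ω b t = ev ω a t * (1 + ev ω w t) ^ 2 := fun t => by
    rw [hbdef, ev_add ha hρ0.le haφ hρ0.le, ev_conv ha hρ0.le hφ hρ0.le, evφ]
    ring
  -- The error is at most 2·3Mθ + 5Mθ = 11Mθ, and 40Mθ ≤ A.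
  have hmean : ‖(1 + χ 0) * b 0 - A‖ ≤ 11 / 40 * A := by
    have e1 : (1 + χ 0) * b 0 - A = (1 + χ 0) * conv a φ 0 + χ 0 * A := by
      rw [hbdef, Pi.add_apply, ha0]; ring
    have h1 := haφ.norm_zero_le
    have h2 := hχ.norm_zero_le
    have h3 : ‖1 + χ 0‖ ≤ 2 := (norm_add_le _ _).trans (by rw [norm_one]; linarith)
    rw [e1]
    refine (norm_add_le _ _).trans ?_
    rw [norm_mul, norm_mul, Complex.norm_real, Real.norm_eq_abs, abs_of_pos hA]
    have h4 : ‖1 + χ 0‖ * ‖conv a φ 0‖ ≤ 2 * (M * (3 * θ)) :=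
      mul_le_mul h3 h1 (norm_nonneg _) (by norm_num)
    have h5 : ‖χ 0‖ * A ≤ 5 * θ * M := mul_le_mul h2 hAM hA.le (by positivity)
    linarith
  -- Half of the loss of width is spent on the divisors ⟨k,ω⟩ + 2μ, the other half on ⟨k,ω⟩ when q
  -- is integrated to y.
  set ρ₁ := (ρ + ρ') / 2 with hρ₁
  obtain ⟨δ, p, q, N, hδ, hp, hq, hq0, hqp, hpode⟩ :=
    exists_correction (ρ' := ρ₁) (M := M) (A := A) hγ hσ (hσρ.trans hρ.le) (by linarith)
      (by linarith) (by linarith) hμ hd hA hAM hμG hb he hχ (by linarith) hmean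
  have e2 : ρ - ρ₁ = (ρ - ρ') / 2 := by rw [hρ₁]; ring
  have e3 : ρ₁ - ρ' = (ρ - ρ') / 2 := by rw [hρ₁]; ring
  have hρ₁0 : 0 < ρ₁ := by linarith
  rw [e2] at hq
  have hρ₁' : ρ' < ρ₁ := by rw [hρ₁]; linarith
  have hy := hq.sol hρ₁' hn hγ
  set y := sol (freq ω) q with hydef
  have hy : Bd ρ' y Y := hy.mono le_rfl (by rw [e3, ← hY]; apply le_of_eq; ring)
  have hdy : dif ω y = q := by
    funext k
    by_cases hk : k = 0
    · subst hk; rw [dif_zero, hq0]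
    · exact hn.mul_sol hγ q hk
  have hY0 := hy.nonneg
  have hw' : Bd ρ' w θ := hw.mono hρ.le le_rfl
  have hwy := hw'.conv hy hρ'0.le
  have hyy := hy.conv hy hρ'0.le
  have hinc : Bd ρ' (y + conv w y) (2 * Y) := (hy.add hwy).mono le_rfl (by nlinarith)
  have hin2 : Bd ρ' (w + (y + conv w y)) _ := hw'.add hinc
  have hf1 : Bd ρ' (y + conv y y) _ := hy.add hyy
  have hf2 : Bd ρ' (e + δ • b) _ := (he.mono hρ.le le_rfl).add ((hb.mono hρ.le le_rfl).smul δ)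
  -- The new residual is (1+y)²e - (1+y)(e + δb) + δ(1+y)²b = (y + y²)(e + δb), an exact identity
  -- and not merely an estimate.
  refine ⟨δ, w + (y + conv w y), conv (y + conv y y) (e + δ • b), hδ, by simpa using hinc,
    (hf1.conv hf2 hρ'0.le).mono le_rfl ?_, ?_⟩
  · have h1 : ‖δ‖ * (2 * M) ≤ 12 * (M / A) * x := by
      calc _ ≤ 6 * x / A * (2 * M) := by gcongr
        _ = _ := by field_simp; ring
    have h2 : Y + Y * Y ≤ 3 / 2 * Y := by nlinarith
    have h3 : x + ‖δ‖ * (2 * M) ≤ 13 * (M / A) * x := by nlinarith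
    have h4 : (Y + Y * Y) * (x + ‖δ‖ * (2 * M)) ≤ 3 / 2 * Y * (13 * (M / A) * x) :=
      mul_le_mul h2 h3 (by positivity) (by positivity)
    have h5 : 0 ≤ M / A * Y * x := by positivity
    nlinarith
  · obtain ⟨W, hW, hWω⟩ := abs_freq_le ω
    have evw' : ∀ t, 1 + ev ω (w + (y + conv w y)) t = (1 + ev ω w t) * (1 + ev ω y t) := fun t => by
      rw [ev_add hw' hρ'0.le hinc hρ'0.le, ev_add hy hρ'0.le hwy hρ'0.le,
        ev_conv hw' hρ'0.le hy hρ'0.le]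
      ring
    have dw := hasDerivAt_ev hw hρ0 ω
    have hw1 : Bd (ρ / 2) (dif ω w) _ := hw.dif (by linarith) hW hWω
    have dw1 := hasDerivAt_ev hw1 (by linarith) ω
    have dy := hasDerivAt_ev hy hρ'0 ω
    rw [hdy] at dy
    have dq := hasDerivAt_ev hq hρ₁0 ω
    have dp := hasDerivAt_ev hp hρ₁0 ω
    have evw1 : ∀ t, ev ω (dif ω (w + (y + conv w y))) t =
        ev ω (dif ω w) t * (1 + ev ω y t) + (1 + ev ω w t) * ev ω q t := fun t => by
      have h1 := (hasDerivAt_ev hin2 hρ'0 ω t).const_add 1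
      have h2 := ((dw t).const_add 1).mul ((dy t).const_add 1)
      have h3 : (fun t => 1 + ev ω (w + (y + conv w y)) t) =
        ((fun t => 1 + ev ω w t) * fun t => 1 + ev ω y t) := funext evw'
      rw [h3] at h1
      exact h1.unique h2
    have hin3 : Bd (ρ' / 2) (dif ω (w + (y + conv w y))) _ := hin2.dif (by linarith) hW hWω
    have evw2 : ∀ t, ev ω (dif ω (dif ω (w + (y + conv w y)))) t =
        ev ω (dif ω (dif ω w)) t * (1 + ev ω y t) + ev ω (dif ω w) t * ev ω q t +
        (ev ω (dif ω w) t * ev ω q t + (1 + ev ω w t) * ev ω (dif ω q) t) := fun t => by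
      have h1 := hasDerivAt_ev hin3 (by linarith) ω t
      have h2 := ((dw1 t).mul ((dy t).const_add 1)).add (((dw t).const_add 1).mul (dq t))
      have h3 : ev ω (dif ω (w + (y + conv w y))) =
        ((ev ω (dif ω w)) * fun t => 1 + ev ω y t) + ((fun t => 1 + ev ω w t) * ev ω q) :=
          funext evw1
      rw [h3] at h1
      exact h1.unique h2
    have hpq : ∀ t, ev ω p t = (1 + ev ω w t) ^ 2 * ev ω q t := fun t => by
      rw [hqp, evχ]
      have := hwz t
      calc ev ω p t = ((1 + ev ω w t) * (1 + ev ω z t)) ^ 2 * ev ω p t := by rw [this]; ring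
        _ = _ := by ring
    have hdp : ∀ t, ev ω (dif ω p) t = 2 * (1 + ev ω w t) * ev ω (dif ω w) t * ev ω q t +
        (1 + ev ω w t) ^ 2 * ev ω (dif ω q) t := fun t => by
      have h1 := dp t
      have h2 := (((dw t).const_add 1).pow 2).mul (dq t)
      have h3 : ev ω p = ((fun t => 1 + ev ω w t) ^ 2) * ev ω q := funext hpq
      rw [h3] at h1
      rw [← h3] at h1
      have h4 := h1.unique (h3 ▸ h2)
      rw [h4]
      simp
    intro t
    rw [evw', evw1, evw2, ev_conv hf1 hρ'0.le hf2 hρ'0.le, ev_add hy hρ'0.le hyy hρ'0.le,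
      ev_conv hy hρ'0.le hy hρ'0.le,
      ev_add (he.mono hρ.le le_rfl) hρ'0.le ((hb.mono hρ.le le_rfl).smul δ) hρ'0.le, ev_smul]
    have h1 := hpode t
    rw [hdp, hpq] at h1
    have h2 := heq t
    have h3 := evb t
    linear_combination (1 + ev ω y t) * h1 + (1 + ev ω y t) ^ 2 * h2 -
      δ * (1 + ev ω y t) ^ 2 * h3

end QPHill

/-! ### Convergence of the Newton scheme. -/

namespace QPHill

open Complex (I)

variable {r : ℕ}

lemma tendsto_ev_series {ρ M : ℝ} {w : ℕ → (Fin r → ℤ) → ℂ} {N : ℕ → ℝ}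
    (h0 : w 0 = 0) (h : ∀ n, Bd ρ (w (n + 1) - w n) (N n))
    (hρ : 0 ≤ ρ) (hN : HasSum N M) (ω : Fin r → ℝ) (t : ℝ) :
    Tendsto (fun n => ev ω (w n) t) atTop
      (𝓝 (ev ω (fun k => ∑' n, (w (n + 1) - w n) k) t)) := by
  have h1 := ((bd_series h hρ hN ω).2 t).tendsto_sum_nat
  refine h1.congr fun n => ?_
  -- A norm bound for w n is carried through the telescoping because additivity of `ev` requires
  -- summability.
  have h2 : ∃ K, Bd ρ (w n) K ∧
      ∑ i ∈ Finset.range n, ev ω (w (i + 1) - w i) t = ev ω (w n) t := by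
    induction n with
    | zero => exact ⟨0, by rw [h0]; simp [Bd], by rw [h0]; simp [ev]⟩
    | succ n ih =>
      obtain ⟨K, hK, hs⟩ := ih
      refine ⟨_, by simpa using hK.add (h n), ?_⟩
      rw [Finset.sum_range_succ, hs, ← ev_add hK hρ (h n) hρ, add_sub_cancel]
  exact h2.choose_spec.2

lemma dif_sub (ω : Fin r → ℝ) (c d : (Fin r → ℤ) → ℂ) : dif ω (c - d) = dif ω c - dif ω d := by
  funext k; simp [dif, mul_sub]

lemma dif_tsum (ω : Fin r → ℝ) (c : ℕ → (Fin r → ℤ) → ℂ) :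
    dif ω (fun k => ∑' n, c n k) = fun k => ∑' n, dif ω (c n) k := by
  funext k; simp [dif, tsum_mul_left]

/-- Limits of telescoping series of coefficient families, with two derivatives. -/
lemma exists_limit {ρ M : ℝ} {w : ℕ → (Fin r → ℤ) → ℂ} {N : ℕ → ℝ}
    (h0 : w 0 = 0) (h : ∀ n, Bd ρ (w (n + 1) - w n) (N n))
    (hρ : 0 < ρ) (hN : HasSum N M) (ω : Fin r → ℝ) :
    ∃ v, Bd ρ v M ∧ ∀ t, Tendsto (fun n => ev ω (w n) t) atTop (𝓝 (ev ω v t)) ∧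
      Tendsto (fun n => ev ω (dif ω (w n)) t) atTop (𝓝 (ev ω (dif ω v) t)) ∧
      Tendsto (fun n => ev ω (dif ω (dif ω (w n))) t) atTop (𝓝 (ev ω (dif ω (dif ω v)) t)) := by
  obtain ⟨W, hW, hWω⟩ := abs_freq_le ω
  have e1 : ∀ n, dif ω (w (n + 1) - w n) = dif ω (w (n + 1)) - dif ω (w n) := fun n => dif_sub _ _ _
  have e2 : ∀ n, dif ω (dif ω (w (n + 1) - w n)) =
      dif ω (dif ω (w (n + 1))) - dif ω (dif ω (w n)) := fun n => by rw [e1, dif_sub]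
  have z1 : dif ω (0 : (Fin r → ℤ) → ℂ) = 0 := by funext k; simp [dif]
  have h1 : ∀ n, Bd (ρ / 2) (dif ω (w (n + 1) - w n)) _ := fun n =>
    (h n).dif (by linarith) hW hWω
  have h2 : ∀ n, Bd 0 (dif ω (dif ω (w (n + 1) - w n))) _ := fun n =>
    (h1 n).dif (by linarith) hW hWω
  refine ⟨_, (bd_series h hρ.le hN ω).1, fun t => ⟨tendsto_ev_series h0 h hρ.le hN ω t, ?_, ?_⟩⟩
  · rw [dif_tsum]
    simp only [e1] at h1 ⊢
    exact tendsto_ev_series (w := fun n => dif ω (w n)) (by simp only [h0, z1]) h1 (by linarith)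
      (hN.mul_left _) ω t
  · rw [dif_tsum, dif_tsum]
    simp only [e2] at h2 ⊢
    exact tendsto_ev_series (w := fun n => dif ω (dif ω (w n))) (by simp only [h0, z1]) h2 le_rfl
      ((hN.mul_left _).mul_left _) ω t

set_option maxHeartbeats 2000000 in
/-- Existence of Floquet solutions `e^{iμt}(1 + w)` with `w` quasi-periodic of size `O(μ²)`, for
small `μ` such that `2μ` is Diophantine relative to `ω`. -/
theorem exists_floquet {ω : Fin r → ℝ} {γ ρ M A : ℝ} {m : ℕ} {a : (Fin r → ℤ) → ℂ}
    (hγ : 0 < γ) (hn : SmallDiv γ m (freq ω)) (hρ : 0 < ρ) (hA : 0 < A) (ha : Bd ρ a M)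
    (ha0 : a 0 = A) :
    ∃ μ₁ C : ℝ, 0 < μ₁ ∧ 0 ≤ C ∧ ∀ μ, 0 < μ → μ ≤ μ₁ →
      SmallDiv γ m (fun k => freq ω k + 2 * μ) →
      ∃ (ε : ℂ) (w : (Fin r → ℤ) → ℂ), Bd (ρ / 2) w (C * μ ^ 2) ∧
        ∀ t, ev ω (dif ω (dif ω w)) t + 2 * I * μ * ev ω (dif ω w) t +
          (ε * ev ω a t - μ ^ 2) * (1 + ev ω w t) = 0 := by
  have hAM : A ≤ M := by
    have := ha.norm_zero_le
    rwa [ha0, Complex.norm_real, Real.norm_eq_abs, abs_of_pos hA] at this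
  have hM0 : 0 < M := hA.trans_le hAM
  have hMA : 1 ≤ M / A := (one_le_div hA).2 hAM
  set Q := M / A with hQ
  have hQ0 : 0 < Q := by linarith
  set G := γ⁻¹ * m.factorial / (ρ / 2) ^ m with hG
  set G₁ := γ⁻¹ * m.factorial / (ρ / 8) ^ m with hG₁
  set A₀ := 170 * Q * G₁ ^ 2 with hA₀
  set B : ℝ := 4 ^ m with hB
  have hGp : 0 < G := by positivity
  have hG₁p : 0 < G₁ := by positivity
  have hA₀p : 0 < A₀ := by positivity
  have hBp : 0 < B := by positivity
  have hB1 : 1 ≤ B := one_le_pow₀ (by norm_num)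
  -- Zμ ≤ 1 contains all smallness conditions at once: μ ≤ 1, the bound on μG, and the smallness of
  -- q.
  set Z := 1 + 40 * Q * G + 4000 * A₀ * Q ^ 2 * (1 + B) with hZ
  have hZ1 : 1 ≤ Z := by
    have : 0 ≤ 40 * Q * G + 4000 * A₀ * Q ^ 2 * (1 + B) := by positivity
    linarith
  refine ⟨1 / Z, 8 * A₀ * Q, by positivity, by positivity, fun μ hμ hμ1 hd => ?_⟩
  have hZμ : Z * μ ≤ 1 := by
    rw [le_div_iff₀ (by linarith)] at hμ1; linarith
  have hμ1' : μ ≤ 1 := by nlinarith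
  have hμG : 40 * M * (G * μ) ≤ A := by
    have h1 : 40 * Q * G * μ ≤ 1 := by
      have : 0 ≤ 4000 * A₀ * Q ^ 2 * (1 + B) * μ := by positivity
      rw [hZ] at hZμ
      linarith
    have h2 : 40 * M * (G * μ) = A * (40 * Q * G * μ) := by rw [hQ]; field_simp
    rw [h2]; nlinarith
  -- q bounds the residual (μ²/A)a - μ² of the initial guess u = 1, ε = μ²/A.
  set q := 2 * Q * μ ^ 2 with hq
  have hq0 : 0 < q := by positivity
  have hqs : 2000 * A₀ * Q * (1 + B) * q ≤ 1 := by
    have h1 : 4000 * A₀ * Q ^ 2 * (1 + B) * μ ≤ 1 := by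
      have : 0 ≤ (1 + 40 * Q * G) * μ := by positivity
      rw [hZ] at hZμ
      linarith
    have h2 : 2000 * A₀ * Q * (1 + B) * q = 4000 * A₀ * Q ^ 2 * (1 + B) * μ * μ := by rw [hq]; ring
    rw [h2]; nlinarith
  have hA₀q : 0 < A₀ * q := by positivity
  have hA₀Qq : A₀ * q * Q * (1 + B) ≤ 1 / 2000 := by linarith
  have hs1 : A₀ * q ≤ 1 / 2000 := by
    refine le_trans ?_ hA₀Qq
    have : 1 ≤ Q * (1 + B) := by nlinarith
    nlinarith
  have hs2 : A₀ * q * Q ≤ 1 / 2000 := by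
    refine le_trans ?_ hA₀Qq
    have : 0 < A₀ * q * Q := by positivity
    nlinarith
  have hs3 : A₀ * q * Q * B ≤ 1 / 2000 := by
    refine le_trans ?_ hA₀Qq
    have : 0 < A₀ * q * Q := by positivity
    nlinarith
  clear_value G G₁ A₀ B Z q
  -- The widths shrink from ρ to ρ/2. Geometric decay of the residual at rate 1/(4B) is enough: B =
  -- 4^m is the growth per step of the squared small-divisor loss, and the remaining factor 1/4
  -- makes the corrections summable.
  let P : ℕ → ((Fin r → ℤ) → ℂ) × ((Fin r → ℤ) → ℂ) × ℂ → Prop := fun n s =>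
    Bd (ρ / 2 + ρ / 2 / 2 ^ n) s.1 (4 * (A₀ * q) * (1 - 1 / 2 ^ n)) ∧
    Bd (ρ / 2 + ρ / 2 / 2 ^ n) s.2.1 (q / (4 * B) ^ n) ∧
    ∀ t, (1 + ev ω s.1 t) * (ev ω (dif ω (dif ω s.1)) t + 2 * I * μ * ev ω (dif ω s.1) t +
      (s.2.2 * ev ω a t - μ ^ 2) * (1 + ev ω s.1 t)) = ev ω s.2.1 t
  have hstep : ∀ n s, P n s → ∃ s', P (n + 1) s' ∧
      Bd (ρ / 2) (s'.1 - s.1) (2 * (A₀ * q) * (1 / 4) ^ n) ∧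
      ‖s'.2.2 - s.2.2‖ ≤ 6 * q / A * (1 / 4) ^ n := by
    rintro n ⟨w, e, ε⟩ ⟨h1, h2, h3⟩
    simp only at h1 h2 h3
    have p2 : (1 : ℝ) ≤ 2 ^ n := one_le_pow₀ (by norm_num)
    have hρn : ρ / 2 / 2 ^ (n + 1) < ρ / 2 / 2 ^ n := by
      apply div_lt_div_of_pos_left (by positivity) (by positivity)
      rw [pow_succ]; linarith
    have hdiff : ρ / 2 + ρ / 2 / 2 ^ n - (ρ / 2 + ρ / 2 / 2 ^ (n + 1)) = ρ / 4 / 2 ^ n := by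
      rw [pow_succ]; field_simp; ring
    have hx : q / (4 * B) ^ n ≤ q * (1 / 4) ^ n := by
      rw [div_eq_mul_inv, ← inv_pow, one_div]
      gcongr
      linarith
    have hY : 170 * (M / A) * (γ⁻¹ * m.factorial / ((ρ / 4 / 2 ^ n) / 2) ^ m) ^ 2 *
        (q / (4 * B) ^ n) = A₀ * q * (1 / 4) ^ n := by
      have e1 : γ⁻¹ * m.factorial / ((ρ / 4 / 2 ^ n) / 2) ^ m = G₁ * (2 ^ m) ^ n := by
        rw [hG₁, ← pow_mul, mul_comm m n, pow_mul, show ρ / 4 / 2 ^ n / 2 = ρ / 8 / 2 ^ n by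
          field_simp; norm_num, div_pow (ρ / 8)]
        field_simp
      have e2 : ((2 : ℝ) ^ m) ^ 2 = B := by
        rw [hB, ← pow_mul, mul_comm, pow_mul]; norm_num
      have e3 : ((1 : ℝ) / 4) ^ n = 1 / 4 ^ n := one_div_pow _ _
      rw [e1, mul_pow, ← pow_mul (2 ^ m : ℝ), mul_comm n 2, pow_mul (2 ^ m : ℝ), e2, mul_pow 4 B,
        e3, hA₀, hQ]
      field_simp
    have hp4 : ((1 : ℝ) / 4) ^ n ≤ 1 := pow_le_one₀ (by norm_num) (by norm_num)
    have hp2 : 0 ≤ 1 / (2 : ℝ) ^ n := by positivity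
    have hp2' : 1 / (2 : ℝ) ^ n ≤ 1 := by rw [div_le_one (by positivity)]; exact p2
    have hθ : 4 * (A₀ * q) * (1 - 1 / 2 ^ n) ≤ 4 * (A₀ * q) := by nlinarith
    obtain ⟨δ, w', e', hδ, hw', he', heq'⟩ := newton_step (σ := ρ / 2)
      (ρ' := ρ / 2 + ρ / 2 / 2 ^ (n + 1)) (Y := A₀ * q * (1 / 4) ^ n) hγ (by positivity)
      (le_add_of_nonneg_right (by positivity)) (by linarith)
      (by
        rw [hdiff, div_le_iff₀ (by positivity)]
        nlinarith) hn hμ hd hA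
      (ha.mono (by
        have : ρ / 2 / 2 ^ n ≤ ρ / 2 := div_le_self (by positivity) p2
        linarith) le_rfl) ha0 (by rw [← hG]; exact hμG) h2 h1 (by linarith)
      (by
        have h4 : 40 * M * (4 * (A₀ * q)) = A * (160 * (A₀ * q * Q)) := by
          rw [hQ]; field_simp; ring
        calc _ ≤ 40 * M * (4 * (A₀ * q)) := by gcongr
          _ = A * (160 * (A₀ * q * Q)) := h4
          _ ≤ A := by nlinarith)
      h3 (by rw [hdiff]; exact hY) (by nlinarith)
    refine ⟨(w', e', ε + δ), ⟨?_, ?_, heq'⟩, ?_, ?_⟩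
    · have h5 := (h1.mono (ρ' := ρ / 2 + ρ / 2 / 2 ^ (n + 1)) (by linarith) le_rfl).add hw'
      rw [add_sub_cancel] at h5
      refine h5.mono le_rfl ?_
      have h6 : ((1 : ℝ) / 4) ^ n ≤ 1 / 2 ^ n := by
        rw [div_pow, one_pow]
        apply one_div_le_one_div_of_le (by positivity)
        gcongr; norm_num
      have h7 : (1 : ℝ) / 2 ^ (n + 1) = 1 / 2 ^ n / 2 := by rw [pow_succ]; field_simp
      rw [h7]
      nlinarith
    · refine he'.mono le_rfl ?_
      have e1 : 20 * (M / A) * (A₀ * q * (1 / 4) ^ n) * (q / (4 * B) ^ n) =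
          (80 * (A₀ * q * Q * B)) * (1 / 4) ^ n * (q / (4 * B) ^ (n + 1)) := by
        rw [pow_succ (4 * B), hQ]; field_simp; ring
      rw [e1]
      refine mul_le_of_le_one_left (by positivity) (mul_le_one₀ (by linarith) (by positivity) hp4)
    · exact hw'.mono (le_add_of_nonneg_right (by positivity)) (by linarith)
    · simp only [add_sub_cancel_left]
      refine hδ.trans ?_
      calc 6 * (q / (4 * B) ^ n) / A ≤ 6 * (q * (1 / 4) ^ n) / A := by gcongr
        _ = _ := by ring
  choose! f hf using hstep
  have hev0 : ∀ t, ev ω 0 t = 0 := fun t => by simp [ev]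
  have hdif0 : dif ω (0 : (Fin r → ℤ) → ℂ) = 0 := by funext k; simp [dif]
  -- The initial ε = μ²/A is the value for which the residual at u = 1 has mean zero.
  let s : ℕ → ((Fin r → ℤ) → ℂ) × ((Fin r → ℤ) → ℂ) × ℂ := fun n =>
    Nat.rec (0, ((μ ^ 2 / A : ℝ) : ℂ) • a - ((μ ^ 2 : ℝ) : ℂ) • one, ((μ ^ 2 / A : ℝ) : ℂ)) f n
  have hs0 : s 0 = (0, ((μ ^ 2 / A : ℝ) : ℂ) • a - ((μ ^ 2 : ℝ) : ℂ) • one,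
    ((μ ^ 2 / A : ℝ) : ℂ)) := rfl
  have hsucc : ∀ n, s (n + 1) = f n (s n) := fun n => rfl
  have hP : ∀ n, P n (s n) := by
    intro n
    induction n with
    | zero =>
      rw [hs0]
      refine ⟨by simp [Bd], ?_, fun t => ?_⟩
      · refine ((((ha.mono (ρ' := ρ / 2 + ρ / 2 / 2 ^ 0) (by simp) le_rfl).smul _).sub
          ((bd_one _).smul _)).mono le_rfl ?_)
        rw [Complex.norm_real, Complex.norm_real, Real.norm_eq_abs, Real.norm_eq_abs,
          abs_of_nonneg (by positivity), abs_of_nonneg (by positivity), hq, pow_zero, div_one]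
        have : μ ^ 2 / A * M = Q * μ ^ 2 := by rw [hQ]; ring
        rw [this]
        nlinarith [sq_nonneg μ]
      · simp only [hdif0, hev0]
        rw [ev_sub (ha.smul _) hρ.le ((bd_one ρ).smul _) hρ.le, ev_smul, ev_smul, ev_one]
        push_cast
        ring
    | succ n ih => rw [hsucc]; exact (hf n _ ih).1
  have hd1 : ∀ n, Bd (ρ / 2) ((s (n + 1)).1 - (s n).1) (2 * (A₀ * q) * (1 / 4) ^ n) := fun n => by
    rw [hsucc]; exact (hf n _ (hP n)).2.1
  have hd2 : ∀ n, ‖(s (n + 1)).2.2 - (s n).2.2‖ ≤ 6 * q / A * (1 / 4) ^ n := fun n => by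
    rw [hsucc]; exact (hf n _ (hP n)).2.2
  obtain ⟨v, hv, hlim⟩ := exists_limit (w := fun n => (s n).1) (by rw [hs0]) hd1 (by positivity)
    ((hasSum_geometric_of_lt_one (by norm_num : (0 : ℝ) ≤ 1 / 4) (by norm_num)).mul_left _) ω
  have hcau : CauchySeq fun n => (s n).2.2 := by
    refine cauchySeq_of_le_geometric (1 / 4) (6 * q / A) (by norm_num) fun n => ?_
    rw [dist_comm, dist_eq_norm]; exact hd2 n
  obtain ⟨ε, hε⟩ := cauchySeq_tendsto_of_complete hcau
  have hv' : Bd (ρ / 2) v (8 * A₀ * Q * μ ^ 2) := hv.mono le_rfl (by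
    rw [hq]
    have : 0 ≤ A₀ * Q * μ ^ 2 := by positivity
    norm_num
    nlinarith)
  have hvsmall : 8 * A₀ * Q * μ ^ 2 ≤ 1 / 2 := by
    have : 8 * A₀ * Q * μ ^ 2 = 4 * (A₀ * q) := by rw [hq]; ring
    rw [this]; linarith
  refine ⟨ε, v, hv', fun t => ?_⟩
  obtain ⟨l0, l1, l2⟩ := hlim t
  have he0 : Tendsto (fun n => ev ω (s n).2.1 t) atTop (𝓝 0) := by
    have hb : Tendsto (fun n : ℕ => q * (1 / (4 * B)) ^ n) atTop (𝓝 0) := by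
      have : Tendsto (fun n : ℕ => (1 / (4 * B)) ^ n) atTop (𝓝 0) :=
        tendsto_pow_atTop_nhds_zero_of_lt_one (by positivity) (by
          rw [div_lt_one (by positivity)]
          linarith)
      simpa using this.const_mul q
    refine squeeze_zero_norm (fun n => ?_) hb
    have := (hP n).2.1.norm_ev_le (by positivity) ω t
    refine this.trans (le_of_eq ?_)
    rw [div_pow, one_pow]; ring
  have hl := (l0.const_add 1).mul ((l2.add (l1.const_mul (2 * I * μ))).add
    (((hε.mul_const (ev ω a t)).sub_const ((μ : ℂ) ^ 2)).mul (l0.const_add 1)))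
  have hz := tendsto_nhds_unique (hl.congr fun n => (hP n).2.2 t) he0
  -- The scheme controls the equation multiplied by 1 + v; this factor is cancelled since |v| ≤ 1/2.
  refine (mul_eq_zero.1 hz).resolve_left fun h => ?_
  have h1 := hv'.norm_ev_le (by positivity) ω t
  rw [show ev ω v t = -1 by linear_combination h, norm_neg, norm_one] at h1
  linarith

end QPHill

/-! ### Floquet solutions: Wronskian estimates and reducibility. -/

namespace QPHill

open Complex (I)
open scoped ComplexConjugate

/-- `e^{iμt} u` solves Hill's equation, and `u` is `h`-close to `1` (with derivative `v`). -/
structure Floquet (a : ℝ → ℝ) (μ : ℝ) (ε : ℂ) (h : ℝ) (u v : ℝ → ℂ) : Prop where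
  deriv_u : ∀ t, HasDerivAt u (v t) t
  deriv_v : ∀ t, HasDerivAt v (-2 * I * μ * v t - (ε * a t - μ ^ 2) * u t) t
  norm_u : ∀ t, ‖u t - 1‖ ≤ h
  norm_v : ∀ t, ‖v t‖ ≤ h * μ

/-- At ε = 0 the constant solution has exponent 0. It is the reference solution against which the
size of ε is measured. -/
lemma floquet_zero (a : ℝ → ℝ) {h : ℝ} (hh : 0 ≤ h) : Floquet a 0 0 h (fun _ => 1) (fun _ => 0) where
  deriv_u t := hasDerivAt_const t 1
  deriv_v t := by simpa using hasDerivAt_const t (0 : ℂ)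
  norm_u t := by simpa using hh
  norm_v t := by simp

lemma HasDerivAt.complex_conj {f : ℝ → ℂ} {f' : ℂ} {t : ℝ} (hf : HasDerivAt f f' t) :
    HasDerivAt (fun t => conj (f t)) (conj f') t :=
  (Complex.conjCLE.toContinuousLinearMap.hasFDerivAt.comp_hasDerivAt t hf)

/-- Averaging the Wronskian identity of two Floquet solutions relates the parameters to the
exponents. -/
lemma Floquet.pair_estimate {a : ℝ → ℝ} {μ ν A K h : ℝ} {ε δ : ℂ} {u v p q : ℝ → ℂ}
    (hu : Floquet a μ ε h u v) (hp : Floquet a ν δ h p q) (hμ : 0 ≤ μ) (hν : 0 ≤ ν)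
    (hh : h ≤ 1) (ha : Continuous a) (hK : ∀ t, |a t| ≤ K) (hA : HasAverage a A) :
    ‖(ε - conj δ) * A - (μ ^ 2 - ν ^ 2 : ℝ)‖ ≤
      5 * h * (K * ‖ε - conj δ‖ + |μ ^ 2 - ν ^ 2|) := by
  have hh0 : 0 ≤ h := (norm_nonneg _).trans (hu.norm_u 0)
  have hK0 : 0 ≤ K := (abs_nonneg _).trans (hK 0)
  set Δ := ε - conj δ with hΔ
  -- Q is the Wronskian of e^{iμt}u and the conjugate of e^{iνt}p, stripped of its factor
  -- e^{i(μ-ν)t}. As a is real, it satisfies Q' = -i(μ-ν)Q - Δ a u p̄.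
  let Q : ℝ → ℂ := fun t => I * (μ + ν) * (u t * conj (p t)) + v t * conj (p t) - u t * conj (q t)
  have hnu : ∀ t, ‖u t‖ ≤ 1 + h := fun t => by
    have := norm_add_le (u t - 1) 1
    rw [sub_add_cancel, norm_one] at this
    linarith [hu.norm_u t]
  have hnp : ∀ t, ‖conj (p t)‖ ≤ 1 + h := fun t => by
    rw [RCLike.norm_conj]
    have := norm_add_le (p t - 1) 1
    rw [sub_add_cancel, norm_one] at this
    linarith [hp.norm_u t]
  have hup : ∀ t, ‖u t * conj (p t) - 1‖ ≤ 3 * h := fun t => by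
    have e : u t * conj (p t) - 1 = (u t - 1) * conj (p t) + conj (p t - 1) := by
      rw [map_sub, map_one]; ring
    rw [e]
    refine (norm_add_le _ _).trans ?_
    rw [norm_mul, RCLike.norm_conj (p t - 1)]
    have h1 := hp.norm_u t
    have h2 : ‖u t - 1‖ * ‖conj (p t)‖ ≤ h * 2 :=
      mul_le_mul (hu.norm_u t) ((hnp t).trans (by linarith)) (norm_nonneg _) hh0
    linarith
  have hQ : ∀ t, ‖Q t - I * (μ + ν)‖ ≤ 5 * h * (μ + ν) := fun t => by
    have e : Q t - I * (μ + ν) = I * ((μ + ν : ℝ) : ℂ) * (u t * conj (p t) - 1) +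
        (v t * conj (p t) - u t * conj (q t)) := by simp only [Q]; push_cast; ring
    rw [e]
    refine (norm_add_le _ _).trans ?_
    have h1 : ‖I * ((μ + ν : ℝ) : ℂ) * (u t * conj (p t) - 1)‖ ≤ (μ + ν) * (3 * h) := by
      rw [norm_mul, norm_mul, Complex.norm_I, one_mul, Complex.norm_real, Real.norm_eq_abs,
        abs_of_nonneg (by linarith)]
      exact mul_le_mul_of_nonneg_left (hup t) (by linarith)
    have h2 : ‖v t * conj (p t)‖ ≤ h * μ * 2 := by
      rw [norm_mul]
      exact mul_le_mul (hu.norm_v t) ((hnp t).trans (by linarith)) (norm_nonneg _) (by positivity)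
    have h3 : ‖u t * conj (q t)‖ ≤ 2 * (h * ν) := by
      rw [norm_mul, RCLike.norm_conj]
      exact mul_le_mul ((hnu t).trans (by linarith)) (hp.norm_v t) (norm_nonneg _) (by norm_num)
    have h4 := norm_sub_le (v t * conj (p t)) (u t * conj (q t))
    nlinarith
  have hQd : ∀ t, HasDerivAt Q (-(I * (μ - ν) * Q t) - Δ * a t * (u t * conj (p t))) t := fun t => by
    have d1 := (hu.deriv_u t).mul (HasDerivAt.complex_conj (hp.deriv_u t))
    have d2 := (hu.deriv_v t).mul (HasDerivAt.complex_conj (hp.deriv_u t))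
    have d3 := (hu.deriv_u t).mul (HasDerivAt.complex_conj (hp.deriv_v t))
    have d4 := ((d1.const_mul (I * (μ + ν))).add d2).sub d3
    refine HasDerivAt.congr_deriv d4 ?_
    simp only [Q, hΔ, map_sub, map_mul, map_neg, map_pow, Complex.conj_ofReal, Complex.conj_I,
      map_ofNat]
    linear_combination ((μ : ℂ) ^ 2 - ν ^ 2) * conj (p t) * u t * Complex.I_sq
  have hInt : ∀ t, HasDerivAt (fun t => ((∫ s in (0 : ℝ)..t, a s : ℝ) : ℂ)) (a t : ℂ) t := fun t =>
    (intervalIntegral.integral_hasDerivAt_right (ha.intervalIntegrable _ _)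
      (ha.stronglyMeasurableAtFilter _ _) ha.continuousAt).ofReal_comp
  -- Replacing Q by i(μ+ν) and u p̄ by 1 in the equation for Q' leaves μ² - ν² - Δa. R removes the
  -- integral of this main part, so only O(h) terms remain in R'.
  let R : ℝ → ℂ := fun t => Q t - ((μ ^ 2 - ν ^ 2 : ℝ) : ℂ) * t +
    Δ * ((∫ s in (0 : ℝ)..t, a s : ℝ) : ℂ)
  have hRd : ∀ t, HasDerivAt R (-(I * (μ - ν)) * (Q t - I * (μ + ν)) -
      Δ * a t * (u t * conj (p t) - 1)) t := fun t => by
    have d1 := ((hQd t).sub (((hasDerivAt_id t).ofReal_comp).const_mul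
      ((μ ^ 2 - ν ^ 2 : ℝ) : ℂ))).add ((hInt t).const_mul Δ)
    refine HasDerivAt.congr_deriv d1 ?_
    push_cast
    linear_combination -((μ : ℂ) ^ 2 - ν ^ 2) * Complex.I_sq
  set c := 5 * h * (K * ‖Δ‖ + |μ ^ 2 - ν ^ 2|) with hc
  have hRb : ∀ t, ‖-(I * (μ - ν)) * (Q t - I * (μ + ν)) - Δ * a t * (u t * conj (p t) - 1)‖ ≤ c :=
    fun t => by
    refine (norm_sub_le _ _).trans ?_
    have h1 : ‖-(I * (μ - ν)) * (Q t - I * (μ + ν))‖ ≤ |μ - ν| * (5 * h * (μ + ν)) := by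
      rw [norm_mul, norm_neg, norm_mul, Complex.norm_I, one_mul, ← Complex.ofReal_sub,
        Complex.norm_real, Real.norm_eq_abs]
      exact mul_le_mul_of_nonneg_left (hQ t) (abs_nonneg _)
    have h2 : ‖Δ * a t * (u t * conj (p t) - 1)‖ ≤ ‖Δ‖ * K * (3 * h) := by
      rw [norm_mul, norm_mul, Complex.norm_real, Real.norm_eq_abs]
      have := hK t
      have := hup t
      gcongr
    have h3 : |μ ^ 2 - ν ^ 2| = |μ - ν| * (μ + ν) := by
      rw [sq_sub_sq, abs_mul, abs_of_nonneg (by linarith : 0 ≤ μ + ν)]; ring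
    have h4 : 0 ≤ ‖Δ‖ * K * h := by positivity
    rw [hc, h3]
    linarith
  set D := (10 * h + 2) * (μ + ν) with hD
  have hQn : ∀ t, ‖Q t‖ ≤ D := fun t => by
    have h1 := norm_add_le (Q t - I * (μ + ν)) (I * (μ + ν))
    rw [sub_add_cancel, norm_mul, Complex.norm_I, one_mul, ← Complex.ofReal_add,
      Complex.norm_real, Real.norm_eq_abs, abs_of_nonneg (by linarith : 0 ≤ μ + ν)] at h1
    have h2 := hQ t
    push_cast at h1
    have : 0 ≤ h * (μ + ν) := by positivity
    rw [hD]
    linarith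
  -- The mean value inequality for R on [-T, T], divided by 2T; the bounded boundary terms Q(±T)
  -- contribute D/T.
  have hbound : ∀ T : ℝ, 0 < T → ‖Δ * ((1 / (2 * T) * ∫ t in (-T)..T, a t : ℝ) : ℂ) -
      (μ ^ 2 - ν ^ 2 : ℝ)‖ ≤ c + D / T := fun T hT => by
    have h1 : ‖R T - R (-T)‖ ≤ c * ‖T - -T‖ :=
      convex_univ.norm_image_sub_le_of_norm_hasDerivWithin_le
        (fun t _ => (hRd t).hasDerivWithinAt) (fun t _ => hRb t) (mem_univ _) (mem_univ _)
    have h2 : R T - R (-T) = (Q T - Q (-T)) + 2 * T * (Δ *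
        ((1 / (2 * T) * ∫ t in (-T)..T, a t : ℝ) : ℂ) - (μ ^ 2 - ν ^ 2 : ℝ)) := by
      have h3 : ∫ t in (-T)..T, a t = (∫ t in (0 : ℝ)..T, a t) - ∫ t in (0 : ℝ)..(-T), a t :=
        (intervalIntegral.integral_interval_sub_left (ha.intervalIntegrable _ _)
          (ha.intervalIntegrable _ _)).symm
      have hT' : (T : ℂ) ≠ 0 := by exact_mod_cast hT.ne'
      simp only [R, h3]
      push_cast
      field_simp
      ring
    have h4 : 2 * T * ‖Δ * ((1 / (2 * T) * ∫ t in (-T)..T, a t : ℝ) : ℂ) -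
        (μ ^ 2 - ν ^ 2 : ℝ)‖ ≤ c * (2 * T) + 2 * D := by
      have h5 : ‖(2 * T : ℂ)‖ = 2 * T := by simp [abs_of_pos hT]
      rw [← h5, ← norm_mul, h5]
      have h6 := norm_sub_le (R T - R (-T)) (Q T - Q (-T))
      rw [h2, add_sub_cancel_left] at h6
      rw [← h2] at h6
      have h7 := norm_sub_le (Q T) (Q (-T))
      rw [sub_neg_eq_add, Real.norm_eq_abs, abs_of_pos (by linarith)] at h1
      linarith [hQn T, hQn (-T)]
    have h8 : c + D / T = (c * (2 * T) + 2 * D) / (2 * T) := by field_simp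
    rw [h8, le_div_iff₀ (by linarith)]
    linarith
  have hl1 : Tendsto (fun T : ℝ => ‖Δ * ((1 / (2 * T) * ∫ t in (-T)..T, a t : ℝ) : ℂ) -
      (μ ^ 2 - ν ^ 2 : ℝ)‖) atTop (𝓝 ‖Δ * A - (μ ^ 2 - ν ^ 2 : ℝ)‖) :=
    ((((Complex.continuous_ofReal.tendsto A).comp hA).const_mul Δ).sub_const _).norm
  have hl2 : Tendsto (fun T : ℝ => c + D / T) atTop (𝓝 (c + 0)) :=
    (tendsto_const_nhds.div_atTop tendsto_id).const_add c
  rw [add_zero] at hl2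
  exact le_of_tendsto_of_tendsto hl1 hl2 ((eventually_gt_atTop 0).mono hbound)

/-- The parameter of a Floquet solution close to `1` with real exponent is real. -/
lemma Floquet.param_real {a : ℝ → ℝ} {μ A K h : ℝ} {ε : ℂ} {u v : ℝ → ℂ}
    (hu : Floquet a μ ε h u v) (hμ : 0 ≤ μ) (hh : h ≤ 1) (ha : Continuous a)
    (hK : ∀ t, |a t| ≤ K) (hA : HasAverage a A) (hsmall : 5 * h * K < A) : ε = (ε.re : ℂ) := by
  -- Paired with itself the difference of exponents vanishes, leaving A|ε - ε̄| ≤ 5hK|ε - ε̄| with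
  -- 5hK < A.
  have h1 := hu.pair_estimate hu hμ hμ hh ha hK hA
  have h0 : 0 ≤ h := (norm_nonneg _).trans (hu.norm_u 0)
  have hK0 : 0 ≤ K := (abs_nonneg _).trans (hK 0)
  have hA0 : 0 < A := lt_of_le_of_lt (by positivity) hsmall
  rw [sub_self, Complex.ofReal_zero, sub_zero, abs_zero, add_zero, norm_mul, Complex.norm_real,
    Real.norm_eq_abs, abs_of_pos hA0] at h1
  have h2 : ‖ε - conj ε‖ = 0 := by
    by_contra hne
    have : 0 < ‖ε - conj ε‖ := lt_of_le_of_ne (norm_nonneg _) (Ne.symm hne)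
    nlinarith
  exact (Complex.conj_eq_iff_re.1 (sub_eq_zero.1 (norm_eq_zero.1 h2)).symm).symm

/-- By the product rule, P' = NP - PM is the condition for P to carry solutions of M to solutions of
N. Used for ψ and for ψ⁻¹, it gives the two directions of the equivalence. -/
lemma isSolution_mulVec {M N P : ℝ → Matrix (Fin 2) (Fin 2) ℝ} {y : ℝ → Fin 2 → ℝ}
    (hP : ∀ t i j, HasDerivAt (fun t => P t i j) ((N t * P t - P t * M t) i j) t)
    (hy : IsSolution M y) : IsSolution N (fun t => P t *ᵥ y t) := by
  intro t
  rw [hasDerivAt_pi]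
  intro i
  have hy' := hasDerivAt_pi.1 (hy t)
  have d := ((hP t i 0).mul (hy' 0)).add ((hP t i 1).mul (hy' 1))
  have e : (fun t => (P t *ᵥ y t) i) =
      ((fun t => P t i 0) * fun t => y t 0) + ((fun t => P t i 1) * fun t => y t 1) := by
    funext t
    simp [Matrix.mulVec, dotProduct, Fin.sum_univ_two]
  rw [e]
  refine HasDerivAt.congr_deriv d ?_
  simp [Matrix.mulVec, dotProduct, Fin.sum_univ_two, Matrix.mul_apply]
  ring

/-- Matrix form of the reducibility obtained from a Floquet solution. -/
lemma Floquet.reducible {r : ℕ} {ω : Fin r → ℝ} {a : ℝ → ℝ} {μ ε h ρ : ℝ} {u v : ℝ → ℂ}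
    (hu : Floquet a μ ε h u v) (hμ : 0 < μ) (hh : h ≤ 1 / 10) (hρ : 0 < ρ)
    (hQP : ∀ c : ℝ, ∀ z : ℂ, IsAnalyticQP ω ρ (fun t => c * (z * u t).re) ∧
      IsAnalyticQP ω ρ (fun t => c * (z * (v t + I * μ * u t)).re)) :
    IsReducible ω (fun t => hillA + ε • hillQ a t) := by
  -- s is the derivative of e^{iμt}u with the exponential factored out, the second component of the
  -- solution.
  let s : ℝ → ℂ := fun t => v t + I * μ * u t
  have hs : ∀ t, HasDerivAt s (-(I * μ * s t) - ε * a t * u t) t := fun t => by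
    refine HasDerivAt.congr_deriv ((hu.deriv_v t).add ((hu.deriv_u t).const_mul (I * μ))) ?_
    simp only [s]
    linear_combination (μ : ℂ) ^ 2 * u t * Complex.I_sq
  have hu' : ∀ t, HasDerivAt u (s t - I * μ * u t) t := fun t =>
    (hu.deriv_u t).congr_deriv (by simp only [s]; ring)
  have dre : ∀ {f : ℝ → ℂ} {f' : ℂ} {t : ℝ}, HasDerivAt f f' t →
      HasDerivAt (fun t => (f t).re) f'.re t := fun hf =>
    Complex.reCLM.hasFDerivAt.comp_hasDerivAt _ hf
  have dim : ∀ {f : ℝ → ℂ} {f' : ℂ} {t : ℝ}, HasDerivAt f f' t →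
      HasDerivAt (fun t => (f t).im) f'.im t := fun hf =>
    Complex.imCLM.hasFDerivAt.comp_hasDerivAt _ hf
  have du0 : ∀ t, HasDerivAt (fun t => (u t).re) ((s t).re + μ * (u t).im) t := fun t =>
    (dre (hu' t)).congr_deriv (by simp)
  have du1 : ∀ t, HasDerivAt (fun t => (u t).im) ((s t).im - μ * (u t).re) t := fun t =>
    (dim (hu' t)).congr_deriv (by simp)
  have ds0 : ∀ t, HasDerivAt (fun t => (s t).re) (μ * (s t).im - ε * a t * (u t).re) t := fun t =>
    (dre (hs t)).congr_deriv (by simp)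
  have ds1 : ∀ t, HasDerivAt (fun t => (s t).im) (-(μ * (s t).re) - ε * a t * (u t).im) t :=
    fun t => (dim (hs t)).congr_deriv (by simp)
  -- κ is the determinant of the unnormalised ψ. It is constant, and positive because its main term
  -- is μ|u|².
  let κ : ℝ → ℝ := fun t => (u t).re * (s t).im - (u t).im * (s t).re
  have hκd : ∀ t, HasDerivAt κ 0 t := fun t => by
    refine HasDerivAt.congr_deriv (((du0 t).mul (ds1 t)).sub ((du1 t).mul (ds0 t))) ?_
    ring
  have hκc : ∀ t, κ t = κ 0 := fun t =>
    is_const_of_deriv_eq_zero (fun t => (hκd t).differentiableAt) (fun t => (hκd t).deriv) t 0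
  have hh0 : 0 ≤ h := (norm_nonneg _).trans (hu.norm_u 0)
  have hun : ∀ t, ‖u t‖ ≤ 11 / 10 := fun t => by
    have := norm_add_le (u t - 1) 1
    rw [sub_add_cancel, norm_one] at this
    linarith [hu.norm_u t]
  have hvn : ∀ t, ‖v t‖ ≤ μ / 10 := fun t => (hu.norm_v t).trans (by nlinarith)
  have hsn : ∀ t, ‖s t‖ ≤ 2 * μ := fun t => by
    refine (norm_add_le _ _).trans ?_
    rw [norm_mul, norm_mul, Complex.norm_I, one_mul, Complex.norm_real, Real.norm_eq_abs,
      abs_of_pos hμ]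
    nlinarith [hun t, hvn t]
  have hκ0 : 0 < κ 0 := by
    have h1 : κ 0 = μ * Complex.normSq (u 0) + ((u 0).re * (v 0).im - (u 0).im * (v 0).re) := by
      simp only [κ, s, Complex.normSq_apply]; simp; ring
    have h2 : (9 : ℝ) / 10 ≤ ‖u 0‖ := by
      have := norm_sub_norm_le (1 : ℂ) (u 0)
      rw [norm_sub_rev, norm_one] at this
      linarith [hu.norm_u 0]
    have h3 : ((u 0).re * (v 0).im - (u 0).im * (v 0).re) = (conj (u 0) * v 0).im := by
      simp; ring
    have h4 : |(conj (u 0) * v 0).im| ≤ 11 / 10 * (μ / 10) := by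
      refine (Complex.abs_im_le_norm _).trans ?_
      rw [norm_mul, RCLike.norm_conj]
      exact mul_le_mul (hun 0) (hvn 0) (norm_nonneg _) (by norm_num)
    rw [h1, h3, Complex.normSq_eq_norm_sq]
    have h5 := neg_abs_le (conj (u 0) * v 0).im
    have h6 : (81 : ℝ) / 100 ≤ ‖u 0‖ ^ 2 := by nlinarith
    have h7 : μ * (81 / 100) ≤ μ * ‖u 0‖ ^ 2 := mul_le_mul_of_nonneg_left h6 hμ.le
    linarith
  -- This scaling makes det ψ = 1, which for 2 × 2 matrices is the symplectic condition.
  set g := (Real.sqrt (κ 0))⁻¹ with hg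
  have hg0 : 0 < g := by positivity
  have hg2 : g * g * κ 0 = 1 := by
    rw [hg, ← mul_inv, Real.mul_self_sqrt hκ0.le, inv_mul_cancel₀ hκ0.ne']
  let ψ : ℝ → Matrix (Fin 2) (Fin 2) ℝ := fun t =>
    !![g * (u t).re, g * (u t).im; g * (s t).re, g * (s t).im]
  let B : Matrix (Fin 2) (Fin 2) ℝ := !![0, μ; -μ, 0]
  have hdet : ∀ t, (ψ t).det = 1 := fun t => by
    have : κ t = κ 0 := hκc t
    simp only [κ] at this
    rw [Matrix.det_fin_two]
    simp only [ψ, Matrix.of_apply, Matrix.cons_val', Matrix.cons_val_zero, Matrix.cons_val_one,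
      Matrix.cons_val_fin_one]
    rw [← hg2]
    simp only [κ]
    rw [← this]
    ring
  have hinv : ∀ t, (ψ t)⁻¹ = !![g * (s t).im, -(g * (u t).im); -(g * (s t).re), g * (u t).re] :=
    fun t => by
    rw [Matrix.inv_def, hdet, Ring.inverse_one, one_smul]
    simp [ψ, Matrix.adjugate_fin_two]
  have hψd : ∀ t i j, HasDerivAt (fun t => ψ t i j)
      (((hillA + ε • hillQ a t) * ψ t - ψ t * B) i j) t := fun t i j => by
    fin_cases i <;> fin_cases j
    · refine ((du0 t).const_mul g).congr_deriv ?_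
      simp [ψ, B, hillA, hillQ]; ring
    · refine ((du1 t).const_mul g).congr_deriv ?_
      simp [ψ, B, hillA, hillQ]; ring
    · refine ((ds0 t).const_mul g).congr_deriv ?_
      simp [ψ, B, hillA, hillQ]; ring
    · refine ((ds1 t).const_mul g).congr_deriv ?_
      simp [ψ, B, hillA, hillQ]; ring
  have hψid : ∀ t i j, HasDerivAt (fun t => (ψ t)⁻¹ i j)
      ((B * (ψ t)⁻¹ - (ψ t)⁻¹ * (hillA + ε • hillQ a t)) i j) t := fun t i j => by
    simp only [hinv]
    fin_cases i <;> fin_cases j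
    · refine ((ds1 t).const_mul g).congr_deriv ?_
      simp [B, hillA, hillQ]; ring
    · refine (((du1 t).const_mul g).neg).congr_deriv ?_
      simp [B, hillA, hillQ]; ring
    · refine (((ds0 t).const_mul g).neg).congr_deriv ?_
      simp [B, hillA, hillQ]; ring
    · refine ((du0 t).const_mul g).congr_deriv ?_
      simp [B, hillA, hillQ]; ring
  have hunit : ∀ t, IsUnit (ψ t).det := fun t => by rw [hdet]; exact isUnit_one
  have q1 : ∀ c : ℝ, IsAnalyticQP ω ρ (fun t => c * (u t).re) := fun c => by
    simpa using (hQP c 1).1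
  have q2 : ∀ c : ℝ, IsAnalyticQP ω ρ (fun t => c * (u t).im) := fun c => by
    simpa using (hQP c (-I)).1
  have q3 : ∀ c : ℝ, IsAnalyticQP ω ρ (fun t => c * (s t).re) := fun c => by
    simpa [s] using (hQP c 1).2
  have q4 : ∀ c : ℝ, IsAnalyticQP ω ρ (fun t => c * (s t).im) := fun c => by
    have := (hQP c (-I)).2
    simpa only [neg_mul, Complex.neg_re, Complex.I_mul_re, neg_neg] using this
  refine ⟨ψ, B, ⟨ρ, hρ, fun i j => ?_, fun i j => ?_⟩, ⟨g * 2 + g * (2 * μ), fun t i j => ?_⟩,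
    hunit, fun t => ?_, ⟨μ • 1, ?_, ?_⟩, fun y => ⟨fun h => ?_, fun h => ?_⟩⟩
  · fin_cases i <;> fin_cases j
    · exact q1 g
    · exact q2 g
    · exact q3 g
    · exact q4 g
  · simp only [hinv]
    fin_cases i <;> fin_cases j
    · exact q4 g
    · simpa using q2 (-g)
    · simpa using q3 (-g)
    · exact q1 g
  · have b1 : |g * (u t).re| ≤ g * 2 + g * (2 * μ) := by
      rw [abs_mul, abs_of_pos hg0]
      nlinarith [(Complex.abs_re_le_norm (u t)).trans (hun t)]
    have b2 : |g * (u t).im| ≤ g * 2 + g * (2 * μ) := by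
      rw [abs_mul, abs_of_pos hg0]
      nlinarith [(Complex.abs_im_le_norm (u t)).trans (hun t)]
    have b3 : |g * (s t).re| ≤ g * 2 + g * (2 * μ) := by
      rw [abs_mul, abs_of_pos hg0]
      nlinarith [(Complex.abs_re_le_norm (s t)).trans (hsn t)]
    have b4 : |g * (s t).im| ≤ g * 2 + g * (2 * μ) := by
      rw [abs_mul, abs_of_pos hg0]
      nlinarith [(Complex.abs_im_le_norm (s t)).trans (hsn t)]
    rw [hinv]
    fin_cases i <;> fin_cases j
    · exact ⟨b1, b4⟩
    · exact ⟨b2, by simpa using b2⟩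
    · exact ⟨b3, by simpa using b3⟩
    · exact ⟨b4, b1⟩
  · have h1 := hdet t
    rw [Matrix.det_fin_two] at h1
    unfold IsSymplectic J
    ext i j
    fin_cases i <;> fin_cases j <;>
      simp [Matrix.mul_apply, Fin.sum_univ_two] <;> linarith
  · exact (Matrix.isSymm_one).smul μ
  · ext i j
    fin_cases i <;> fin_cases j <;> simp [B, J]
  · have h1 := isSolution_mulVec hψid h
    have h2 : (fun t => (ψ t)⁻¹ *ᵥ (ψ t *ᵥ y t)) = y := by
      funext t
      rw [Matrix.mulVec_mulVec, Matrix.nonsing_inv_mul _ (hunit t), Matrix.one_mulVec]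
    rwa [h2] at h1
  · exact isSolution_mulVec hψd h

end QPHill

/-! ### From coefficients to analytic functions on a strip. -/

namespace QPHill

open Complex (I)
open scoped ComplexConjugate

variable {r : ℕ}

/-- The linear form `θ ↦ i⟨k, θ⟩`. -/
noncomputable def phase (k : Fin r → ℤ) : (Fin r → ℂ) →L[ℂ] ℂ :=
  I • ∑ j, (k j : ℂ) • ContinuousLinearMap.proj j

lemma phase_apply (k : Fin r → ℤ) (θ : Fin r → ℂ) : phase k θ = I * ∑ j, (k j : ℂ) * θ j := by
  simp [phase]

lemma norm_phase_le (k : Fin r → ℤ) : ‖phase k‖ ≤ len k := by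
  refine ContinuousLinearMap.opNorm_le_bound _ (len_nonneg k) fun θ => ?_
  rw [phase_apply, norm_mul, Complex.norm_I, one_mul, len, Finset.sum_mul]
  refine (norm_sum_le _ _).trans (Finset.sum_le_sum fun j _ => ?_)
  rw [norm_mul, Complex.norm_intCast]
  exact mul_le_mul_of_nonneg_left (norm_le_pi_norm θ j) (abs_nonneg _)

lemma norm_exp_phase_le {ρ : ℝ} (k : Fin r → ℤ) {θ : Fin r → ℂ} (hθ : θ ∈ strip r ρ) :
    ‖Complex.exp (phase k θ)‖ ≤ Real.exp (ρ * len k) := by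
  rw [Complex.norm_exp, Real.exp_le_exp, phase_apply, Complex.I_mul_re, Complex.im_sum, len,
    Finset.mul_sum, ← Finset.sum_neg_distrib]
  refine Finset.sum_le_sum fun j _ => ?_
  have h1 : ((k j : ℂ) * θ j).im = (k j : ℝ) * (θ j).im := by
    rw [Complex.mul_im]; simp
  rw [h1]
  have h2 := neg_abs_le ((k j : ℝ) * (θ j).im)
  rw [abs_mul] at h2
  have h3 := mul_le_mul_of_nonneg_left (hθ j) (abs_nonneg (k j : ℝ))
  linarith

/-- The function on the strip with Fourier coefficients `c`. -/
noncomputable def evStrip (c : (Fin r → ℤ) → ℂ) (θ : Fin r → ℂ) : ℂ :=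
  ∑' k, c k * Complex.exp (phase k θ)

/-- The monomial `y ↦ (i⟨k, y⟩)ⁿ` as a multilinear map. -/
noncomputable def phasePow (k : Fin r → ℤ) (n : ℕ) :
    ContinuousMultilinearMap ℂ (fun _ : Fin n => Fin r → ℂ) ℂ :=
  (ContinuousMultilinearMap.mkPiAlgebraFin ℂ n ℂ).compContinuousLinearMap fun _ => phase k

lemma phasePow_apply (k : Fin r → ℤ) (n : ℕ) (y : Fin r → ℂ) :
    (phasePow k n fun _ => y) = phase k y ^ n := by
  simp [phasePow, ContinuousMultilinearMap.compContinuousLinearMap_apply]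

lemma norm_phasePow_le (k : Fin r → ℤ) (n : ℕ) : ‖phasePow k n‖ ≤ len k ^ n := by
  refine (ContinuousMultilinearMap.norm_compContinuousLinearMap_le _ _).trans ?_
  rw [ContinuousMultilinearMap.norm_mkPiAlgebraFin, one_mul, Finset.prod_const, Finset.card_univ,
    Fintype.card_fin]
  exact pow_le_pow_left₀ (norm_nonneg _) (norm_phase_le k) n

/-- Each exponential is expanded at θ. With δ = ρ - ρ', the double series of |c_k|
e^{ρ'|k|}(δ|k|)ⁿ/n! sums to that of |c_k| e^{ρ|k|}, so the sums may be exchanged and the power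
series at θ converges on a ball of radius δ. -/
lemma analyticOnNhd_evStrip {ρ ρ' M : ℝ} {c : (Fin r → ℤ) → ℂ} (h : Bd ρ c M) (hρ : ρ' < ρ) :
    AnalyticOnNhd ℂ (evStrip c) (strip r ρ') := by
  intro θ hθ
  set δ : NNReal := ⟨ρ - ρ', (sub_pos.2 hρ).le⟩ with hδ
  have hδ0 : 0 < δ := sub_pos.2 hρ
  have hδc : (δ : ℝ) = ρ - ρ' := rfl
  let T : (Fin r → ℤ) → (n : ℕ) → ContinuousMultilinearMap ℂ (fun _ : Fin n => Fin r → ℂ) ℂ :=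
    fun k n => (c k * Complex.exp (phase k θ) * (n.factorial : ℂ)⁻¹) • phasePow k n
  let S : (Fin r → ℤ) × ℕ → ℝ := fun p =>
    ‖c p.1‖ * Real.exp (ρ' * len p.1) * (((δ : ℝ) * len p.1) ^ p.2 / p.2.factorial)
  have hexp : ∀ x : ℝ, HasSum (fun n : ℕ => x ^ n / n.factorial) (Real.exp x) := fun x => by
    rw [Real.exp_eq_exp_ℝ]; exact NormedSpace.expSeries_div_hasSum_exp x
  have hexpc : ∀ x : ℂ, HasSum (fun n : ℕ => x ^ n / n.factorial) (Complex.exp x) := fun x => by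
    rw [Complex.exp_eq_exp_ℂ]; exact NormedSpace.expSeries_div_hasSum_exp x
  have hl := fun k : Fin r → ℤ => len_nonneg k
  have hS0 : ∀ p, 0 ≤ S p := fun p => by
    have := hl p.1
    positivity
  have hS : Summable S := by
    have h1 : ∀ k, HasSum (fun n => S (k, n)) (‖c k‖ * Real.exp (ρ * len k)) := fun k => by
      have h2 := (hexp (δ * len k)).mul_left (‖c k‖ * Real.exp (ρ' * len k))
      have h3 : ‖c k‖ * Real.exp (ρ' * len k) * Real.exp (δ * len k) =
          ‖c k‖ * Real.exp (ρ * len k) := by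
        rw [mul_assoc, ← Real.exp_add, hδc]
        ring_nf
      rw [← h3]
      exact h2
    refine (summable_prod_of_nonneg hS0).2 ⟨fun k => (h1 k).summable, ?_⟩
    exact h.1.congr fun k => ((h1 k).tsum_eq).symm
  have hT : ∀ k n, ‖T k n‖ * (δ : ℝ) ^ n ≤ S (k, n) := fun k n => by
    simp only [T, S, norm_smul, norm_mul, norm_inv, Complex.norm_natCast]
    have h1 := norm_exp_phase_le k hθ
    have h2 := norm_phasePow_le k n
    calc _ ≤ ‖c k‖ * Real.exp (ρ' * len k) * ((n.factorial : ℝ)⁻¹) * len k ^ n * (δ : ℝ) ^ n := by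
          gcongr
      _ = _ := by rw [mul_pow]; field_simp
  have hSw : Summable fun p : ℕ × (Fin r → ℤ) => S (p.2, p.1) :=
    (Equiv.prodComm ℕ (Fin r → ℤ)).summable_iff.2 hS
  have hTs : ∀ n, Summable fun k => T k n := fun n => by
    refine Summable.of_norm_bounded (g := fun k => S (k, n) * ((δ : ℝ) ^ n)⁻¹)
      ((hSw.prod_factor n).mul_right _) fun k => ?_
    rw [← div_eq_mul_inv, le_div_iff₀ (by positivity)]
    exact hT k n
  let p : FormalMultilinearSeries ℂ (Fin r → ℂ) ℂ := fun n => ∑' k, T k n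
  have hp : ∀ n, ‖p n‖ * (δ : ℝ) ^ n ≤ ∑' k, S (k, n) := fun n => by
    have h1 : Summable fun k => ‖T k n‖ * (δ : ℝ) ^ n :=
      Summable.of_nonneg_of_le (fun k => by positivity) (fun k => hT k n) (hSw.prod_factor n)
    have h2 : Summable fun k => ‖T k n‖ :=
      (summable_mul_right_iff (by positivity)).1 h1
    calc _ ≤ (∑' k, ‖T k n‖) * (δ : ℝ) ^ n := by
          gcongr; exact norm_tsum_le_tsum_norm h2
      _ = ∑' k, ‖T k n‖ * (δ : ℝ) ^ n := tsum_mul_right.symm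
      _ ≤ _ := h1.tsum_le_tsum (fun k => hT k n) (hSw.prod_factor n)
  have hball : HasFPowerSeriesOnBall (evStrip c) p θ δ := by
    refine ⟨p.le_radius_of_summable ?_, by exact_mod_cast hδ0, fun {y} hy => ?_⟩
    · exact Summable.of_nonneg_of_le (fun n => by positivity) hp hSw.prod
    · have hy' : ‖y‖ ≤ δ := by
        rw [Metric.mem_eball, edist_zero_right] at hy
        have : ‖y‖ₑ < (δ : ENNReal) := hy
        rw [enorm_eq_nnnorm, ENNReal.coe_lt_coe] at this
        exact_mod_cast this.le
      obtain ⟨V, hV⟩ : ∃ V : (Fin r → ℤ) → ℕ → ℂ, ∀ k n,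
          V k n = c k * Complex.exp (phase k θ) * (phase k y ^ n / n.factorial) :=
        ⟨_, fun _ _ => rfl⟩
      have hv : ∀ k n, T k n (fun _ => y) = V k n := fun k n => by
        rw [hV]
        simp only [T, _root_.smul_apply, phasePow_apply, smul_eq_mul]
        ring
      have hb : ∀ k n, ‖V k n‖ ≤ S (k, n) := fun k n => by
        rw [← hv]
        refine ((T k n).le_opNorm _).trans (le_trans ?_ (hT k n))
        rw [Finset.prod_const, Finset.card_univ, Fintype.card_fin]
        gcongr
      have hs2 : Summable fun p : ℕ × (Fin r → ℤ) => V p.2 p.1 :=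
        Summable.of_norm_bounded hSw fun p => hb p.2 p.1
      have e1 : ∀ n, p n (fun _ => y) = ∑' k, V k n := fun n => by
        simp only [p, ContinuousMultilinearMap.tsum_eval (hTs n), hv]
      have e2 : evStrip c (θ + y) = ∑' n : ℕ, ∑' k, V k n := by
        rw [← Summable.tsum_comm (f := fun (n : ℕ) k => V k n) hs2]
        refine tsum_congr fun k => ?_
        simp only [hV]
        rw [tsum_mul_left, (hexpc _).tsum_eq, map_add, Complex.exp_add, mul_assoc]
      rw [e2]
      simp only [e1]
      exact hs2.prod.hasSum
  exact hball.analyticAt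

lemma evStrip_periodic (c : (Fin r → ℤ) → ℂ) (θ : Fin r → ℂ) (j : Fin r) :
    evStrip c (Function.update θ j (θ j + 2 * (Real.pi : ℂ))) = evStrip c θ := by
  refine tsum_congr fun k => ?_
  have h1 : phase k (Function.update θ j (θ j + 2 * (Real.pi : ℂ))) =
      phase k θ + (k j : ℂ) * (2 * Real.pi * I) := by
    have : Function.update θ j (θ j + 2 * (Real.pi : ℂ)) =
        θ + Pi.single j (2 * (Real.pi : ℂ)) := by
      funext i
      by_cases hi : i = j
      · subst hi; simp
      · simp [hi]
    rw [this, map_add, phase_apply k (Pi.single _ _)]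
    congr 1
    rw [Finset.sum_eq_single j]
    · simp; ring
    · intro i _ hi; simp [hi]
    · simp
  rw [h1, Complex.exp_add, Complex.exp_int_mul_two_pi_mul_I, mul_one]

lemma evStrip_line (ω : Fin r → ℝ) (c : (Fin r → ℤ) → ℂ) (t : ℝ) :
    evStrip c (fun j => ((ω j * t : ℝ) : ℂ)) = ev ω c t := by
  refine tsum_congr fun k => ?_
  rw [chr, phase_apply, mul_comm I, freq, Finset.sum_mul]
  push_cast
  simp only [mul_assoc, Finset.sum_mul]

lemma isAnalyticQP_of_ev {ρ ρ' M : ℝ} {ω : Fin r → ℝ} {c : (Fin r → ℤ) → ℂ} (h : Bd ρ c M)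
    (hρ : ρ' < ρ) {f : ℝ → ℝ} (hf : ∀ t, (f t : ℂ) = ev ω c t) : IsAnalyticQP ω ρ' f :=
  ⟨evStrip c, analyticOnNhd_evStrip h hρ, fun θ _ j => evStrip_periodic c θ j,
    fun t => by rw [hf, evStrip_line]⟩

/-- Real parts of quasi-periodic functions. -/
lemma isAnalyticQP_re {ρ ρ' M : ℝ} {ω : Fin r → ℝ} {c : (Fin r → ℤ) → ℂ} (h : Bd ρ c M)
    (hρ : ρ' < ρ) (hρ0 : 0 ≤ ρ) : IsAnalyticQP ω ρ' fun t => (ev ω c t).re := by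
  -- The real part of a holomorphic extension is not holomorphic; instead, d gives the conjugate
  -- function on the real line, and (c + d)/2 extends the real part.
  let d : (Fin r → ℤ) → ℂ := fun k => conj (c (-k))
  have hs : HasSum (fun k => ‖d k‖ * Real.exp (ρ * len k))
      (∑' k, ‖c k‖ * Real.exp (ρ * len k)) := by
    have := (Equiv.neg (Fin r → ℤ)).hasSum_iff.2 h.1.hasSum
    refine this.congr_fun fun k => ?_
    simp [d, len_neg]
  have hd : Bd ρ d M := ⟨hs.summable, hs.tsum_eq.trans_le h.2⟩
  have evd : ∀ t, ev ω d t = conj (ev ω c t) := fun t => by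
    rw [ev, ev, Complex.conj_tsum, ← (Equiv.neg (Fin r → ℤ)).tsum_eq]
    refine tsum_congr fun k => ?_
    simp only [d, Equiv.neg_apply, neg_neg, map_mul]
    congr 1
    rw [chr, chr, ← Complex.exp_conj, freq_neg]
    simp
  refine isAnalyticQP_of_ev ((h.add hd).smul (1 / 2)) hρ fun t => ?_
  rw [ev_smul, ev_add h hρ0 hd hρ0, evd, Complex.re_eq_add_conj]
  ring

end QPHill

/-! ### Holomorphic parameter integrals, lattice sums and functions on the torus. -/

namespace QPHill

open Complex (I)

/-- Holomorphy of an integral depending holomorphically and boundedly on a parameter. -/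
lemma differentiableOn_integral_param {X : Type*} [MeasurableSpace X] {μ : Measure X}
    [IsFiniteMeasure μ] {U : Set ℂ} (hU : IsOpen U) {g : ℂ → X → ℂ} {M : ℝ}
    (hm : ∀ ζ ∈ U, AEStronglyMeasurable (g ζ) μ) (hd : ∀ x, DifferentiableOn ℂ (fun ζ => g ζ x) U)
    (hM : ∀ ζ ∈ U, ∀ x, ‖g ζ x‖ ≤ M) :
    DifferentiableOn ℂ (fun ζ => ∫ x, g ζ x ∂μ) U := by
  intro z hz
  obtain ⟨R, hR, hball⟩ := Metric.isOpen_iff.1 hU z hz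
  have hda : ∀ x, ∀ ζ ∈ U, HasDerivAt (fun ζ => g ζ x) (deriv (fun ζ => g ζ x) ζ) ζ :=
    fun x ζ hζ => ((hd x).differentiableAt (hU.mem_nhds hζ)).hasDerivAt
  -- The derivative at z is measurable in x as a limit of difference quotients along a sequence w n
  -- → z.
  have hmeas : AEStronglyMeasurable (fun x => deriv (fun ζ => g ζ x) z) μ := by
    let w : ℕ → ℂ := fun n => z + ((R / (n + 2) : ℝ) : ℂ)
    have hpos : ∀ n : ℕ, 0 < R / (n + 2) := fun n => by positivity
    have hw : ∀ n, w n ∈ U := fun n => hball (by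
      simp only [w, Metric.mem_ball, dist_self_add_left, Complex.norm_real, Real.norm_eq_abs]
      rw [abs_of_pos (hpos n), div_lt_iff₀ (by positivity)]
      have : (0 : ℝ) ≤ n := Nat.cast_nonneg n
      nlinarith)
    have hlim : Tendsto w atTop (𝓝[≠] z) := by
      refine tendsto_nhdsWithin_iff.2 ⟨?_, Eventually.of_forall fun n => ?_⟩
      · have h1 : Tendsto (fun n : ℕ => R / ((n : ℝ) + 2)) atTop (𝓝 0) :=
          tendsto_const_nhds.div_atTop
            (tendsto_atTop_add_const_right _ _ tendsto_natCast_atTop_atTop)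
        have h2 := ((Complex.continuous_ofReal.tendsto 0).comp h1).const_add z
        rw [Complex.ofReal_zero, add_zero] at h2
        exact h2
      · have : ((R / (n + 2) : ℝ) : ℂ) ≠ 0 := by exact_mod_cast (hpos n).ne'
        simpa only [w, mem_compl_iff, mem_singleton_iff, add_eq_left] using this
    refine aestronglyMeasurable_of_tendsto_ae (u := atTop)
      (f := fun n x => slope (fun ζ => g ζ x) z (w n)) (fun n => ?_)
      (Eventually.of_forall fun x => ((hda x z hz).tendsto_slope).comp hlim)
    simp only [slope_def_field]
    have := ((hm (w n) (hw n)).sub (hm z hz)).mul_const ((w n - z)⁻¹)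
    simpa [div_eq_mul_inv] using this
  -- Cauchy's estimate on circles of radius R/4, which stay in U for centres within R/2 of z,
  -- supplies a constant dominating function.
  have hM0 : ∀ x, ∀ ζ ∈ Metric.ball z (R / 2), ‖deriv (fun ζ => g ζ x) ζ‖ ≤ M / (R / 4) :=
    fun x ζ hζ => by
    have hsub : Metric.closedBall ζ (R / 4) ⊆ U := fun w hw => hball (by
      rw [Metric.mem_ball] at hζ ⊢
      rw [Metric.mem_closedBall] at hw
      have := dist_triangle w ζ z
      linarith)
    refine Complex.norm_deriv_le_of_forall_mem_sphere_norm_le (by positivity) ?_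
      fun w hw => hM w (hsub (Metric.sphere_subset_closedBall hw)) x
    refine DifferentiableOn.diffContOnCl ?_
    exact (hd x).mono (Metric.closure_ball_subset_closedBall.trans hsub)
  refine (hasDerivAt_integral_of_dominated_loc_of_deriv_le (bound := fun _ => M / (R / 4))
    (F' := fun ζ x => deriv (fun ζ => g ζ x) ζ)
    (Metric.ball_mem_nhds z (by positivity : 0 < R / 2)) ?_ ?_ hmeas ?_
    (integrable_const _) ?_).2.differentiableAt.differentiableWithinAt
  · filter_upwards [hU.mem_nhds hz] with ζ hζ using hm ζ hζ
  · exact Integrable.of_bound (hm z hz) M (Eventually.of_forall fun x => hM z hz x)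
  · exact Eventually.of_forall hM0
  · refine Eventually.of_forall fun x ζ hζ => hda x ζ (hball ?_)
    exact Metric.ball_subset_ball (by linarith) hζ

variable {r : ℕ}

/-- Products of summable families over `ℤ` are summable over `ℤʳ`. -/
lemma summable_prod_int {f : ℤ → ℝ} (hf : Summable f) (h0 : ∀ n, 0 ≤ f n) :
    Summable fun k : Fin r → ℤ => ∏ j, f (k j) := by
  classical
  refine summable_of_sum_le (c := (∑' n, f n) ^ r)
    (fun k => Finset.prod_nonneg fun j _ => h0 _) fun s => ?_
  let T : Finset ℤ := s.biUnion fun k => Finset.univ.image k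
  have hs : s ⊆ Fintype.piFinset fun _ : Fin r => T := fun k hk => by
    rw [Fintype.mem_piFinset]
    intro j
    exact Finset.mem_biUnion.2 ⟨k, hk, Finset.mem_image_of_mem _ (Finset.mem_univ j)⟩
  calc ∑ k ∈ s, ∏ j, f (k j) ≤ ∑ k ∈ Fintype.piFinset fun _ : Fin r => T, ∏ j, f (k j) :=
        Finset.sum_le_sum_of_subset_of_nonneg hs fun k _ _ => Finset.prod_nonneg fun j _ => h0 _
    _ = ∏ _j : Fin r, ∑ n ∈ T, f n := (Finset.prod_univ_sum (fun _ => T) (fun _ n => f n)).symm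
    _ = (∑ n ∈ T, f n) ^ r := by simp
    _ ≤ _ := pow_le_pow_left₀ (Finset.sum_nonneg fun n _ => h0 n) (hf.sum_le_tsum T fun n _ => h0 n) r

lemma summable_exp_len {δ : ℝ} (hδ : 0 < δ) :
    Summable fun k : Fin r → ℤ => Real.exp (-(δ * len k)) := by
  have h1 : Summable fun n : ℕ => Real.exp (-(δ * n)) := by
    have := summable_geometric_of_lt_one (Real.exp_pos (-δ)).le (by
      rw [Real.exp_lt_one_iff]; linarith)
    refine this.congr fun n => ?_
    rw [← Real.exp_nat_mul]; ring_nf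
  have h2 : Summable fun n : ℤ => Real.exp (-(δ * |(n : ℝ)|)) := by
    refine Summable.of_nat_of_neg ?_ ?_
    · simpa using h1
    · simpa using h1
  refine (summable_prod_int h2 fun n => (Real.exp_pos _).le).congr fun k => ?_
  rw [← Real.exp_sum, len, Finset.mul_sum, Finset.sum_neg_distrib]

/-- Functions on the torus from functions on `ℝʳ`, evaluated on representatives. -/
noncomputable def torusLift (H : (Fin r → ℝ) → ℂ) (x : UnitAddTorus (Fin r)) : ℂ :=
  H fun j => Function.surjInv (QuotientAddGroup.mk_surjective (s := AddSubgroup.zmultiples (1 : ℝ)))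
    (x j)

/-- Two representatives differ by an integer vector, so periodicity makes the chosen one irrelevant.
-/
lemma torusLift_coe {H : (Fin r → ℝ) → ℂ} (hH : ∀ y (k : Fin r → ℤ), H (y + fun j => (k j : ℝ)) = H y)
    (y : Fin r → ℝ) : torusLift H (fun j => (y j : UnitAddCircle)) = H y := by
  unfold torusLift
  set s : Fin r → ℝ := fun j =>
    Function.surjInv (QuotientAddGroup.mk_surjective (s := AddSubgroup.zmultiples (1 : ℝ)))
      (y j : UnitAddCircle) with hs
  have h1 : ∀ j, ∃ n : ℤ, s j = y j + n := fun j => by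
    have h2 : ((s j : ℝ) : UnitAddCircle) = (y j : UnitAddCircle) :=
      Function.surjInv_eq (QuotientAddGroup.mk_surjective (s := AddSubgroup.zmultiples (1 : ℝ))) _
    have h3 : ((s j - y j : ℝ) : UnitAddCircle) = 0 := by rw [AddCircle.coe_sub, h2, sub_self]
    obtain ⟨n, hn⟩ := (AddCircle.coe_eq_zero_iff (1 : ℝ)).1 h3
    refine ⟨n, ?_⟩
    rw [zsmul_eq_mul, mul_one] at hn
    linarith
  choose n hn using h1
  have : s = y + fun j => (n j : ℝ) := funext hn
  rw [this, hH]

lemma exists_coe (x : UnitAddTorus (Fin r)) :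
    ∃ y : Fin r → ℝ, (fun j => (y j : UnitAddCircle)) = x :=
  ⟨fun j => Function.surjInv
    (QuotientAddGroup.mk_surjective (s := AddSubgroup.zmultiples (1 : ℝ))) (x j),
    funext fun _ => Function.surjInv_eq _ _⟩

/-- Open quotient maps are stable under products, so continuity can be tested after pulling back to
ℝʳ. -/
lemma continuous_torusLift {H : (Fin r → ℝ) → ℂ}
    (hH : ∀ y (k : Fin r → ℤ), H (y + fun j => (k j : ℝ)) = H y) (hc : Continuous H) :
    Continuous (torusLift H) := by
  have hq : IsOpenQuotientMap (Pi.map fun _ : Fin r => ((↑) : ℝ → UnitAddCircle)) :=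
    IsOpenQuotientMap.piMap fun _ => QuotientAddGroup.isOpenQuotientMap_mk
  rw [← hq.continuous_comp_iff]
  convert hc using 1
  funext y
  exact torusLift_coe hH y

/-- Real shifts preserve the strip, so the one-coordinate periodicity can be iterated: over
naturals, then integers, then over a growing set of coordinates. -/
lemma periodic_int {ρ : ℝ} {F : (Fin r → ℂ) → ℂ}
    (hF : ∀ θ ∈ strip r ρ, ∀ j, F (Function.update θ j (θ j + 2 * (Real.pi : ℂ))) = F θ)
    {θ : Fin r → ℂ} (hθ : θ ∈ strip r ρ) (k : Fin r → ℤ) :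
    F (fun j => θ j + 2 * Real.pi * k j) = F θ := by
  classical
  have h1 : ∀ (n : ℕ) (j : Fin r), ∀ θ ∈ strip r ρ,
      F (Function.update θ j (θ j + 2 * Real.pi * n)) = F θ := by
    intro n j
    induction n with
    | zero => intro θ _; simp
    | succ n ih =>
      intro θ hθ
      have h2 : Function.update θ j (θ j + 2 * Real.pi * n) ∈ strip r ρ := fun i => by
        by_cases hi : i = j
        · subst hi; simpa using hθ i
        · simpa [hi] using hθ i
      have h3 := hF _ h2 j
      rw [ih θ hθ] at h3
      rw [← h3]
      congr 1
      simp only [Function.update_self, Function.update_idem]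
      congr 1
      push_cast; ring
  have h2 : ∀ (n : ℤ) (j : Fin r), ∀ θ ∈ strip r ρ,
      F (Function.update θ j (θ j + 2 * Real.pi * n)) = F θ := by
    intro n j θ hθ
    obtain ⟨m, rfl | rfl⟩ := n.eq_nat_or_neg
    · exact_mod_cast h1 m j θ hθ
    · have h3 : Function.update θ j (θ j + 2 * Real.pi * ((-(m : ℤ) : ℤ) : ℂ)) ∈ strip r ρ :=
        fun i => by
        by_cases hi : i = j
        · subst hi; simpa using hθ i
        · simpa [hi] using hθ i
      have h4 := h1 m j _ h3
      rw [← h4]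
      congr 1
      simp
  have h3 : ∀ s : Finset (Fin r), F (fun j => if j ∈ s then θ j + 2 * Real.pi * k j else θ j) =
      F θ := by
    intro s
    induction s using Finset.induction_on with
    | empty => simp
    | insert i s hi ih =>
      have h4 : (fun j => if j ∈ s then θ j + 2 * Real.pi * k j else θ j) ∈ strip r ρ := fun j => by
        simp only
        split_ifs
        · simpa using hθ j
        · exact hθ j
      rw [← ih, ← h2 (k i) i _ h4]
      congr 1
      funext j
      by_cases hj : j = i
      · subst hj; simp [hi]
      · simp [hj]
  simpa using h3 Finset.univ

/-- By periodicity it suffices to bound F on a compact fundamental box. -/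
lemma exists_bound_strip {ρ : ℝ} {F : (Fin r → ℂ) → ℂ} (hc : ContinuousOn F (strip r ρ))
    (hF : ∀ θ ∈ strip r ρ, ∀ j, F (Function.update θ j (θ j + 2 * (Real.pi : ℂ))) = F θ) :
    ∃ M, ∀ θ ∈ strip r ρ, ‖F θ‖ ≤ M := by
  let K : Set (Fin r → ℂ) := Set.pi univ fun _ => Icc 0 (2 * Real.pi) ×ℂ Icc (-ρ) ρ
  have hK : IsCompact K := isCompact_univ_pi fun _ => (isCompact_Icc).reProdIm isCompact_Icc
  have hsub : K ⊆ strip r ρ := fun θ hθ j => abs_le.2 ((hθ j (mem_univ j)).2)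
  obtain ⟨M, hM⟩ := hK.exists_bound_of_continuousOn (hc.mono hsub)
  refine ⟨M, fun θ hθ => ?_⟩
  let k : Fin r → ℤ := fun j => -⌊(θ j).re / (2 * Real.pi)⌋
  rw [← periodic_int hF hθ k]
  refine hM _ fun j _ => ⟨?_, ?_⟩
  · have hp : 0 < 2 * Real.pi := by positivity
    have h1 := Int.floor_le ((θ j).re / (2 * Real.pi))
    have h2 := Int.lt_floor_add_one ((θ j).re / (2 * Real.pi))
    rw [le_div_iff₀ hp] at h1
    rw [div_lt_iff₀ hp] at h2
    simp only [k, mem_preimage, Complex.add_re, Complex.mul_re, Int.cast_neg]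
    simp
    constructor <;> linarith
  · have := abs_le.1 (hθ j)
    simpa [k] using this

end QPHill

/-! ### Exponential decay of Fourier coefficients. -/

namespace QPHill

open Complex (I)

variable {r : ℕ}

lemma mFourier_coe (k : Fin r → ℤ) (y : Fin r → ℝ) :
    UnitAddTorus.mFourier k (fun j => (y j : UnitAddCircle)) =
      Complex.exp (phase k fun j => 2 * Real.pi * y j) := by
  simp only [UnitAddTorus.mFourier, ContinuousMap.coe_mk, fourier_coe_apply]
  rw [← Complex.exp_sum, phase_apply, Finset.mul_sum]
  congr 1
  refine Finset.sum_congr rfl fun j _ => ?_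
  push_cast
  ring

/-- Exponential decay of Fourier coefficients of a function analytic on a strip, by shifting the
torus of integration into the complex domain. -/
lemma exists_coeff_bound {ρ ρ₁ : ℝ} (hρ₁ : 0 < ρ₁) (hρ : ρ₁ < ρ) {F : (Fin r → ℂ) → ℂ}
    (hF : AnalyticOnNhd ℂ F (strip r ρ))
    (hper : ∀ θ ∈ strip r ρ, ∀ j, F (Function.update θ j (θ j + 2 * (Real.pi : ℂ))) = F θ) :
    ∃ M, ∀ k : Fin r → ℤ, ‖UnitAddTorus.mFourierCoeff
      (torusLift fun y : Fin r → ℝ => F fun j => 2 * Real.pi * y j) k‖ ≤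
        M * Real.exp (-(ρ₁ * len k)) := by
  have hρ0 : 0 < ρ := hρ₁.trans hρ
  obtain ⟨M, hM⟩ := exists_bound_strip hF.continuousOn hper
  refine ⟨M, fun k => ?_⟩
  -- The shift direction opposes the signs of k: moving by isσ multiplies the modulus of the
  -- character by e^{-s|k|}. A single complex variable ζ moves all coordinates at once.
  let σ : Fin r → ℝ := fun j => -(SignType.sign (k j) : ℝ)
  have hσ1 : ∀ j, |σ j| ≤ 1 := fun j => by
    simp only [σ, abs_neg]
    rcases lt_trichotomy (k j) 0 with h | h | h <;> simp [h]
  have hσk : ∀ j, (k j : ℝ) * σ j = -|(k j : ℝ)| := fun j => by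
    simp only [σ]
    rcases lt_trichotomy (k j) 0 with h | h | h
    · have : (k j : ℝ) < 0 := by exact_mod_cast h
      simp [h, abs_of_neg this]
    · simp [h]
    · have : 0 < (k j : ℝ) := by exact_mod_cast h
      simp [h, abs_of_pos this]
  let P : ℂ → (Fin r → ℝ) → (Fin r → ℂ) := fun ζ y j => 2 * Real.pi * y j + ζ * σ j
  have hPim : ∀ ζ y j, (P ζ y j).im = ζ.im * σ j := fun ζ y j => by
    simp [P]
  let U : Set ℂ := {ζ | |ζ.im| < ρ}
  have hPs : ∀ ζ ∈ U, ∀ y, P ζ y ∈ strip r ρ := fun ζ hζ y j => by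
    rw [hPim, abs_mul]
    have h1 : |ζ.im| < ρ := hζ
    have h2 := hσ1 j
    have h3 := abs_nonneg ζ.im
    nlinarith
  let G : ℂ → (Fin r → ℝ) → ℂ := fun ζ y => Complex.exp (-phase k (P ζ y)) * F (P ζ y)
  have hGp : ∀ ζ ∈ U, ∀ y (n : Fin r → ℤ), G ζ (y + fun j => (n j : ℝ)) = G ζ y :=
    fun ζ hζ y n => by
    have h1 : P ζ (y + fun j => (n j : ℝ)) = fun j => P ζ y j + 2 * Real.pi * n j := by
      funext j; simp only [P, Pi.add_apply]; push_cast; ring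
    have h2 : phase k (P ζ (y + fun j => (n j : ℝ))) =
        phase k (P ζ y) + ((∑ j, k j * n j : ℤ) : ℂ) * (2 * Real.pi * I) := by
      rw [h1, phase_apply, phase_apply]
      push_cast
      rw [Finset.sum_mul, Finset.mul_sum, Finset.mul_sum, ← Finset.sum_add_distrib]
      refine Finset.sum_congr rfl fun j _ => ?_
      ring
    simp only [G]
    rw [h2, h1, periodic_int hper (hPs ζ hζ y), neg_add, Complex.exp_add, Complex.exp_neg (_ * _),
      Complex.exp_int_mul_two_pi_mul_I, inv_one, mul_one]
  have hPc : ∀ ζ, Continuous (P ζ) := fun ζ => by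
    refine continuous_pi fun j => ?_
    simp only [P]
    fun_prop
  have hGc : ∀ ζ ∈ U, Continuous (G ζ) := fun ζ hζ => by
    refine Continuous.mul (Complex.continuous_exp.comp ((phase k).continuous.comp (hPc ζ)).neg) ?_
    exact hF.continuousOn.comp_continuous (hPc ζ) (hPs ζ hζ)
  have hGn : ∀ ζ ∈ U, ∀ y, ‖G ζ y‖ ≤ M * Real.exp (-(ζ.im * len k)) := fun ζ hζ y => by
    simp only [G]
    rw [norm_mul, mul_comm, Complex.norm_exp]
    have h1 : (-phase k (P ζ y)).re = -(ζ.im * len k) := by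
      rw [phase_apply, Complex.neg_re, Complex.I_mul_re, Complex.im_sum, len, Finset.mul_sum,
        neg_neg, ← Finset.sum_neg_distrib]
      refine Finset.sum_congr rfl fun j _ => ?_
      rw [Complex.mul_im, hPim]
      simp only [Complex.intCast_re, Complex.intCast_im, zero_mul, add_zero]
      linear_combination ζ.im * hσk j
    rw [h1]
    gcongr
    exact hM _ (hPs ζ hζ y)
  have hM0 : 0 ≤ M := (norm_nonneg _).trans (hM 0 fun j => by simpa using hρ0.le)
  have hUo : IsOpen U := isOpen_lt (Complex.continuous_im.abs) continuous_const
  have hUc : IsPreconnected U := by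
    have : Convex ℝ U := by
      have h1 : U = Complex.imCLM ⁻¹' (Metric.ball 0 ρ) := by ext ζ; simp [U]
      rw [h1]
      exact (convex_ball 0 ρ).is_linear_preimage Complex.imCLM.isLinear
    exact this.isPreconnected
  let N : ℂ → ℂ := fun ζ => ∫ x : UnitAddTorus (Fin r), torusLift (G ζ) x
  have hNd : DifferentiableOn ℂ N U := by
    refine differentiableOn_integral_param hUo (M := M * Real.exp (ρ * len k))
      (fun ζ hζ => (continuous_torusLift (hGp ζ hζ) (hGc ζ hζ)).aestronglyMeasurable) (fun x => ?_)
      fun ζ hζ x => ?_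
    · simp only [torusLift]
      intro ζ hζ
      generalize (fun j => Function.surjInv
        (QuotientAddGroup.mk_surjective (s := AddSubgroup.zmultiples (1 : ℝ))) (x j)) = y
      have hPd : DifferentiableAt ℂ (fun ζ => P ζ y) ζ := by
        rw [differentiableAt_pi]
        intro j
        simp only [P]
        fun_prop
      have h1 : DifferentiableAt ℂ (fun ζ => F (P ζ y)) ζ :=
        ((hF _ (hPs ζ hζ y)).differentiableAt).comp ζ hPd
      have h2 : DifferentiableAt ℂ (fun ζ => phase k (P ζ y)) ζ :=
        ((phase k).differentiableAt).comp ζ hPd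
      exact ((h2.neg.cexp).mul h1).differentiableWithinAt
    · refine (hGn ζ hζ _).trans ?_
      have h1 : -ζ.im ≤ ρ := by
        have h2 : |ζ.im| < ρ := hζ
        linarith [neg_abs_le ζ.im]
      have := mul_le_mul_of_nonneg_right h1 (len_nonneg k)
      gcongr
      linarith
  have h0U : (0 : ℂ) ∈ U := by simpa [U] using hρ0
  -- A real shift is a translation of the torus, under which the integral is invariant.
  have hreal : ∀ s : ℝ, N s = N 0 := fun s => by
    have hsU : (s : ℂ) ∈ U := by simpa [U] using hρ0
    have h1 : ∀ x, torusLift (G s) x =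
        torusLift (G 0) (x + fun j => ((s * σ j / (2 * Real.pi) : ℝ) : UnitAddCircle)) := fun x => by
      obtain ⟨y, rfl⟩ := exists_coe x
      have h2 : ((fun j => (y j : UnitAddCircle)) +
          fun j => ((s * σ j / (2 * Real.pi) : ℝ) : UnitAddCircle)) =
          fun j => (((y + fun j => s * σ j / (2 * Real.pi)) j : ℝ) : UnitAddCircle) := by
        funext j; simp
      rw [h2, torusLift_coe (hGp _ hsU), torusLift_coe (hGp _ h0U)]
      have h3 : P 0 (y + fun j => s * σ j / (2 * Real.pi)) = P s y := by
        funext j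
        simp only [P, Pi.add_apply]
        push_cast
        have : (Real.pi : ℂ) ≠ 0 := by exact_mod_cast Real.pi_ne_zero
        field_simp
        ring
      simp only [G, h3]
    simp only [N, h1]
    exact integral_add_right_eq_self (μ := (volume : Measure (UnitAddTorus (Fin r))))
      (fun x => torusLift (G 0) x) _
  -- The identity theorem in ζ replaces contour shifting in r variables: constancy on the reals
  -- spreads to the strip, in particular to ζ = iρ₁.
  have hconst : EqOn N (fun _ => N 0) U := by
    refine (hNd.analyticOnNhd hUo).eqOn_of_preconnected_of_frequently_eq
      (analyticOnNhd_const) hUc h0U ?_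
    have h1 : Tendsto (fun n : ℕ => ((1 / ((n : ℝ) + 1) : ℝ) : ℂ)) atTop (𝓝[≠] 0) := by
      refine tendsto_nhdsWithin_iff.2 ⟨?_, Eventually.of_forall fun n => ?_⟩
      · have h2 := (Complex.continuous_ofReal.tendsto 0).comp
          (tendsto_one_div_add_atTop_nhds_zero_nat (𝕜 := ℝ))
        rw [Complex.ofReal_zero] at h2
        exact h2
      · have h2 : (1 / ((n : ℝ) + 1)) ≠ 0 := by positivity
        exact Complex.ofReal_ne_zero.2 h2
    exact h1.frequently (Frequently.of_forall fun n => hreal _)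
  have hvol : (volume : Measure (UnitAddTorus (Fin r))) =
      Measure.pi fun _ => AddCircle.haarAddCircle := by
    have h1 : (volume : Measure UnitAddCircle) = AddCircle.haarAddCircle := by
      rw [AddCircle.volume_eq_smul_haarAddCircle]; simp
    change Measure.pi (fun _ : Fin r => (volume : Measure UnitAddCircle)) = _
    rw [h1]
  have hcoef : UnitAddTorus.mFourierCoeff
      (torusLift fun y : Fin r → ℝ => F fun j => 2 * Real.pi * y j) k = N 0 := by
    unfold UnitAddTorus.mFourierCoeff
    simp only [N]
    rw [hvol]
    congr 1
    funext x
    obtain ⟨y, rfl⟩ := exists_coe x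
    have h1 : ∀ y (n : Fin r → ℤ), (fun y : Fin r → ℝ => F fun j => 2 * Real.pi * y j)
        (y + fun j => (n j : ℝ)) = (fun y : Fin r → ℝ => F fun j => 2 * Real.pi * y j) y :=
      fun y n => by
      have h2 : (fun j => 2 * (Real.pi : ℂ) * y j) ∈ strip r ρ := fun j => by
        simpa using hρ0.le
      have h3 := periodic_int hper h2 n
      simp only [Pi.add_apply]
      rw [← h3]
      congr 1
      funext j
      push_cast; ring
    rw [torusLift_coe h1, torusLift_coe (hGp _ h0U), mFourier_coe, smul_eq_mul]
    have h4 : P 0 y = fun j => 2 * (Real.pi : ℂ) * y j := by funext j; simp [P]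
    simp only [G, h4]
    congr 2
    simp [phase_apply]
  have hiU : (ρ₁ * I : ℂ) ∈ U := by
    change |(ρ₁ * I : ℂ).im| < ρ
    simpa [abs_of_pos hρ₁] using hρ
  rw [hcoef, ← show N (ρ₁ * I) = N 0 from hconst hiU]
  have h5 := norm_integral_le_of_norm_le_const (μ := (volume : Measure (UnitAddTorus (Fin r))))
    (Eventually.of_forall fun x => hGn _ hiU fun j => Function.surjInv
        (QuotientAddGroup.mk_surjective (s := AddSubgroup.zmultiples (1 : ℝ))) (x j))
  have h6 : (volume : Measure (UnitAddTorus (Fin r))).real univ = 1 := by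
    rw [hvol]; exact probReal_univ
  rw [h6, mul_one] at h5
  simpa [N, torusLift] using h5

/-- Analytic quasi-periodic functions have exponentially decaying Fourier coefficients. -/
lemma exists_coeff {ω : Fin r → ℝ} {ρ : ℝ} (hρ : 0 < ρ) {a : ℝ → ℝ} (ha : IsAnalyticQP ω ρ a) :
    ∃ (c : (Fin r → ℤ) → ℂ) (M : ℝ), Bd (ρ / 4) c M ∧ ∀ t, (a t : ℂ) = ev ω c t := by
  obtain ⟨F, hF, hper, hFa⟩ := ha
  -- Decay at rate ρ/2 leaves e^{-ρ|k|/4} for summation over k at width ρ/4.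
  obtain ⟨M, hM⟩ := exists_coeff_bound (ρ₁ := ρ / 2) (by positivity) (by linarith) hF hper
  let H : (Fin r → ℝ) → ℂ := fun y => F fun j => 2 * Real.pi * y j
  have hs : ∀ y : Fin r → ℝ, (fun j => 2 * (Real.pi : ℂ) * y j) ∈ strip r ρ := fun y j => by
    simpa using hρ.le
  have hH : ∀ y (n : Fin r → ℤ), H (y + fun j => (n j : ℝ)) = H y := fun y n => by
    have h3 := periodic_int hper (hs y) n
    simp only [H, Pi.add_apply]
    rw [← h3]
    congr 1
    funext j
    push_cast; ring
  have hHc : Continuous H :=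
    hF.continuousOn.comp_continuous (continuous_pi fun j => by fun_prop) hs
  let f : C(UnitAddTorus (Fin r), ℂ) := ⟨torusLift H, continuous_torusLift hH hHc⟩
  have hb : Bd (ρ / 4) (UnitAddTorus.mFourierCoeff f)
      (∑' k, ‖UnitAddTorus.mFourierCoeff f k‖ * Real.exp (ρ / 4 * len k)) := by
    have h1 : Summable fun k : Fin r → ℤ =>
        ‖UnitAddTorus.mFourierCoeff f k‖ * Real.exp (ρ / 4 * len k) := by
      refine Summable.of_nonneg_of_le (fun k => by positivity) (fun k => ?_)
        ((summable_exp_len (by positivity : 0 < ρ / 4)).mul_left M)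
      refine (mul_le_mul_of_nonneg_right (hM k) (Real.exp_pos _).le).trans (le_of_eq ?_)
      rw [mul_assoc, ← Real.exp_add]
      ring_nf
    exact ⟨h1, le_rfl⟩
  refine ⟨_, _, hb, fun t => ?_⟩
  have h2 := UnitAddTorus.hasSum_mFourier_series_apply_of_summable (f := f)
    (Summable.of_norm (hb.summable_norm (by positivity)))
    (fun j => ((ω j * t / (2 * Real.pi) : ℝ) : UnitAddCircle))
  have hpi : (Real.pi : ℂ) ≠ 0 := by exact_mod_cast Real.pi_ne_zero
  have h3 : (fun j => 2 * (Real.pi : ℂ) * ((ω j * t / (2 * Real.pi) : ℝ) : ℂ)) =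
      fun j => ((ω j * t : ℝ) : ℂ) := by
    funext j; push_cast; field_simp
  have h4 : f (fun j => ((ω j * t / (2 * Real.pi) : ℝ) : UnitAddCircle)) = a t := by
    rw [hFa, ← h3]
    exact torusLift_coe hH _
  rw [h4] at h2
  rw [← h2.tsum_eq, ← evStrip_line]
  refine tsum_congr fun k => ?_
  rw [mFourier_coe, smul_eq_mul, h3]

end QPHill

/-! ### Cantor subsets, averages and resonant exponents. -/

namespace QPHill

open Complex (I)
open scoped ENNReal NNReal

variable {r : ℕ}

/-- Compact sets contain Cantor sets of almost full measure. -/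
lemma exists_cantor_subset {K : Set ℝ} (hK : IsCompact K) {δ : ℝ} (hδ : 0 < δ)
    (hv : δ < volume.real K) :
    ∃ E ⊆ K, IsCantorSet E ∧ volume.real K - δ ≤ volume.real E := by
  have hcount : (range ((↑) : ℚ → ℝ)).Countable := countable_range _
  -- Removing the rationals costs no measure and leaves no interval, whence total disconnectedness.
  -- Inner regularity then restores compactness.
  have hmeas : MeasurableSet (K \ range ((↑) : ℚ → ℝ)) :=
    hK.measurableSet.diff hcount.measurableSet
  have hvol : volume (K \ range ((↑) : ℚ → ℝ)) = volume K :=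
    measure_sdiff_null (hcount.measure_zero _)
  have hfin : volume K ≠ ∞ := hK.measure_lt_top.ne
  obtain ⟨K₁, hK₁, hK₁c, hlt⟩ := hmeas.exists_isCompact_lt_add (μ := volume)
    (by rw [hvol]; exact hfin) (ε := ENNReal.ofReal δ) (by simpa using hδ)
  -- Cantor–Bendixson: the perfect kernel differs from K₁ by a countable, hence null, set.
  obtain ⟨V, D, hV, hD, hVD⟩ := exists_countable_union_perfect_of_isClosed hK₁c.isClosed
  have hDK : D ⊆ K₁ := hVD ▸ subset_union_right
  have hDc : IsCompact D := hK₁c.of_isClosed_subset hD.closed hDK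
  have hD1 : volume K₁ ≤ volume D := by
    rw [hVD]
    refine (measure_union_le _ _).trans ?_
    rw [hV.measure_zero, zero_add]
  have hbound : volume.real K - δ ≤ volume.real D := by
    have h1 : volume K ≤ volume D + ENNReal.ofReal δ := by
      rw [← hvol]
      exact hlt.le.trans (add_le_add_left hD1 _)
    have h2 := ENNReal.toReal_mono
      (ENNReal.add_ne_top.2 ⟨hDc.measure_lt_top.ne, ENNReal.ofReal_ne_top⟩) h1
    rw [ENNReal.toReal_add hDc.measure_lt_top.ne ENNReal.ofReal_ne_top,
      ENNReal.toReal_ofReal hδ.le] at h2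
    have h3 : volume.real K = (volume K).toReal := rfl
    have h4 : volume.real D = (volume D).toReal := rfl
    linarith
  refine ⟨D, hDK.trans (hK₁.trans sdiff_subset), ⟨?_, hDc, hD, ?_⟩, hbound⟩
  · rw [nonempty_iff_ne_empty]
    rintro rfl
    simp at hbound
    linarith
  · intro t ht hpre x hx y hy
    by_contra hne
    wlog hlt : x < y generalizing x y
    · exact this hy hx (Ne.symm hne) (lt_of_le_of_ne (not_lt.1 hlt) (Ne.symm hne))
    obtain ⟨q, hq1, hq2⟩ := exists_rat_btwn hlt
    have h1 : (q : ℝ) ∈ t := hpre.ordConnected.out hx hy ⟨hq1.le, hq2.le⟩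
    exact (hK₁ (hDK (ht h1))).2 ⟨q, rfl⟩

/-- Lebesgue measure on ℝ is one-dimensional Hausdorff measure, for which the Lipschitz bound holds
without measurability of S. -/
lemma volume_image_le {f : ℝ → ℝ} {S : Set ℝ} {L : ℝ≥0} (hf : LipschitzOnWith L f S) :
    volume (f '' S) ≤ L * volume S := by
  have := hf.hausdorffMeasure_image_le (d := 1) zero_le_one
  simpa [hausdorffMeasure_real] using this

/-- The mean of a quasi-periodic function is its zeroth coefficient. -/
lemma coeff_zero_eq_average {ω : Fin r → ℝ} {γ ρ M A : ℝ} {m : ℕ} {c : (Fin r → ℤ) → ℂ}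
    {a : ℝ → ℝ} (hγ : 0 < γ) (hn : SmallDiv γ m (freq ω)) (hρ : 0 < ρ) (hc : Bd ρ c M)
    (ha : ∀ t, (a t : ℂ) = ev ω c t) (hcont : Continuous a) (hA : HasAverage a A) :
    c 0 = A := by
  -- Away from the zeroth mode the series has a bounded quasi-periodic primitive y, so the averages
  -- over [-T, T] converge to c 0 with error at most N/T.
  have hy := hc.sol (ρ' := ρ / 2) (by linarith) hn hγ
  set y := sol (freq ω) c with hydef
  set N := γ⁻¹ * m.factorial / (ρ - ρ / 2) ^ m * M with hN
  have hdy : dif ω y = c - (c 0) • one := by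
    funext k
    by_cases hk : k = 0
    · subst hk; simp [dif_zero, one_zero]
    · simp only [Pi.sub_apply, Pi.smul_apply, one_ne hk, smul_zero, sub_zero]
      exact hn.mul_sol hγ c hk
  have hder : ∀ t, HasDerivAt (fun t => ev ω y t + c 0 * t) (a t : ℂ) t := fun t => by
    have h1 := (hasDerivAt_ev hy (by positivity) ω t).add
      (((hasDerivAt_id t).ofReal_comp).const_mul (c 0))
    refine HasDerivAt.congr_deriv h1 ?_
    rw [hdy, ev_sub hc hρ.le ((bd_one ρ).smul _) hρ.le, ev_smul, ev_one, ha]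
    simp
  have hint : ∀ T : ℝ, ((∫ t in (-T)..T, a t : ℝ) : ℂ) =
      ev ω y T - ev ω y (-T) + 2 * T * c 0 := fun T => by
    rw [← intervalIntegral.integral_ofReal]
    rw [intervalIntegral.integral_eq_sub_of_hasDerivAt (fun t _ => hder t)
      ((Complex.continuous_ofReal.comp hcont).intervalIntegrable _ _)]
    push_cast
    ring
  have hev : ∀ t, ‖ev ω y t‖ ≤ N := fun t => hy.norm_ev_le (by positivity) ω t
  have hlim : Tendsto (fun T : ℝ => ((1 / (2 * T) * ∫ t in (-T)..T, a t : ℝ) : ℂ)) atTop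
      (𝓝 (c 0)) := by
    rw [tendsto_iff_norm_sub_tendsto_zero]
    have h1 : Tendsto (fun T : ℝ => N / T) atTop (𝓝 0) := tendsto_const_nhds.div_atTop tendsto_id
    refine squeeze_zero' (Eventually.of_forall fun T => norm_nonneg _) ?_ h1
    filter_upwards [eventually_gt_atTop 0] with T hT
    have hT' : (T : ℂ) ≠ 0 := by exact_mod_cast hT.ne'
    have h2 : ((1 / (2 * T) * ∫ t in (-T)..T, a t : ℝ) : ℂ) - c 0 =
        (ev ω y T - ev ω y (-T)) / (2 * T : ℝ) := by
      rw [Complex.ofReal_mul, hint]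
      push_cast
      field_simp
      ring
    rw [h2, norm_div, Complex.norm_real, Real.norm_eq_abs, abs_of_pos (by positivity),
      div_le_div_iff₀ (by positivity) hT]
    have h3 := norm_sub_le (ev ω y T) (ev ω y (-T))
    nlinarith [hev T, hev (-T)]
  exact tendsto_nhds_unique hlim ((Complex.continuous_ofReal.tendsto A).comp hA)

lemma IsDiophantine.smallDiv {ω : Fin r → ℝ} {α τ : ℝ} (hα : 0 < α) (h : IsDiophantine ω α τ) :
    SmallDiv α ⌈τ⌉₊ (freq ω) := fun k hk => by
  refine le_trans ?_ (h k hk)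
  have hl := one_le_len hk
  change α / len k ^ ⌈τ⌉₊ ≤ α / len k ^ τ
  rw [← Real.rpow_natCast]
  exact div_le_div_of_nonneg_left hα.le (Real.rpow_pos_of_pos (by linarith) _)
    (Real.rpow_le_rpow_of_exponent_le hl (Nat.le_ceil τ))

lemma SmallDiv.mono {γ γ' : ℝ} {m m' : ℕ} {f : (Fin r → ℤ) → ℝ} (h : SmallDiv γ m f)
    (hγ' : 0 ≤ γ') (hγ : γ' ≤ γ) (hm : m ≤ m') : SmallDiv γ' m' f := fun k hk => by
  refine le_trans ?_ (h k hk)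
  have hl := one_le_len hk
  have := pow_le_pow_right₀ hl hm
  have : 0 < len k ^ m := by positivity
  have hγ0 : 0 ≤ γ := hγ'.trans hγ
  gcongr

lemma summable_poly : Summable fun k : Fin r → ℤ => ∏ j, (1 / (1 + |(k j : ℝ)|) ^ 2) := by
  refine summable_prod_int (f := fun n : ℤ => 1 / (1 + |(n : ℝ)|) ^ 2) ?_ fun n => by positivity
  have h1 : Summable fun n : ℕ => 1 / (1 + (n : ℝ)) ^ 2 := by
    have h2 := (summable_nat_add_iff 1).2 (Real.summable_one_div_nat_pow.2 one_lt_two)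
    refine h2.congr fun n => ?_
    push_cast
    ring_nf
  refine Summable.of_nat_of_neg ?_ ?_
  · simpa using h1
  · simpa using h1

/-- For k ≠ 0 each factor 1 + |k_j| is at most 2|k|; thus |k|^{-2r} is dominated by a product
summable over ℤʳ. -/
lemma one_div_len_pow_le {k : Fin r → ℤ} (hk : k ≠ 0) :
    1 / len k ^ (2 * r) ≤ 4 ^ r * ∏ j, (1 / (1 + |(k j : ℝ)|) ^ 2) := by
  have hl := one_le_len hk
  have h1 : ∏ j, (1 + |(k j : ℝ)|) ^ 2 ≤ 4 ^ r * len k ^ (2 * r) := by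
    calc ∏ j, (1 + |(k j : ℝ)|) ^ 2 ≤ ∏ _j : Fin r, (2 * len k) ^ 2 := by
          refine Finset.prod_le_prod (fun j _ => by positivity) fun j _ => ?_
          have : |(k j : ℝ)| ≤ len k := Finset.single_le_sum (f := fun j => |(k j : ℝ)|)
            (fun _ _ => abs_nonneg _) (Finset.mem_univ j)
          gcongr
          linarith
      _ = 4 ^ r * len k ^ (2 * r) := by
          rw [Finset.prod_const, Finset.card_univ, Fintype.card_fin, mul_pow, mul_pow,
            ← pow_mul (len k)]
          norm_num
  have h2 : 0 < ∏ j, (1 + |(k j : ℝ)|) ^ 2 := Finset.prod_pos fun j _ => by positivity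
  rw [Finset.prod_div_distrib, Finset.prod_const_one, mul_one_div, div_le_div_iff₀ (by positivity) h2]
  linarith

/-- The resonant exponents `μ ≤ μ₀` have measure `O(μ₀²)`. -/
lemma exists_resonant_bound {ω : Fin r → ℝ} {α : ℝ} {m : ℕ} (hα : 0 < α)
    (hn : SmallDiv α m (freq ω)) :
    ∃ C : ℝ, 0 ≤ C ∧ ∀ μ₀ : ℝ, 0 < μ₀ →
      volume {μ | μ ∈ Ioc 0 μ₀ ∧ ¬ SmallDiv (α / 2) (2 * m + 2 * r) (fun k => freq ω k + 2 * μ)} ≤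
        ENNReal.ofReal (C * μ₀ ^ 2) := by
  let f : (Fin r → ℤ) → ℝ := fun k => ∏ j, (1 / (1 + |(k j : ℝ)|) ^ 2)
  have hf : Summable f := summable_poly
  have hf0 : ∀ k, 0 ≤ f k := fun k => Finset.prod_nonneg fun j _ => by positivity
  let C₀ := α / 2 * (4 / α) ^ 2 * 4 ^ r
  refine ⟨C₀ * ∑' k, f k, mul_nonneg (by positivity) (tsum_nonneg hf0), fun μ₀ hμ₀ => ?_⟩
  let B : (Fin r → ℤ) → Set ℝ := fun k =>
    {μ | k ≠ 0 ∧ μ ∈ Ioc 0 μ₀ ∧ |freq ω k + 2 * μ| < α / 2 / len k ^ (2 * m + 2 * r)}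
  have hsub : {μ | μ ∈ Ioc 0 μ₀ ∧
      ¬ SmallDiv (α / 2) (2 * m + 2 * r) (fun k => freq ω k + 2 * μ)} ⊆ ⋃ k, B k := by
    rintro μ ⟨hμ, hs⟩
    unfold SmallDiv at hs
    push Not at hs
    obtain ⟨k, hk, hlt⟩ := hs
    exact mem_iUnion.2 ⟨k, hk, hμ, hlt⟩
  have hB : ∀ k, volume (B k) ≤ ENNReal.ofReal (C₀ * μ₀ ^ 2 * f k) := fun k => by
    by_cases hne : (B k).Nonempty
    · obtain ⟨ν, hk, hν, hlt⟩ := hne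
      have hl := one_le_len hk
      have hlm : 0 < len k ^ m := by positivity
      have h1 := hn k hk
      have h2 : α / 2 / len k ^ (2 * m + 2 * r) ≤ α / 2 / len k ^ m := by
        have := pow_le_pow_right₀ hl (by omega : m ≤ 2 * m + 2 * r)
        gcongr
      have h3 : |freq ω k| ≤ |freq ω k + 2 * ν| + 2 * ν := by
        have := abs_sub (freq ω k + 2 * ν) (2 * ν)
        rw [add_sub_cancel_right, abs_of_pos (by linarith [hν.1] : 0 < 2 * ν)] at this
        exact this
      -- A resonance with 2ν ≤ 2μ₀ forces ⟨k,ω⟩ to be of size at most about μ₀, so by nonresonance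
      -- of ω only long k contribute.
      have h4 : 1 / len k ^ m ≤ 4 / α * μ₀ := by
        have h5 : α / len k ^ m - α / 2 / len k ^ m = α / 2 * (1 / len k ^ m) := by ring
        have h6 : α / 2 * (1 / len k ^ m) ≤ 2 * μ₀ := by linarith [hν.2]
        rw [div_mul_eq_mul_div, le_div_iff₀ hα]
        linarith
      have hsub2 : B k ⊆ Metric.closedBall (-freq ω k / 2) (α / 2 / len k ^ (2 * m + 2 * r) / 2) := by
        rintro μ ⟨-, -, hμ⟩
        rw [Metric.mem_closedBall, Real.dist_eq]
        have : μ - -freq ω k / 2 = (freq ω k + 2 * μ) / 2 := by ring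
        rw [this, abs_div, abs_two]
        linarith
      refine (measure_mono hsub2).trans ?_
      rw [Real.volume_closedBall]
      refine ENNReal.ofReal_le_ofReal ?_
      -- This is why the exponent is 2m + 2r: the part |k|^{-2m} yields μ₀², and |k|^{-2r} makes the
      -- sum over k converge.
      have h7 : α / 2 / len k ^ (2 * m + 2 * r) =
          α / 2 * (1 / len k ^ m) ^ 2 * (1 / len k ^ (2 * r)) := by
        rw [pow_add, pow_mul', _root_.one_div_pow]
        field_simp
      have h8 : α / 2 * (1 / len k ^ m) ^ 2 * (1 / len k ^ (2 * r)) ≤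
          α / 2 * (4 / α * μ₀) ^ 2 * (4 ^ r * f k) := by
        have := one_div_len_pow_le hk
        gcongr
      calc 2 * (α / 2 / len k ^ (2 * m + 2 * r) / 2) = α / 2 / len k ^ (2 * m + 2 * r) := by ring
        _ ≤ α / 2 * (4 / α * μ₀) ^ 2 * (4 ^ r * f k) := by rw [h7]; exact h8
        _ = C₀ * μ₀ ^ 2 * f k := by simp only [C₀]; ring
    · rw [not_nonempty_iff_eq_empty.1 hne, measure_empty]
      exact zero_le
  have hC : 0 ≤ C₀ * μ₀ ^ 2 := by positivity
  calc _ ≤ volume (⋃ k, B k) := measure_mono hsub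
    _ ≤ ∑' k, volume (B k) := measure_iUnion_le _
    _ ≤ ∑' k, ENNReal.ofReal (C₀ * μ₀ ^ 2 * f k) := ENNReal.tsum_le_tsum hB
    _ = ENNReal.ofReal (∑' k, C₀ * μ₀ ^ 2 * f k) :=
        (ENNReal.ofReal_tsum_of_nonneg (fun k => mul_nonneg hC (hf0 k)) (hf.mul_left _)).symm
    _ = _ := by rw [tsum_mul_left]; ring_nf

end QPHill

/-! ### From good exponents to good parameters. -/

namespace QPHill

open Complex (I)
open scoped ENNReal NNReal

variable {r : ℕ}

lemma isClosed_smallDiv (ω : Fin r → ℝ) (γ : ℝ) (m : ℕ) :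
    IsClosed {μ : ℝ | SmallDiv γ m (fun k => freq ω k + 2 * μ)} := by
  simp only [SmallDiv, ofPred_forall]
  exact isClosed_iInter fun k => isClosed_iInter fun _ =>
    isClosed_le continuous_const (by fun_prop)

lemma Floquet.mono {a : ℝ → ℝ} {μ h h' : ℝ} {ε : ℂ} {u v : ℝ → ℂ} (hu : Floquet a μ ε h u v)
    (hμ : 0 ≤ μ) (hh : h ≤ h') : Floquet a μ ε h' u v where
  deriv_u := hu.deriv_u
  deriv_v := hu.deriv_v
  norm_u t := (hu.norm_u t).trans hh
  norm_v t := (hu.norm_v t).trans (mul_le_mul_of_nonneg_right hh hμ)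

/-- For every nonresonant small exponent `μ` there is a real parameter for which Hill's equation
has the Floquet exponent `iμ`, and it is reducible there. -/
lemma exists_reducible {ω : Fin r → ℝ} {γ ρ M A K : ℝ} {m : ℕ} {a : ℝ → ℝ}
    {c : (Fin r → ℤ) → ℂ} (hγ : 0 < γ) (hn : SmallDiv γ m (freq ω)) (hρ : 0 < ρ) (hA : 0 < A)
    (hc : Bd ρ c M) (hac : ∀ t, (a t : ℂ) = ev ω c t) (hc0 : c 0 = A) (hcont : Continuous a)
    (hK : ∀ t, |a t| ≤ K) (hav : HasAverage a A) :
    ∃ μ₁ H : ℝ, 0 < μ₁ ∧ 0 ≤ H ∧ H * μ₁ ≤ 1 / 10 ∧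
      ∀ μ, 0 < μ → μ ≤ μ₁ → SmallDiv γ m (fun k => freq ω k + 2 * μ) →
        ∃ ε : ℝ, (∃ u v, Floquet a μ ε (H * μ) u v) ∧
          IsReducible ω (fun t => hillA + ε • hillQ a t) := by
  obtain ⟨μ₂, C, hμ₂, hC, hsol⟩ := exists_floquet hγ hn hρ hA hc hc0
  obtain ⟨W, hW, hWω⟩ := abs_freq_le ω
  have hK0 : 0 ≤ K := (abs_nonneg _).trans (hK 0)
  -- The two terms bound w and w'. Both are O(μ²): for w' one factor μ goes into h = Hμ and the
  -- other is the μ in `norm_v`.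
  set H := C + W / (ρ / 2 - ρ / 4) * C with hH
  have hd : 0 < ρ / 2 - ρ / 4 := by linarith
  have hH0 : 0 ≤ H := by positivity
  -- The three summands ensure H/L ≤ 1/10 for reducibility, 5(H/L)K < A for reality of ε, and 1/L ≤
  -- 1.
  set L := 10 * H + (5 * H * K + 1) / A + 1 with hL
  have hLp : 0 < L := by positivity
  have hL1 : H * (1 / L) ≤ 1 / 10 := by
    rw [mul_one_div, div_le_div_iff₀ hLp (by norm_num)]
    have : 0 ≤ (5 * H * K + 1) / A := by positivity
    linarith
  have hL2 : 5 * (H * (1 / L)) * K < A := by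
    have h1 : (5 * H * K + 1) / A < L := by rw [hL]; linarith
    rw [div_lt_iff₀ hA] at h1
    have : 5 * (H * (1 / L)) * K = 5 * H * K / L := by ring
    rw [this, div_lt_iff₀ hLp]
    linarith
  have hL3 : 1 / L ≤ 1 := by
    rw [div_le_one hLp]
    have : 0 ≤ (5 * H * K + 1) / A := by positivity
    linarith
  have hmin : min μ₂ (1 / L) ≤ 1 / L := min_le_right _ _
  refine ⟨min μ₂ (1 / L), H, by positivity, hH0,
    (mul_le_mul_of_nonneg_left hmin hH0).trans hL1, fun μ hμ hμle hμn => ?_⟩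
  obtain ⟨ε, w, hw, heq⟩ := hsol μ hμ (hμle.trans (min_le_left _ _)) hμn
  have hμL : μ ≤ 1 / L := hμle.trans hmin
  have hμ1 : μ ≤ 1 := hμL.trans hL3
  have hw1 : Bd (ρ / 4) (dif ω w) _ := hw.dif (by linarith) hW hWω
  have hflo : Floquet a μ ε (H * μ) (fun t => 1 + ev ω w t) (fun t => ev ω (dif ω w) t) := by
    refine ⟨fun t => ?_, fun t => ?_, fun t => ?_, fun t => ?_⟩
    · exact (hasDerivAt_ev hw (by positivity) ω t).const_add 1
    · refine (hasDerivAt_ev hw1 (by positivity) ω t).congr_deriv ?_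
      rw [hac]
      linear_combination heq t
    · rw [add_sub_cancel_left]
      refine (hw.norm_ev_le (by positivity) ω t).trans ?_
      have h1 : C * μ ^ 2 ≤ C * μ := by
        have : μ ^ 2 ≤ μ := by nlinarith
        gcongr
      have h2 : 0 ≤ W / (ρ / 2 - ρ / 4) * C * μ := by positivity
      rw [hH]
      linarith
    · refine (hw1.norm_ev_le (by positivity) ω t).trans ?_
      have h2 : 0 ≤ C * μ * μ := by positivity
      rw [hH]
      linarith
  have hh : H * μ ≤ H * (1 / L) := mul_le_mul_of_nonneg_left hμL hH0
  have hreal := hflo.param_real hμ.le (by linarith) hcont hK hav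
    (lt_of_le_of_lt (by gcongr) hL2)
  rw [hreal] at hflo
  refine ⟨ε.re, ⟨_, _, hflo⟩, hflo.reducible hμ (hh.trans hL1) (ρ := ρ / 8) (by positivity)
    fun x z => ⟨?_, ?_⟩⟩
  all_goals
    have hu := ((bd_one (r := r) (ρ / 4)).add (hw.mono (by linarith : ρ / 4 ≤ ρ / 2) le_rfl))
    have hue : ∀ t, ev ω (one + w) t = 1 + ev ω w t := fun t => by
      rw [ev_add (bd_one (ρ / 4)) (by positivity) hw (by positivity), ev_one]
  · have := isAnalyticQP_re (ω := ω) (ρ' := ρ / 8) (hu.smul (x * z)) (by linarith) (by positivity)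
    simp only [ev_smul, hue, mul_assoc, Complex.re_ofReal_mul] at this
    exact this
  · have := isAnalyticQP_re (ω := ω) (ρ' := ρ / 8) ((hw1.add (hu.smul (I * μ))).smul (x * z))
      (by linarith) (by positivity)
    simp only [ev_smul, ev_add hw1 (by positivity : 0 ≤ ρ / 4) (hu.smul (I * μ))
      (by positivity : 0 ≤ ρ / 4), hue, mul_assoc (x : ℂ), Complex.re_ofReal_mul] at this
    exact this

/-- A map which is close to `μ ↦ μ² / A` on a set of almost full measure near `0` has an image of
almost full measure near `0`. -/
lemma exists_compact_image {A c C μ₁ : ℝ} {P : ℝ → Prop} {e : ℝ → ℝ} (hA : 0 < A) (hc : 0 ≤ c)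
    (hC : 0 ≤ C) (hμ₁ : 0 < μ₁) (hPc : IsClosed {μ | P μ})
    (hPm : ∀ μ₀, 0 < μ₀ → volume {μ | μ ∈ Ioc 0 μ₀ ∧ ¬ P μ} ≤ ENNReal.ofReal (C * μ₀ ^ 2))
    (he0 : ∀ μ₀ ≤ μ₁, ∀ μ ∈ Ioc 0 μ₀, P μ → |e μ * A - μ ^ 2| ≤ c * μ₀ * (|e μ| * A + μ ^ 2))
    (he : ∀ μ₀ ≤ μ₁, ∀ μ ∈ Ioc 0 μ₀, P μ → ∀ ν ∈ Ioc 0 μ₀, P ν →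
      |(e μ - e ν) * A - (μ ^ 2 - ν ^ 2)| ≤ c * μ₀ * (|e μ - e ν| * A + |μ ^ 2 - ν ^ 2|)) :
    ∃ D s₁ : ℝ, 0 ≤ D ∧ 0 < s₁ ∧ ∀ s, 0 < s → s ≤ s₁ → ∃ K, IsCompact K ∧ K ⊆ Ioo 0 (s ^ 2) ∧
      K ⊆ e '' {μ | μ ∈ Ioc 0 μ₁ ∧ P μ} ∧ s ^ 2 * (1 - D * s) ≤ volume.real K := by
  set q := √A with hq
  have hq0 : 0 < q := Real.sqrt_pos.2 hA
  have hqA : q ^ 2 = A := Real.sq_sqrt hA.le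
  set b := c * q + 1 with hb
  have hb0 : 0 < b := by positivity
  set D₁ := 4 * b + 1 + 2 * C * q with hD₁
  have hD₁0 : 0 ≤ D₁ := by positivity
  refine ⟨D₁ + 3 * b, min (μ₁ / q) (min (1 / (10 * (b + 1))) 1), by positivity, by positivity,
    fun s hs hs₁ => ?_⟩
  -- With μ = √(Ax), the range x ≤ s² corresponds to μ ≤ √A·s, and x ↦ e(√(Ax)) is close to the
  -- identity.
  set μ₀ := q * s with hμ₀
  have hμ₀p : 0 < μ₀ := by positivity
  have hμ₀1 : μ₀ ≤ μ₁ := by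
    have := hs₁.trans (min_le_left _ _)
    rw [le_div_iff₀ hq0] at this
    linarith
  set η := b * s with hη
  have hη0 : 0 < η := by positivity
  have hcη : c * μ₀ ≤ η := by rw [hη, hb, hμ₀]; linarith
  have hη1 : η ≤ 1 / 10 := by
    have := hs₁.trans ((min_le_right _ _).trans (min_le_left _ _))
    rw [le_div_iff₀ (by positivity)] at this
    nlinarith
  have hs1 : s ≤ 1 := hs₁.trans ((min_le_right _ _).trans (min_le_right _ _))
  -- Since g may stretch by 1 + 3η, this upper cut keeps the image below s². The lower cut s³ keeps
  -- S compact away from 0; both cost O(s³).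
  set x₀ := s ^ 2 / (1 + 4 * η) with hx₀
  have hx₀s : x₀ ≤ s ^ 2 := div_le_self (by positivity) (by linarith)
  have hx₁p : 0 < s ^ 3 := by positivity
  let S : Set ℝ := {x | x ∈ Icc (s ^ 3) x₀ ∧ P √(A * x)}
  have hSc : IsCompact S := isCompact_Icc.inter_right
    (hPc.preimage (Real.continuous_sqrt.comp (continuous_const.mul continuous_id)))
  have hsq : ∀ x, 0 < x → √(A * x) ^ 2 = A * x := fun x hx => Real.sq_sqrt (by positivity)
  have hmem : ∀ x ∈ Icc (s ^ 3) x₀, √(A * x) ∈ Ioc 0 μ₀ := fun x hx => by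
    have hx0 : 0 < x := hx₁p.trans_le hx.1
    refine ⟨Real.sqrt_pos.2 (by positivity), ?_⟩
    rw [Real.sqrt_le_left hμ₀p.le, hμ₀, mul_pow, hqA]
    have := hx.2.trans hx₀s
    gcongr
  let g : ℝ → ℝ := fun x => e √(A * x)
  have hg : ∀ x ∈ S, ∀ y ∈ S, |(g x - g y) - (x - y)| ≤ η * (|g x - g y| + |x - y|) :=
    fun x hx y hy => by
      have h1 := he μ₀ hμ₀1 _ (hmem x hx.1) hx.2 _ (hmem y hy.1) hy.2
      replace h1 := h1.trans (mul_le_mul_of_nonneg_right hcη (by positivity))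
      rw [hsq x (hx₁p.trans_le hx.1.1), hsq y (hx₁p.trans_le hy.1.1), ← mul_sub, abs_mul,
        abs_of_pos hA] at h1
      have h2 : (g x - g y) * A - A * (x - y) = A * (g x - g y - (x - y)) := by ring
      change |(g x - g y) * A - A * (x - y)| ≤ η * (|g x - g y| * A + A * |x - y|) at h1
      rw [h2, abs_mul, abs_of_pos hA] at h1
      refine le_of_mul_le_mul_left ?_ hA
      linarith
  have hg0 : ∀ x ∈ S, |g x - x| ≤ η * (|g x| + x) := fun x hx => by
    have h1 := he0 μ₀ hμ₀1 _ (hmem x hx.1) hx.2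
    replace h1 := h1.trans (mul_le_mul_of_nonneg_right hcη (by positivity))
    rw [hsq x (hx₁p.trans_le hx.1.1)] at h1
    have h2 : g x * A - A * x = A * (g x - x) := by ring
    change |g x * A - A * x| ≤ η * (|g x| * A + A * x) at h1
    rw [h2, abs_mul, abs_of_pos hA] at h1
    refine le_of_mul_le_mul_left ?_ hA
    linarith
  -- This crude upper bound serves only for continuity and compactness; the measure estimate uses
  -- the sharper lower bound `hlow`.
  have hup : ∀ x ∈ S, ∀ y ∈ S, |g x - g y| ≤ 3 * |x - y| := fun x hx y hy => by
    have h1 := hg x hx y hy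
    have h2 := abs_sub_abs_le_abs_sub (g x - g y) (x - y)
    nlinarith [abs_nonneg (g x - g y), abs_nonneg (x - y)]
  have hlow : ∀ x ∈ S, ∀ y ∈ S, |x - y| ≤ (1 + 3 * η) * |g x - g y| := fun x hx y hy => by
    have h1 := hg x hx y hy
    have h2 := abs_sub_abs_le_abs_sub (x - y) (g x - g y)
    rw [abs_sub_comm (x - y)] at h2
    have h3 : (1 - η) * |x - y| ≤ (1 - η) * ((1 + 3 * η) * |g x - g y|) := by
      have h4 : (1 + η) * |g x - g y| ≤ (1 - η) * (1 + 3 * η) * |g x - g y| := by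
        refine mul_le_mul_of_nonneg_right ?_ (abs_nonneg _)
        nlinarith
      linarith
    exact le_of_mul_le_mul_left h3 (by linarith)
  have hgS : g '' S ⊆ Ioo 0 (s ^ 2) := by
    rintro _ ⟨x, hx, rfl⟩
    have hxp : 0 < x := hx₁p.trans_le hx.1.1
    have h1 := hg0 x hx
    have h2 := abs_le.1 h1
    have hpos : 0 < g x := by
      by_contra hle
      rw [abs_of_nonpos (not_lt.1 hle)] at h2
      nlinarith
    refine ⟨hpos, ?_⟩
    rw [abs_of_pos hpos] at h2
    have h3 : g x ≤ (1 + 3 * η) * x := by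
      have h4 : (1 + η) * x ≤ (1 - η) * (1 + 3 * η) * x := by
        refine mul_le_mul_of_nonneg_right ?_ hxp.le
        nlinarith
      have h5 : (1 - η) * g x ≤ (1 - η) * ((1 + 3 * η) * x) := by linarith
      exact le_of_mul_le_mul_left h5 (by linarith)
    have h6 : x * (1 + 4 * η) ≤ s ^ 2 := by
      have := hx.1.2
      rwa [hx₀, le_div_iff₀ (by linarith)] at this
    have h7 : 0 < η * x := by positivity
    linarith
  have hgl : LipschitzOnWith 3 g S := LipschitzOnWith.of_dist_le_mul fun x hx y hy => by
    simpa [Real.dist_eq] using hup x hx y hy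
  have hinj : InjOn g S := fun x hx y hy hxy => by
    have := hlow x hx y hy
    rw [hxy, sub_self, abs_zero, mul_zero] at this
    exact sub_eq_zero.1 (abs_nonpos_iff.1 this)
  have hK : IsCompact (g '' S) := hSc.image_of_continuousOn hgl.continuousOn
  -- The measure of the image is bounded below by applying the Lipschitz estimate to the inverse
  -- map, with constant 1 + 3η.
  have hvS : volume.real S ≤ (1 + 3 * η) * volume.real (g '' S) := by
    have hinv : LipschitzOnWith (1 + 3 * η).toNNReal (Function.invFunOn g S) (g '' S) :=
      LipschitzOnWith.of_dist_le_mul (by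
        rintro _ ⟨x, hx, rfl⟩ _ ⟨y, hy, rfl⟩
        rw [hinj.leftInvOn_invFunOn hx, hinj.leftInvOn_invFunOn hy,
          Real.coe_toNNReal _ (by linarith)]
        simpa [Real.dist_eq] using hlow x hx y hy)
    have h1 := volume_image_le hinv
    rw [hinj.leftInvOn_invFunOn.image_image] at h1
    have h2 := ENNReal.toReal_mono (ENNReal.mul_ne_top ENNReal.coe_ne_top hK.measure_lt_top.ne) h1
    rwa [ENNReal.toReal_mul, ENNReal.coe_toReal, Real.coe_toNNReal _ (by linarith)] at h2
  -- The bad x are images of bad exponents under μ²/A, whose Lipschitz constant is O(μ₀); with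
  -- measure O(μ₀²) for the exponents this gives O(s³).
  have hvol : x₀ - s ^ 3 ≤ volume.real S + 2 * μ₀ / A * (C * μ₀ ^ 2) := by
    set Bad : Set ℝ := {μ | μ ∈ Ioc 0 μ₀ ∧ ¬ P μ} with hBad
    have hlip : LipschitzOnWith (2 * μ₀ / A).toNNReal (fun μ => μ ^ 2 / A) Bad :=
      LipschitzOnWith.of_dist_le_mul fun x hx y hy => by
        have h0 : 0 ≤ 2 * μ₀ / A := by positivity
        rw [Real.coe_toNNReal _ h0, Real.dist_eq, Real.dist_eq]
        have h1 : x ^ 2 / A - y ^ 2 / A = (x + y) / A * (x - y) := by ring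
        have hx1 := hx.1
        have hy1 := hy.1
        have h2 : 0 ≤ (x + y) / A := div_nonneg (by linarith [hx1.1, hy1.1]) hA.le
        rw [h1, abs_mul, abs_of_nonneg h2]
        have h3 : x + y ≤ 2 * μ₀ := by linarith [hx1.2, hy1.2]
        gcongr
    have hcov : Icc (s ^ 3) x₀ ⊆ S ∪ (fun μ => μ ^ 2 / A) '' Bad := fun x hx => by
      by_cases hP : P √(A * x)
      · exact Or.inl ⟨hx, hP⟩
      · refine Or.inr ⟨√(A * x), ⟨hmem x hx, hP⟩, ?_⟩
        simp only
        rw [hsq x (hx₁p.trans_le hx.1), mul_div_cancel_left₀ _ hA.ne']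
    have h1 : ENNReal.ofReal (x₀ - s ^ 3) ≤
        volume S + ENNReal.ofReal (2 * μ₀ / A * (C * μ₀ ^ 2)) := by
      rw [← Real.volume_Icc]
      refine (measure_mono hcov).trans ((measure_union_le _ _).trans ?_)
      gcongr
      refine (volume_image_le hlip).trans ?_
      rw [ENNReal.ofReal_mul (by positivity)]
      exact mul_le_mul_right (hPm μ₀ hμ₀p) _
    have h2 := ENNReal.toReal_mono
      (ENNReal.add_ne_top.2 ⟨hSc.measure_lt_top.ne, ENNReal.ofReal_ne_top⟩) h1
    rw [ENNReal.toReal_add hSc.measure_lt_top.ne ENNReal.ofReal_ne_top,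
      ENNReal.toReal_ofReal', ENNReal.toReal_ofReal (by positivity)] at h2
    exact (le_max_left _ _).trans h2
  refine ⟨g '' S, hK, hgS, ?_, ?_⟩
  · rintro _ ⟨x, hx, rfl⟩
    have := hmem x hx.1
    exact ⟨_, ⟨⟨this.1, this.2.trans hμ₀1⟩, hx.2⟩, rfl⟩
  · have h1 : s ^ 2 * (1 - 4 * η) ≤ x₀ := by
      rw [hx₀, le_div_iff₀ (by linarith)]
      have : 0 ≤ s ^ 2 * (16 * η ^ 2) := by positivity
      linarith
    have h2 : 2 * μ₀ / A * (C * μ₀ ^ 2) = 2 * C * q * s ^ 3 := by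
      rw [hμ₀, ← hqA]
      field_simp
    have h3 : s ^ 2 * (1 - D₁ * s) ≤ volume.real S := by
      rw [hD₁]
      rw [hη] at h1
      linarith
    have h4 : (1 + 3 * η) * (s ^ 2 * (1 - (D₁ + 3 * b) * s)) ≤ s ^ 2 * (1 - D₁ * s) := by
      have : 0 ≤ s ^ 2 * (3 * b * s * ((D₁ + 3 * b) * s)) := by positivity
      rw [hη]
      linarith
    exact le_of_mul_le_mul_left (h4.trans (h3.trans hvS)) (by linarith)

/-- With ε₀ = s² the exponents fill a range of order s, so every relative error is linear in s. -/
lemma exists_cantor_params {ω : Fin r → ℝ} {α τ ρ A : ℝ} (hα : 0 < α)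
    (hω : IsDiophantine ω α τ) (hρ : 0 < ρ) {a : ℝ → ℝ} (ha : IsAnalyticQP ω ρ a)
    (hav : HasAverage a A) (hA : 0 < A) :
    ∃ D s₁ : ℝ, 0 ≤ D ∧ 0 < s₁ ∧ ∀ s, 0 < s → s ≤ s₁ → ∃ E, IsCantorSet E ∧ E ⊆ Ioo 0 (s ^ 2) ∧
      0 < volume E ∧ s ^ 2 * (1 - D * s) ≤ volume.real E ∧
      ∀ ε ∈ E, IsReducible ω (fun t => hillA + ε • hillQ a t) := by
  obtain ⟨c, M, hc, hac⟩ := exists_coeff hρ ha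
  have hcont : Continuous a := by
    have h1 : Continuous (ev ω c) := continuous_iff_continuousAt.2 fun t =>
      (hasDerivAt_ev hc (by positivity) ω t).continuousAt
    refine (Complex.continuous_re.comp h1).congr fun t => ?_
    rw [Function.comp_apply, ← hac, Complex.ofReal_re]
  have hK : ∀ t, |a t| ≤ M := fun t => by
    have := hc.norm_ev_le (by positivity) ω t
    rwa [← hac, Complex.norm_real] at this
  have hM := hc.nonneg
  have hn₀ := hω.smallDiv hα
  have hc0 := coeff_zero_eq_average hα hn₀ (by positivity : 0 < ρ / 4) hc hac hcont hav
  obtain ⟨C, hC, hres⟩ := exists_resonant_bound hα hn₀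
  set m := 2 * ⌈τ⌉₊ + 2 * r with hm
  have hn : SmallDiv (α / 2) m (freq ω) :=
    hn₀.mono (by positivity) (by linarith) (by omega)
  obtain ⟨μ₁, H, hμ₁, hH, hHμ, hred⟩ := exists_reducible (by positivity) hn
    (by positivity : 0 < ρ / 4) hA hc hac hc0 hcont hK hav
  let P : ℝ → Prop := fun μ => SmallDiv (α / 2) m (fun k => freq ω k + 2 * μ)
  -- The parameter is selected pointwise with no regularity in μ; the pair estimate provides it
  -- afterwards. Outside the good set the value is a dummy.
  have hex : ∀ μ, ∃ ε : ℝ, μ ∈ Ioc 0 μ₁ → P μ → (∃ u v, Floquet a μ ε (H * μ) u v) ∧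
      IsReducible ω (fun t => hillA + ε • hillQ a t) := fun μ => by
    by_cases h : μ ∈ Ioc 0 μ₁ ∧ P μ
    · obtain ⟨ε, hε⟩ := hred μ h.1.1 h.1.2 h.2
      exact ⟨ε, fun _ _ => hε⟩
    · exact ⟨0, fun h1 h2 => absurd ⟨h1, h2⟩ h⟩
  choose e he using hex
  set κ := 5 * H * (M / A + 1) with hκ
  have hκ0 : 0 ≤ κ := by positivity
  have hest : ∀ μ₀, 0 < μ₀ → μ₀ ≤ μ₁ → ∀ μ ν x y : ℝ, 0 ≤ μ → 0 ≤ ν → ∀ u v p q,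
      Floquet a μ x (H * μ₀) u v → Floquet a ν y (H * μ₀) p q →
      |(x - y) * A - (μ ^ 2 - ν ^ 2)| ≤ κ * μ₀ * (|x - y| * A + |μ ^ 2 - ν ^ 2|) := by
    intro μ₀ hμ₀ hle μ ν x y hμ hν u v p q h1 h2
    have hsm : H * μ₀ ≤ H * μ₁ := mul_le_mul_of_nonneg_left hle hH
    have h3 := h1.pair_estimate h2 hμ hν (by linarith) hcont hK hav
    rw [Complex.conj_ofReal, ← Complex.ofReal_sub, ← Complex.ofReal_mul, ← Complex.ofReal_sub,
      Complex.norm_real, Complex.norm_real, Real.norm_eq_abs, Real.norm_eq_abs] at h3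
    refine h3.trans ?_
    have h4 : M = M / A * A := by field_simp
    have h5 : κ * μ₀ * (|x - y| * A + |μ ^ 2 - ν ^ 2|) =
        5 * (H * μ₀) * (M / A * A * |x - y| + |μ ^ 2 - ν ^ 2|) +
        5 * (H * μ₀) * (|x - y| * A + M / A * |μ ^ 2 - ν ^ 2|) := by rw [hκ]; ring
    rw [h5, ← h4]
    have : 0 ≤ 5 * (H * μ₀) * (|x - y| * A + M / A * |μ ^ 2 - ν ^ 2|) := by positivity
    linarith
  obtain ⟨D, s₁, hD, hs₁, himg⟩ := exists_compact_image (P := P) (e := e) (c := κ) hA hκ0 hC hμ₁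
    (isClosed_smallDiv ω _ _) hres
    (fun μ₀ hle μ hμ hP => by
      have hμ₀ : 0 < μ₀ := hμ.1.trans_le hμ.2
      obtain ⟨⟨u, v, hu⟩, -⟩ := he μ ⟨hμ.1, hμ.2.trans hle⟩ hP
      -- Comparison with the trivial solution at exponent 0 and parameter 0 locates e μ near μ²/A.
      have := hest μ₀ hμ₀ hle μ 0 (e μ) 0 hμ.1.le le_rfl _ _ _ _
        (hu.mono hμ.1.le (mul_le_mul_of_nonneg_left hμ.2 hH))
        (by simpa using floquet_zero a (mul_nonneg hH hμ₀.le))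
      simpa using this)
    (fun μ₀ hle μ hμ hP ν hν hPν => by
      have hμ₀ : 0 < μ₀ := hμ.1.trans_le hμ.2
      obtain ⟨⟨u, v, hu⟩, -⟩ := he μ ⟨hμ.1, hμ.2.trans hle⟩ hP
      obtain ⟨⟨p, q, hp⟩, -⟩ := he ν ⟨hν.1, hν.2.trans hle⟩ hPν
      exact hest μ₀ hμ₀ hle μ ν (e μ) (e ν) hμ.1.le hν.1.le _ _ _ _
        (hu.mono hμ.1.le (mul_le_mul_of_nonneg_left hμ.2 hH))
        (hp.mono hν.1.le (mul_le_mul_of_nonneg_left hν.2 hH)))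
  -- The extra 1 absorbs the measure s³ given up for the Cantor subset, and the second bound on s
  -- keeps its measure positive.
  refine ⟨D + 1, min s₁ (1 / (2 * (D + 1))), by positivity, by positivity, fun s hs hle => ?_⟩
  obtain ⟨K, hKc, hKs, hKe, hKv⟩ := himg s hs (hle.trans (min_le_left _ _))
  have hsD : (D + 1) * s ≤ 1 / 2 := by
    have := hle.trans (min_le_right _ _)
    rw [le_div_iff₀ (by positivity)] at this
    linarith
  have hpos : 0 < s ^ 2 * (1 - (D + 1) * s) := mul_pos (by positivity) (by linarith)
  obtain ⟨E, hEK, hE, hEv⟩ := exists_cantor_subset hKc (δ := s ^ 3) (by positivity) (by linarith)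
  have hEv' : s ^ 2 * (1 - (D + 1) * s) ≤ volume.real E := by linarith
  refine ⟨E, hE, hEK.trans hKs, (ENNReal.toReal_pos_iff.1 (hpos.trans_le hEv')).1, hEv', ?_⟩
  intro ε hε
  obtain ⟨μ, ⟨hμ, hP⟩, rfl⟩ := hKe (hEK hε)
  exact (he μ hμ hP).2

end QPHill

theorem theorem4p1 (r : ℕ) (ω : Fin r → ℝ) (α τ ρ : ℝ)
    (hα : 0 < α) (hτ : (r : ℝ) - 1 < τ) (hω : QPHill.IsDiophantine ω α τ)
    (hρ : 0 < ρ) (a : ℝ → ℝ) (ha : QPHill.IsAnalyticQP ω ρ a)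
    (abar : ℝ) (habar : QPHill.HasAverage a abar) (hpos : 0 < abar) :
    ∃ εmax : ℝ, 0 < εmax ∧ ∃ E : ℝ → Set ℝ,
      (∀ ε₀ : ℝ, 0 < ε₀ → ε₀ ≤ εmax →
        QPHill.IsCantorSet (E ε₀) ∧ E ε₀ ⊆ Set.Ioo 0 ε₀ ∧
        0 < MeasureTheory.volume (E ε₀) ∧
        ∀ ε ∈ E ε₀,
          QPHill.IsReducible ω (fun t => QPHill.hillA + ε • QPHill.hillQ a t)) ∧
      Filter.Tendsto (fun ε₀ : ℝ => MeasureTheory.volume.real (E ε₀) / ε₀)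
        (nhdsWithin 0 (Set.Ioi 0)) (nhds 1) := by
  obtain ⟨D, s₁, hD, hs₁, h⟩ := QPHill.exists_cantor_params hα hω hρ ha habar hpos
  choose! E hE using h
  have hs : ∀ ε₀ : ℝ, 0 < ε₀ → ε₀ ≤ s₁ ^ 2 → 0 < √ε₀ ∧ √ε₀ ≤ s₁ ∧ √ε₀ ^ 2 = ε₀ :=
    fun ε₀ h0 h1 => ⟨Real.sqrt_pos.2 h0, (Real.sqrt_le_left hs₁.le).2 h1, Real.sq_sqrt h0.le⟩
  -- The sets for different ε₀ are chosen independently, with s = √ε₀; the relative measure is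
  -- squeezed between 1 - D√ε₀ and 1.
  refine ⟨s₁ ^ 2, by positivity, fun ε₀ => E √ε₀, fun ε₀ h0 h1 => ?_, ?_⟩
  · obtain ⟨h2, h3, h4⟩ := hs ε₀ h0 h1
    obtain ⟨e1, e2, e3, -, e5⟩ := hE _ h2 h3
    rw [h4] at e2
    exact ⟨e1, e2, e3, e5⟩
  · have hlow : Tendsto (fun ε₀ : ℝ => 1 - D * √ε₀) (𝓝[>] 0) (𝓝 1) := by
      have : Tendsto (fun ε₀ : ℝ => 1 - D * √ε₀) (𝓝 0) (𝓝 (1 - D * √0)) :=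
        Continuous.tendsto (by fun_prop) 0
      simp only [Real.sqrt_zero, mul_zero, sub_zero] at this
      exact this.mono_left nhdsWithin_le_nhds
    have hev : ∀ᶠ ε₀ : ℝ in 𝓝[>] 0, 0 < ε₀ ∧ ε₀ ≤ s₁ ^ 2 := by
      filter_upwards [Ioc_mem_nhdsGT (by positivity : (0 : ℝ) < s₁ ^ 2)] with x hx using hx
    refine tendsto_of_tendsto_of_tendsto_of_le_of_le' hlow tendsto_const_nhds ?_ ?_
    · filter_upwards [hev] with ε₀ hε
      obtain ⟨h2, h3, h4⟩ := hs ε₀ hε.1 hε.2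
      obtain ⟨-, -, -, e4, -⟩ := hE _ h2 h3
      rw [h4] at e4
      rw [le_div_iff₀ hε.1]
      linarith
    · filter_upwards [hev] with ε₀ hε
      obtain ⟨h2, h3, h4⟩ := hs ε₀ hε.1 hε.2
      obtain ⟨-, e2, -⟩ := hE _ h2 h3
      rw [h4] at e2
      rw [div_le_one hε.1]
      have := measureReal_mono e2 (by simp : volume (Ioo 0 ε₀) ≠ ⊤)
      rwa [Real.volume_real_Ioo_of_le hε.1.le, sub_zero] at this
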